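/- \textbf{Proposition (limiting absorption principle).} \emph{Setting.} Let $b:\mathbb R\to\mathbb R$ be smooth, with $b'(y)>c$ for all $y\in\mathbb R$ and some constant $c>0$, and $b''(y)=0$ for $y\notin[-2,2]$. For integers $k\ge1$ let $$G^{D}_k(y,z)=\frac1{k\sinh k}\begin{cases}\sinh(k(1-z))\sinh(ky),& y\le z,\\ \sinh(kz)\sinh(k(1-y)),& y\ge z,\end{cases}$$ be the Green function of $k^2-\frac{d^2}{dy^2}$ on $(0,1)$ with zero Dirichlet boundary conditions, and let $L_kg(y)=b(y)g(y)+b''(y)\int_0^1G^D_k(y,z)g(z)\,dz$ for $g\in L^2((0,1);\mathbb C)$. Assume that for every $k\ge1$ the operator $L_k$ has no embedded eigenvalue, i.e. no eigenvalue in $[b(0),b(1)]$ with a nonzero eigenfunction in $L^2((0,1);\mathbb C)$. Let $\delta_0>0$ and let $\Psi_k\in C^\infty(\mathbb R)$, $k\ge1$, be cutoff functions such that $\Psi_k=1$ on $[0,1]$, $0\le\Psi_k\le1$, $\operatorname{supp}\Psi_k\subseteq[-\delta_0/k,1+\delta_0/k]$, $\Psi_k'\ge0$ on $(-\delta_0/k,0)$,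 $\Psi_k'\le0$ on $(1,1+\delta_0/k)$, and $|\Psi_k'|\le Ck$ on $\mathbb R$ with a constant $C$ independent of $k$. Define the extended Green function, for $y,z\in\mathbb R$, by $$G_k(y,z)=\Psi_k(y)\Big[\frac1{2k}e^{-k|z-y|}-\frac{\sinh(k(1-y))}{2k\sinh k}e^{-k|z|}-\frac{\sinh(ky)}{2k\sinh k}e^{-k|z-1|}\Big],$$ which agrees with $G_k^D$ on $[0,1]^2$. Put $\mathcal G_k(v,v')=G_k(b^{-1}(v),b^{-1}(v'))$, $B(v)=b'(b^{-1}(v))$, and for $\epsilon\in\mathbb R\setminus\{0\}$, $w\in\mathbb R$ and $h\in H^1(\mathbb R;\mathbb C)$ $$T_{k,\epsilon}h(v,w)=\int_{\mathbb R}\mathcal G_k(v+w,v'+w)\,\partial_{v'}B(v'+w)\,\frac{h(v')}{v'+i\epsilon}\,dv' .$$ Let $\|h\|_{H^1_k(\mathbb R)}=k\|h\|_{L^2(\mathbb R)}+\|\partial_vh\|_{L^2(\mathbb R)}$. \emph{Claim.} There exists $\sigma_0>0$ such that for all $\epsilon\in[-\sigma_0,\sigma_0]\setminus\{0\}$, all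 integers $k\ge1$, all $f\in H^1(\mathbb R;\mathbb C)$ and all $w\in\mathbb R$, the function $f+T_{k,\epsilon}f(\cdot,w)$ belongs to $H^1(\mathbb R;\mathbb C)$ and $$\big\|f+T_{k,\epsilon}f(\cdot,w)\big\|_{H^1_k(\mathbb R)}\ \ge\ \sigma_0\,\|f\|_{H^1_k(\mathbb R)} .$$ -/

import Mathlib

open MeasureTheory Set
open scoped ContDiff

noncomputable section

namespace InviscidDamping

/-! ### The Sobolev space `H¹(ℝ; ℂ)` and its weighted norms -/

/-- `g` is the weak (distributional) derivative of `f` on the real line. -/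
def HasWeakDeriv (f g : ℝ → ℂ) : Prop :=
  LocallyIntegrable f ∧ LocallyIntegrable g ∧
    ∀ φ : ℝ → ℝ, ContDiff ℝ ∞ φ → HasCompactSupport φ →
      ∫ x, deriv φ x • f x = -∫ x, φ x • g x

/-- Weak derivatives are unique up to null sets. -/
theorem HasWeakDeriv.ae_eq {f g g' : ℝ → ℂ} (h : HasWeakDeriv f g) (h' : HasWeakDeriv f g') :
    g =ᵐ[volume] g' := by
  refine ae_eq_of_integral_contDiff_smul_eq h.2.1 h'.2.1 fun φ hφ hc => ?_
  exact neg_injective ((h.2.2 φ hφ hc).symm.trans (h'.2.2 φ hφ hc))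

open Classical in
/-- The weak derivative of `f` (a representative of its a.e.-class; `0` if there is none). -/
def weakDeriv (f : ℝ → ℂ) : ℝ → ℂ :=
  if h : ∃ g, HasWeakDeriv f g then h.choose else 0

theorem HasWeakDeriv.weakDeriv_ae_eq {f g : ℝ → ℂ} (h : HasWeakDeriv f g) :
    weakDeriv f =ᵐ[volume] g := by
  have hex : ∃ g, HasWeakDeriv f g := ⟨g, h⟩
  rw [weakDeriv, dif_pos hex]
  exact hex.choose_spec.ae_eq h

/-- `f ∈ H¹(ℝ)`: `f` is in `L²` and has a weak derivative in `L²`. -/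
def MemH1 (f : ℝ → ℂ) : Prop :=
  MemLp f 2 volume ∧ ∃ g, HasWeakDeriv f g ∧ MemLp g 2 volume

/-- The weighted norm `‖f‖_{H¹_k} = k ‖f‖_{L²} + ‖f'‖_{L²}` of `f ∈ H¹(ℝ)`. -/
def normH1 (k : ℕ) (f : ℝ → ℂ) : ℝ :=
  k * (eLpNorm f 2 volume).toReal + (eLpNorm (weakDeriv f) 2 volume).toReal

/-! ### The Green functions -/

/-- The Green function of `k² - d²/dy²` on `(0, 1)` with Dirichlet boundary conditions. -/
def dirichletGreen (k : ℕ) (y z : ℝ) : ℝ :=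
  1 / (k * Real.sinh k) *
    if y ≤ z then Real.sinh (k * (1 - z)) * Real.sinh (k * y)
    else Real.sinh (k * z) * Real.sinh (k * (1 - y))

/-- The extended Green function with cutoff `Ψ`: the bounded solution on the line, in the
variable `z`, of `(-d²/dz² + k²) G(y, z) =
Ψ(y) [δ(z - y) - sinh(k(1 - y)) / sinh k · δ(z) - sinh(k y) / sinh k · δ(z - 1)]`. -/
def extGreen (k : ℕ) (Ψ : ℝ → ℝ) (y z : ℝ) : ℝ :=
  Ψ y * (1 / (2 * k) * Real.exp (-k * |z - y|)
    - Real.sinh (k * (1 - y)) / (2 * k * Real.sinh k) * Real.exp (-k * |z|)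
    - Real.sinh (k * y) / (2 * k * Real.sinh k) * Real.exp (-k * |z - 1|))

/-- On the unit square the extended Green function is the Dirichlet Green function. -/
theorem extGreen_eq_dirichletGreen {k : ℕ} (hk : 1 ≤ k) {Ψ : ℝ → ℝ} {y z : ℝ}
    (hΨ : Ψ y = 1) (hz : z ∈ Icc (0 : ℝ) 1) :
    extGreen k Ψ y z = dirichletGreen k y z := by
  have hk' : (0 : ℝ) < k := by exact_mod_cast hk
  have hs : Real.sinh k ≠ 0 := (Real.sinh_pos_iff.2 hk').ne'
  have h0 : |z| = z := abs_of_nonneg hz.1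
  have h1 : |z - 1| = 1 - z := by rw [abs_of_nonpos (by linarith [hz.2])]; ring
  have e1 : ∀ x : ℝ, Real.sinh (k * (1 - x)) =
      (Real.exp k / Real.exp (k * x) - Real.exp (k * x) / Real.exp k) / 2 := by
    intro x
    rw [Real.sinh_eq, ← Real.exp_sub, ← Real.exp_sub]
    ring_nf
  have e2 : ∀ x : ℝ, Real.sinh x = (Real.exp x - 1 / Real.exp x) / 2 := by
    intro x
    rw [Real.sinh_eq, Real.exp_neg, one_div]
  have e3 : Real.exp (-k * z) = 1 / Real.exp (k * z) := by
    rw [one_div, ← Real.exp_neg]; ring_nf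
  have e4 : Real.exp (-k * (1 - z)) = Real.exp (k * z) / Real.exp k := by
    rw [← Real.exp_sub]; ring_nf
  have e5 : Real.exp (-k * (z - y)) = Real.exp (k * y) / Real.exp (k * z) := by
    rw [← Real.exp_sub]; ring_nf
  have e6 : Real.exp (-k * -(z - y)) = Real.exp (k * z) / Real.exp (k * y) := by
    rw [← Real.exp_sub]; ring_nf
  have p1 := Real.exp_ne_zero (k * y)
  have p2 := Real.exp_ne_zero (k * z)
  have p3 := Real.exp_ne_zero (k : ℝ)
  rw [extGreen, dirichletGreen, hΨ, h0, h1, e3, e4]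
  have key : ∀ X Y Y' Z Z' W S : ℝ, S ≠ 0 → X * S - Y * Y' - Z * Z' = 2 * W →
      1 * (1 / (2 * k) * X - Y / (2 * k * S) * Y' - Z / (2 * k * S) * Z') =
        1 / (k * S) * W := by
    intro X Y Y' Z Z' W S hS h
    have hW : W = (X * S - Y * Y' - Z * Z') / 2 := by linarith
    rw [hW]
    field_simp
  refine key _ _ _ _ _ _ _ hs ?_
  split_ifs with h
  · rw [abs_of_nonneg (by linarith : (0 : ℝ) ≤ z - y), e5, e1, e1, e2, e2]
    field_simp
    ring
  · rw [abs_of_nonpos (by linarith [not_le.1 h] : z - y ≤ 0), e6, e1, e2, e2, e2]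
    field_simp
    ring

/-! ### The background shear flow and the linearized operator -/

/-- A (strictly increasing) background shear flow, extended from the channel `[0, 1]` to the
line: smooth, with derivative bounded below by a positive constant, and affine off `[-2, 2]`. -/
structure IsShearFlow (b : ℝ → ℝ) : Prop where
  smooth : ContDiff ℝ ∞ b
  deriv_gt : ∃ c : ℝ, 0 < c ∧ ∀ y, c < deriv b y
  deriv_deriv_eq_zero : ∀ y, y ∉ Icc (-2 : ℝ) 2 → deriv (deriv b) y = 0

/-- The linearized operator `L_k g(y) = b(y) g(y) + b''(y) ∫₀¹ G_k(y, z) g(z) dz`. -/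
def linearizedOp (b : ℝ → ℝ) (k : ℕ) (g : ℝ → ℂ) (y : ℝ) : ℂ :=
  b y * g y + deriv (deriv b) y * ∫ z in Ioo (0 : ℝ) 1, (dirichletGreen k y z : ℂ) * g z

/-- `lam` is an eigenvalue of `L_k` on `L²(0, 1)`. -/
def IsEigenvalue (b : ℝ → ℝ) (k : ℕ) (lam : ℂ) : Prop :=
  ∃ g : ℝ → ℂ, MemLp g 2 (volume.restrict (Ioo (0 : ℝ) 1)) ∧
    ¬ (g =ᵐ[volume.restrict (Ioo (0 : ℝ) 1)] 0) ∧
    ∀ᵐ y ∂volume.restrict (Ioo (0 : ℝ) 1), linearizedOp b k g y = lam * g y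

/-- No eigenvalue of `L_k` lies in its continuous spectrum `b([0, 1]) = [b(0), b(1)]`. -/
def NoEmbeddedEigenvalue (b : ℝ → ℝ) (k : ℕ) : Prop :=
  ∀ lam : ℝ, lam ∈ Icc (b 0) (b 1) → ¬ IsEigenvalue b k lam

/-! ### The cutoff functions and the operator `T_{k,ε}` -/

/-- A family of cutoff functions `Ψ_k`, `k ≥ 1`, equal to one on `[0, 1]`, with transition
layers of width at most `δ₀ / k`, and varying there at the corresponding scale `1 / k`. -/
structure IsCutoffFamily (δ₀ : ℝ) (Ψ : ℕ → ℝ → ℝ) : Prop where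
  smooth : ∀ k, 1 ≤ k → ContDiff ℝ ∞ (Ψ k)
  eq_one : ∀ k, 1 ≤ k → ∀ y ∈ Icc (0 : ℝ) 1, Ψ k y = 1
  mem_Icc : ∀ k, 1 ≤ k → ∀ y, Ψ k y ∈ Icc (0 : ℝ) 1
  tsupport_subset : ∀ k : ℕ, 1 ≤ k → tsupport (Ψ k) ⊆ Icc (-(δ₀ / k)) (1 + δ₀ / k)
  deriv_nonneg : ∀ k : ℕ, 1 ≤ k → ∀ y ∈ Ioo (-(δ₀ / k)) 0, 0 ≤ deriv (Ψ k) y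
  deriv_nonpos : ∀ k : ℕ, 1 ≤ k → ∀ y ∈ Ioo 1 (1 + δ₀ / k), deriv (Ψ k) y ≤ 0
  deriv_bound : ∃ C : ℝ, ∀ k : ℕ, 1 ≤ k → ∀ y, |deriv (Ψ k) y| ≤ C * k

/-- The extended Green function in the variables `v = b(y)`, `v' = b(z)`. -/
def greenV (b : ℝ → ℝ) (k : ℕ) (Ψ : ℝ → ℝ) (v v' : ℝ) : ℝ :=
  extGreen k Ψ (Function.invFun b v) (Function.invFun b v')

/-- `B(v) = b'(y)` with `v = b(y)`. -/
def flowB (b : ℝ → ℝ) (v : ℝ) : ℝ := deriv b (Function.invFun b v)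

/-- `T_{k,ε} h(v, w) = ∫ 𝒢_k(v + w, v' + w) ∂_{v'}B(v' + w) h(v') / (v' + iε) dv'`. -/
def opT (b : ℝ → ℝ) (k : ℕ) (Ψ : ℝ → ℝ) (ε w : ℝ) (h : ℝ → ℂ) (v : ℝ) : ℂ :=
  ∫ v' : ℝ, ((greenV b k Ψ (v + w) (v' + w) * deriv (flowB b) (v' + w) : ℝ) : ℂ) *
    (h v' / ((v' : ℂ) + Complex.I * (ε : ℂ)))

end InviscidDamping

end

/-! Write `z` for the original variable, so that `v' = b z - w`, and let `φ z = f (b z - w)`. Since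
`∂B = b'' / b'` in this variable, the Jacobian cancels and `T f` becomes `∫ G(y, z) b''(z) φ(z) / (b
z - w + iε) dz`, an integral over `[-2, 2]`. The first term `exp (-k |z - y|) / (2k)` of the
extended Green function is the reproducing kernel of the Hilbert space `H1 k` with squared norm `k²
‖u‖² + ‖u'‖²`. Hence `T = M ∘ A` (`opT_eq`), where `A` represents the sesquilinear form `∫ b'' u v̄
/ (b - w + iε)`, and `M U = Ψ (U - σ₀ U(0) - σ₁ U(1))` subtracts the boundary values and cuts off.
`M` is bounded uniformly in `k` (`exists_opM`), so everything reduces to a lower bound for `1 + M A`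
(`exists_lower_bound`).

Integration by parts turns the form into `-∫ l (b''/b' u v̄)'`, with `l` a branch of `log (b - w +
iε)`. The logarithm is bounded in `L²` uniformly in the parameters and converges in `L²` as `ε →
0±`, even while `w` moves (`exists_logW_bound`, `tendsto_logW`). Therefore `A` extends to `ε = 0`,
depends continuously in norm on its parameters there, has norm `O(1/√k)`, and is compact
(`isCompactOperator_opA`). It is also small for large `|w|`, because `b''` lives on `[-2, 2]`. A
Neumann series argument settles large `k` and large `|w|`. Finitely many `k` and a compact set of
`w` remain; by norm continuity and the Fredholm alternative it is enough that the limiting operator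
`1 + M A` at `ε = 0` is injective (`LimitSol.eq_zero`).

Let `φ + M U = 0` with `U = A φ`, and let `V = U - σ₀ U(0) - σ₁ U(1)`, so that `φ = -Ψ V` and `V`
vanishes at `0` and `1`. On the channel `[0, 1]`, `-V` solves the Rayleigh equation weakly. If `w =
b y` with `y` in the open channel, the imaginary part of the equation tested with the solution gives
`b''(y) |V(y)|² = 0` (Plemelj), while at an end of the channel the solution itself vanishes. So the
vorticity `b'' φ / (b - w)` is not too singular. A bootstrap (Hölder solution, integrable vorticity,
Lipschitz solution, bounded vorticity) places it in `L²`, where it would be an eigenfunction of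
`L_k` with embedded eigenvalue `w`; hence it vanishes. If `y` is outside the channel, completing the
square with `b' / (b - w)` gives the same conclusion.

Finally `V = 0` on `[0, 1]` is propagated to the line: testing the weak equation with `V` in layers
of width `τ` around an interval of vanishing bounds its energy by a small multiple of itself, and
`τ` does not depend on the interval (`LimitSol.exists_step`). -/

noncomputable section

namespace InviscidDamping

/-! ### Primitives of locally integrable functions and their calculus. -/

/-- `f` is a primitive of the locally integrable function `g`. -/
structure IsPrim (f g : ℝ → ℂ) : Prop where
  locInt : LocallyIntegrable g
  sub_eq : ∀ x y, f y - f x = ∫ z in x..y, g z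

theorem _root_.MeasureTheory.LocallyIntegrable.intervalIntegrable' {g : ℝ → ℂ}
    (hg : LocallyIntegrable g) (x y : ℝ) : IntervalIntegrable g volume x y :=
  intervalIntegrable_iff.mpr <|
    (hg.integrableOn_isCompact isCompact_uIcc).mono_set uIoc_subset_uIcc

namespace IsPrim

variable {f g f₁ g₁ f₂ g₂ : ℝ → ℂ}

theorem intervalIntegrable (h : IsPrim f g) (x y : ℝ) : IntervalIntegrable g volume x y :=
  h.locInt.intervalIntegrable' x y

theorem eq_add (h : IsPrim f g) (x y : ℝ) : f y = f x + ∫ z in x..y, g z := by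
  rw [← h.sub_eq x y]; ring

theorem eq_fun (h : IsPrim f g) : f = fun y => f 0 + ∫ z in (0 : ℝ)..y, g z :=
  funext fun y => h.eq_add 0 y

theorem continuous (h : IsPrim f g) : Continuous f := by
  rw [h.eq_fun]
  exact continuous_const.add (intervalIntegral.continuous_primitive h.intervalIntegrable 0)

theorem ae_hasDerivAt (h : IsPrim f g) : ∀ᵐ x, HasDerivAt f (g x) x := by
  filter_upwards [_root_.LocallyIntegrable.ae_hasDerivAt_integral h.locInt] with x hx
  rw [h.eq_fun]
  exact (hx 0).const_add _

/-- The increments of `f` are dominated by those of the primitive of `‖g‖`. -/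
theorem absolutelyContinuous (h : IsPrim f g) (a b : ℝ) :
    AbsolutelyContinuousOnInterval f a b := by
  have hN : AbsolutelyContinuousOnInterval (fun x => ∫ v in a..x, ‖g v‖) a b :=
    (h.intervalIntegrable a b).norm.absolutelyContinuousOnInterval_intervalIntegral
      left_mem_uIcc
  refine squeeze_zero' (Filter.Eventually.of_forall fun _ =>
    Finset.sum_nonneg fun _ _ => dist_nonneg) (Filter.Eventually.of_forall fun E => ?_) hN
  refine Finset.sum_le_sum fun i _ => ?_
  rw [dist_comm, dist_eq_norm, h.sub_eq, dist_comm, Real.dist_eq,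
    intervalIntegral.integral_interval_sub_left (h.intervalIntegrable _ _).norm
      (h.intervalIntegrable _ _).norm]
  exact intervalIntegral.norm_integral_le_abs_integral_norm

/-- The difference of `f` and the integral of `g` is absolutely continuous with derivative zero
almost everywhere, hence constant. This is how products and the kinked exponential kernel are
recognised as primitives. -/
theorem of_ac (hg : LocallyIntegrable g) (hf : ∀ a b, AbsolutelyContinuousOnInterval f a b)
    (hd : ∀ᵐ x, HasDerivAt f (g x) x) : IsPrim f g := by
  refine ⟨hg, fun x y => ?_⟩
  have hp : IsPrim (fun y => ∫ z in x..y, g z) g := ⟨hg, fun _ _ =>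
    intervalIntegral.integral_interval_sub_left (hg.intervalIntegrable' _ _)
      (hg.intervalIntegrable' _ _)⟩
  obtain ⟨C, hC⟩ := ((hf x y).sub (hp.absolutelyContinuous x y)).const_of_ae_hasDerivAt_zero (by
    filter_upwards [hd, hp.ae_hasDerivAt] with t h1 h2 _
    simpa using h1.sub h2)
  have h1 := hC x left_mem_uIcc
  have h2 := hC y right_mem_uIcc
  simp only [Pi.sub_apply, intervalIntegral.integral_same, sub_zero] at h1 h2
  rw [h1, ← h2]; ring

theorem integral (hg : LocallyIntegrable g) (a : ℝ) : IsPrim (fun y => ∫ z in a..y, g z) g :=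
  ⟨hg, fun _ _ => intervalIntegral.integral_interval_sub_left (hg.intervalIntegrable' _ _)
      (hg.intervalIntegrable' _ _)⟩

theorem of_hasDerivAt (hd : ∀ x, HasDerivAt f (g x) x) (hg : Continuous g) : IsPrim f g :=
  ⟨hg.locallyIntegrable, fun _ _ =>
    (intervalIntegral.integral_eq_sub_of_hasDerivAt (fun z _ => hd z)
      (hg.intervalIntegrable _ _)).symm⟩

theorem add (h₁ : IsPrim f₁ g₁) (h₂ : IsPrim f₂ g₂) :
    IsPrim (fun x => f₁ x + f₂ x) (fun x => g₁ x + g₂ x) :=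
  ⟨h₁.locInt.add h₂.locInt, fun x y => by
    rw [intervalIntegral.integral_add (h₁.intervalIntegrable _ _) (h₂.intervalIntegrable _ _),
      ← h₁.sub_eq, ← h₂.sub_eq]; ring⟩

theorem const_mul (c : ℂ) (h : IsPrim f g) : IsPrim (fun x => c * f x) (fun x => c * g x) :=
  ⟨h.locInt.smul c, fun x y => by
    rw [intervalIntegral.integral_const_mul, ← h.sub_eq]; ring⟩

theorem sub (h₁ : IsPrim f₁ g₁) (h₂ : IsPrim f₂ g₂) :
    IsPrim (fun x => f₁ x - f₂ x) (fun x => g₁ x - g₂ x) := by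
  simpa [sub_eq_add_neg] using h₁.add (h₂.const_mul (-1))

theorem conj (h : IsPrim f g) :
    IsPrim (fun x => (starRingEnd ℂ) (f x)) (fun x => (starRingEnd ℂ) (g x)) := by
  refine ⟨fun x => ?_, fun x y => ?_⟩
  · obtain ⟨s, hs, hi⟩ := h.locInt x
    refine ⟨s, hs, ?_⟩
    exact (Complex.conjLIE.toContinuousLinearEquiv.toContinuousLinearMap.integrable_comp hi)
  · rw [← map_sub, h.sub_eq, intervalIntegral.intervalIntegral_eq_integral_uIoc,
      intervalIntegral.intervalIntegral_eq_integral_uIoc, ← integral_conj.symm]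
    split_ifs <;> simp

theorem mul (h₁ : IsPrim f₁ g₁) (h₂ : IsPrim f₂ g₂) :
    IsPrim (fun x => f₁ x * f₂ x) (fun x => g₁ x * f₂ x + f₁ x * g₂ x) := by
  refine of_ac ?_ (fun a b => (h₁.absolutelyContinuous a b).smul (h₂.absolutelyContinuous a b)) ?_
  · refine LocallyIntegrable.add ?_ ?_
    · rw [locallyIntegrable_iff]
      intro K hK
      exact (h₁.locInt.integrableOn_isCompact hK).mul_continuousOn h₂.continuous.continuousOn hK
    · rw [locallyIntegrable_iff]
      intro K hK
      exact (h₂.locInt.integrableOn_isCompact hK).continuousOn_mul h₁.continuous.continuousOn hK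
  · filter_upwards [h₁.ae_hasDerivAt, h₂.ae_hasDerivAt] with x hx₁ hx₂
    exact hx₁.mul hx₂

/-- A primitive has the given function as weak derivative. -/
theorem hasWeakDeriv (h : IsPrim f g) : HasWeakDeriv f g := by
  refine ⟨h.continuous.locallyIntegrable, h.locInt, fun φ hφ hc => ?_⟩
  obtain ⟨R, hR⟩ := hc.isCompact.isBounded.subset_closedBall 0
  have hout : ∀ x, R < |x| → φ x = 0 := fun x hx => by
    by_contra hne
    have := hR (subset_tsupport φ hne)
    rw [mem_closedBall_zero_iff, Real.norm_eq_abs] at this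
    linarith
  have hout' : ∀ x, R < |x| → deriv φ x = 0 := fun x hx => by
    by_contra hne
    have := hR (support_deriv_subset hne)
    rw [mem_closedBall_zero_iff, Real.norm_eq_abs] at this
    linarith
  have hφp : IsPrim (fun x => (φ x : ℂ)) (fun x => ((deriv φ x : ℝ) : ℂ)) :=
    of_hasDerivAt (fun x => ((hφ.differentiable (by simp)) x).hasDerivAt.ofReal_comp)
      (Complex.continuous_ofReal.comp (hφ.continuous_deriv (by simp)))
  -- Integration by parts is the fundamental theorem for `φ f` on an interval containing the support
  -- of `φ`.
  have hp := (hφp.mul h)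
  set r := |R| + 1
  have hr : R < r := by have := le_abs_self R; simp only [r]; linarith
  have hr0 : 0 < r := by positivity
  have key := hp.sub_eq (-r) r
  rw [hout r (by rwa [abs_of_pos hr0]), hout (-r) (by rwa [abs_neg, abs_of_pos hr0])] at key
  simp only [Complex.ofReal_zero, zero_mul, sub_zero] at key
  have e1 : ∫ x, deriv φ x • f x = ∫ x in (-r)..r, ((deriv φ x : ℝ) : ℂ) * f x := by
    rw [intervalIntegral.integral_of_le (by linarith), ← integral_Icc_eq_integral_Ioc,
      setIntegral_eq_integral_of_forall_compl_eq_zero]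
    · simp
    · intro x hx
      rw [hout' x, Complex.ofReal_zero, zero_mul]
      by_contra hcon
      exact hx (abs_le.1 (by linarith))
  have e2 : ∫ x, φ x • g x = ∫ x in (-r)..r, (φ x : ℂ) * g x := by
    rw [intervalIntegral.integral_of_le (by linarith), ← integral_Icc_eq_integral_Ioc,
      setIntegral_eq_integral_of_forall_compl_eq_zero]
    · simp
    · intro x hx
      rw [hout x, Complex.ofReal_zero, zero_mul]
      by_contra hcon
      exact hx (abs_le.1 (by linarith))
  rw [e1, e2]
  rw [intervalIntegral.integral_add] at key
  · exact eq_neg_of_add_eq_zero_left key.symm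
  · exact (Continuous.intervalIntegrable (by
      have := hφ.continuous_deriv (n := ∞) (by simp)
      have := h.continuous
      fun_prop) _ _)
  · exact (h.intervalIntegrable _ _).continuousOn_mul (by
      have := hφ.continuous
      fun_prop)

end IsPrim

/-! ### From weak derivatives back to primitives. -/

/-- A locally integrable function with vanishing weak derivative is almost everywhere constant. -/
theorem HasWeakDeriv.ae_const {f : ℝ → ℂ} (h : HasWeakDeriv f 0) :
    ∃ c : ℂ, f =ᵐ[volume] fun _ => c := by
  obtain ⟨η⟩ : Nonempty (ContDiffBump (0 : ℝ)) := inferInstance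
  set ρ : ℝ → ℝ := η.normed volume with hρ
  have hρs : ContDiff ℝ ∞ ρ := η.contDiff_normed
  have hρc : HasCompactSupport ρ := η.hasCompactSupport_normed
  have hρi : ∫ x, ρ x = 1 := η.integral_normed
  refine ⟨∫ x, ρ x • f x, ae_eq_of_integral_contDiff_smul_eq h.1
    continuous_const.locallyIntegrable fun φ hφ hc => ?_⟩
  set m : ℝ := ∫ x, φ x with hm
  -- Subtracting a multiple of a fixed bump of mass one gives `θ` mean zero, so its primitive has
  -- compact support and is an admissible test function.
  set θ : ℝ → ℝ := fun x => φ x - m * ρ x with hθ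
  have hθs : ContDiff ℝ ∞ θ := hφ.sub (contDiff_const.mul hρs)
  have hθc : HasCompactSupport θ := hc.sub (hρc.mul_left (f := fun _ => m))
  have hφi : Integrable φ := hφ.continuous.integrable_of_hasCompactSupport hc
  have hρI : Integrable ρ := hρs.continuous.integrable_of_hasCompactSupport hρc
  have hθi : Integrable θ := hφi.sub (hρI.const_mul m)
  have hθ0 : ∫ x, θ x = 0 := by
    rw [hθ, integral_sub hφi (hρI.const_mul m), integral_const_mul, hρi, ← hm]; ring
  obtain ⟨R, hR⟩ := hθc.isCompact.isBounded.subset_closedBall 0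
  have hout : ∀ x, R < |x| → θ x = 0 := fun x hx => by
    by_contra hne
    have := hR (subset_tsupport θ hne)
    rw [mem_closedBall_zero_iff, Real.norm_eq_abs] at this
    linarith
  set r := |R| + 1
  have hr : R < r := by have := le_abs_self R; simp only [r]; linarith
  have hr0 : 0 < r := by positivity
  set Θ : ℝ → ℝ := fun y => ∫ x in (-r)..y, θ x with hΘ
  have hΘd : ∀ y, HasDerivAt Θ (θ y) y := fun y =>
    intervalIntegral.integral_hasDerivAt_right (hθs.continuous.intervalIntegrable _ _)
      (hθs.continuous.stronglyMeasurableAtFilter _ _) hθs.continuous.continuousAt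
  have hΘ' : deriv Θ = θ := funext fun y => (hΘd y).deriv
  have hΘs : ContDiff ℝ ∞ Θ := by
    rw [contDiff_infty_iff_deriv]
    exact ⟨fun y => (hΘd y).differentiableAt, by rw [hΘ']; exact hθs⟩
  have hΘc : HasCompactSupport Θ := by
    refine HasCompactSupport.intro (isCompact_Icc (a := -r) (b := r)) fun y hy => ?_
    rcases lt_or_ge y (-r) with hy1 | hy1
    · rw [hΘ]
      refine intervalIntegral.integral_zero_ae (Filter.Eventually.of_forall fun x hx => hout x ?_)
      rw [uIoc_of_ge hy1.le] at hx
      rw [abs_of_nonpos (by linarith [hx.2])]; linarith [hx.2]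
    · have hy2 : r < y := by
        by_contra hcon
        exact hy ⟨hy1, not_lt.1 hcon⟩
      rw [hΘ]
      simp only
      rw [intervalIntegral.integral_of_le hy1, ← integral_Icc_eq_integral_Ioc,
        setIntegral_eq_integral_of_forall_compl_eq_zero, hθ0]
      intro x hx
      refine hout x ?_
      by_contra hcon
      obtain ⟨h1, h2⟩ := abs_le.1 (not_lt.1 hcon)
      exact hx ⟨by linarith, by linarith⟩
  have key := h.2.2 Θ hΘs hΘc
  simp only [hΘ', Pi.zero_apply, smul_zero, integral_zero, neg_zero] at key
  have hφf : Integrable fun x => φ x • f x :=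
    h.1.integrable_smul_left_of_hasCompactSupport hφ.continuous hc
  have hρf : Integrable fun x => ρ x • f x :=
    h.1.integrable_smul_left_of_hasCompactSupport hρs.continuous hρc
  have : ∫ x, θ x • f x = ∫ x, φ x • f x - m • (ρ x • f x) := by
    congr 1; ext x; simp only [hθ, sub_smul, mul_smul]
  have hρm : Integrable fun x => m • (ρ x • f x) := hρf.smul m
  rw [this, integral_sub hφf hρm, integral_smul] at key
  rw [sub_eq_zero.1 key, integral_smul_const]

/-- Subtracting the integral of `g` leaves a function with zero weak derivative, so a constant. This
supplies the absolutely continuous representative. -/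
theorem HasWeakDeriv.exists_isPrim {f g : ℝ → ℂ} (h : HasWeakDeriv f g) :
    ∃ F, IsPrim F g ∧ f =ᵐ[volume] F := by
  have hp := IsPrim.integral h.2.1 0
  have h0 : HasWeakDeriv (fun x => f x - ∫ z in (0 : ℝ)..x, g z) 0 := by
    refine ⟨h.1.sub hp.continuous.locallyIntegrable, locallyIntegrable_zero, fun φ hφ hc => ?_⟩
    have hd := hφ.continuous_deriv (n := ∞) (by simp)
    have h1 : Integrable fun x => deriv φ x • f x :=
      h.1.integrable_smul_left_of_hasCompactSupport hd hc.deriv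
    have h2 : Integrable fun x => deriv φ x • ∫ z in (0 : ℝ)..x, g z :=
      hp.continuous.locallyIntegrable.integrable_smul_left_of_hasCompactSupport hd hc.deriv
    simp only [smul_sub, Pi.zero_apply, smul_zero, integral_zero, neg_zero]
    rw [integral_sub h1 h2, h.2.2 φ hφ hc, hp.hasWeakDeriv.2.2 φ hφ hc, sub_self]
  obtain ⟨c, hc⟩ := h0.ae_const
  refine ⟨fun x => c + ∫ z in (0 : ℝ)..x, g z, ⟨h.2.1, fun x y => ?_⟩, ?_⟩
  · have := hp.sub_eq x y
    rw [← this]; ring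
  · filter_upwards [hc] with x hx
    rw [← hx]; ring

open scoped ComplexConjugate InnerProductSpace

/-! ### Square integrable functions -/

theorem memLp_two_norm {α : Type*} [MeasurableSpace α] {μ : Measure α} {f : α → ℂ}
    (hf : MemLp f 2 μ) : Integrable (fun x => ‖f x‖ ^ 2) μ :=
  (memLp_two_iff_integrable_sq_norm hf.1).1 hf

/-- The Cauchy-Schwarz inequality. -/
theorem integral_norm_mul_norm_le {α : Type*} [MeasurableSpace α] {μ : Measure α} {f g : α → ℂ}
    (hf : MemLp f 2 μ) (hg : MemLp g 2 μ) :
    ∫ x, ‖f x‖ * ‖g x‖ ∂μ ≤ √(∫ x, ‖f x‖ ^ 2 ∂μ) * √(∫ x, ‖g x‖ ^ 2 ∂μ) := by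
  have h := integral_mul_le_Lp_mul_Lq_of_nonneg (μ := μ) (p := 2) (q := 2)
    (f := fun x => ‖f x‖) (g := fun x => ‖g x‖) Real.HolderConjugate.two_two
    (Filter.Eventually.of_forall fun _ => norm_nonneg _)
    (Filter.Eventually.of_forall fun _ => norm_nonneg _) (by simpa using hf.norm)
    (by simpa using hg.norm)
  simpa [Real.sqrt_eq_rpow] using h

theorem integrable_norm_mul_norm {α : Type*} [MeasurableSpace α] {μ : Measure α} {f g : α → ℂ}
    (hf : MemLp f 2 μ) (hg : MemLp g 2 μ) : Integrable (fun x => ‖f x‖ * ‖g x‖) μ :=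
  hf.norm.integrable_mul hg.norm

theorem eLpNorm_two_toReal {α : Type*} [MeasurableSpace α] {μ : Measure α} {f : α → ℂ}
    (hf : MemLp f 2 μ) : (eLpNorm f 2 μ).toReal = √(∫ x, ‖f x‖ ^ 2 ∂μ) := by
  rw [hf.eLpNorm_eq_integral_rpow_norm (by simp) (by simp), ENNReal.toReal_ofReal (by positivity)]
  simp [Real.sqrt_eq_rpow]

theorem _root_.MeasureTheory.MemLp.locallyIntegrable' {f : ℝ → ℂ} (hf : MemLp f 2 volume) :
    LocallyIntegrable f :=
  hf.locallyIntegrable (by norm_num)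

theorem IsPrim.norm_sub_le {f g : ℝ → ℂ} (h : IsPrim f g) {x y : ℝ} (hxy : x ≤ y)
    (hg : MemLp g 2 (volume.restrict (Ioc x y))) :
    ‖f y - f x‖ ≤ √(y - x) * √(∫ z in Ioc x y, ‖g z‖ ^ 2) := by
  rw [h.sub_eq, intervalIntegral.integral_of_le hxy]
  have h1 : MemLp (fun _ : ℝ => (1 : ℂ)) 2 (volume.restrict (Ioc x y)) := memLp_const _
  have h2 := integral_norm_mul_norm_le h1 hg
  simp only [norm_one, one_mul, one_pow, integral_const, smul_eq_mul, mul_one,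
    measureReal_restrict_apply_univ, Real.volume_real_Ioc_of_le hxy] at h2
  exact (norm_integral_le_integral_norm _).trans h2

theorem IsPrim.norm_sub_le' {f g : ℝ → ℂ} (h : IsPrim f g) (hg : MemLp g 2 volume) (x y : ℝ) :
    ‖f y - f x‖ ≤ √|y - x| * √(∫ z, ‖g z‖ ^ 2) := by
  wlog hxy : x ≤ y generalizing x y
  · rw [norm_sub_rev, abs_sub_comm]
    exact this y x (not_le.1 hxy).le
  rw [abs_of_nonneg (by linarith)]
  refine (h.norm_sub_le hxy (hg.restrict _)).trans ?_
  gcongr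
  · exact Filter.Eventually.of_forall fun z => sq_nonneg _
  · exact memLp_two_norm hg
  · exact Measure.restrict_le_self

/-! ### The exponential kernel -/

/-- The fundamental solution of `k² - d²/dz²` with pole `y`. -/
def expKer (k y z : ℝ) : ℝ := Real.exp (-k * |z - y|) / (2 * k)

/-- The derivative of `expKer k y`. -/
def expKer' (k y z : ℝ) : ℝ :=
  if z < y then Real.exp (-k * |z - y|) / 2 else -(Real.exp (-k * |z - y|) / 2)

theorem integrable_exp_abs {k : ℝ} (hk : 0 < k) (y : ℝ) :
    Integrable fun z => Real.exp (-k * |z - y|) := by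
  have h0 : Integrable fun z : ℝ => Real.exp (-k * |z|) := by
    rw [← integrableOn_univ, ← Iic_union_Ioi (a := (0 : ℝ)), integrableOn_union]
    constructor
    · refine (integrableOn_exp_mul_Iic hk 0).congr_fun (fun z hz => ?_) measurableSet_Iic
      simp only; rw [abs_of_nonpos hz]; ring_nf
    · refine (integrableOn_exp_mul_Ioi (neg_lt_zero.2 hk) 0).congr_fun (fun z hz => ?_)
        measurableSet_Ioi
      simp only; rw [abs_of_pos hz]
  exact h0.comp_sub_right y

theorem measurable_expKer' (k y : ℝ) : Measurable (expKer' k y) := by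
  unfold expKer'
  refine Measurable.ite measurableSet_Iio ?_ ?_ <;> fun_prop

theorem memLp_of_norm_le_exp {k : ℝ} (hk : 0 < k) (y C : ℝ) {f : ℝ → ℝ} (hf : Measurable f)
    (hle : ∀ z, |f z| ≤ C * Real.exp (-k * |z - y|)) :
    MemLp (fun z => (f z : ℂ)) 2 volume := by
  have hm : AEStronglyMeasurable (fun z => (f z : ℂ)) volume :=
    (Complex.measurable_ofReal.comp hf).aestronglyMeasurable
  rw [memLp_two_iff_integrable_sq_norm hm]
  refine ((integrable_exp_abs (k := 2 * k) (by linarith) y).const_mul (C ^ 2)).mono'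
    (hm.norm.pow 2) (Filter.Eventually.of_forall fun z => ?_)
  simp only [Complex.norm_real, Real.norm_eq_abs, abs_pow, abs_abs]
  calc |f z| ^ 2 ≤ (C * Real.exp (-k * |z - y|)) ^ 2 := by gcongr; exact hle z
    _ = C ^ 2 * Real.exp (-(2 * k) * |z - y|) := by
      rw [mul_pow, ← Real.exp_nat_mul]; congr 2; push_cast; ring

theorem memLp_expKer {k : ℝ} (hk : 0 < k) (y : ℝ) : MemLp (fun z => (expKer k y z : ℂ)) 2 volume := by
  refine memLp_of_norm_le_exp hk y (1 / (2 * k)) (by unfold expKer; fun_prop) fun z => ?_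
  rw [expKer, abs_of_nonneg (by positivity)]
  exact le_of_eq (by ring)

theorem memLp_expKer' {k : ℝ} (hk : 0 < k) (y : ℝ) :
    MemLp (fun z => (expKer' k y z : ℂ)) 2 volume := by
  refine memLp_of_norm_le_exp hk y (1 / 2) (measurable_expKer' k y) fun z => ?_
  have : |expKer' k y z| = Real.exp (-k * |z - y|) / 2 := by
    unfold expKer'
    split_ifs
    · exact abs_of_pos (by positivity)
    · rw [abs_neg]; exact abs_of_pos (by positivity)
  rw [this]
  exact le_of_eq (by ring)

theorem abs_exp_neg_sub_exp_neg_le {a b : ℝ} (ha : 0 ≤ a) (hb : 0 ≤ b) :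
    |Real.exp (-a) - Real.exp (-b)| ≤ |a - b| := by
  wlog hab : a ≤ b generalizing a b
  · rw [abs_sub_comm, abs_sub_comm a]
    exact this hb ha (not_le.1 hab).le
  have h1 : Real.exp (-b) ≤ Real.exp (-a) := Real.exp_le_exp.2 (by linarith)
  rw [abs_of_nonneg (by linarith), abs_of_nonpos (by linarith)]
  have h2 : Real.exp (-b) = Real.exp (-a) * Real.exp (a - b) := by
    rw [← Real.exp_add]; ring_nf
  have h3 := Real.add_one_le_exp (a - b)
  have h4 : Real.exp (-a) ≤ 1 := Real.exp_le_one_iff.2 (by linarith)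
  have h5 := Real.exp_pos (-a)
  rw [h2]
  nlinarith

/-- The factor `k` from the exponent cancels against `1 / (2 * k)`, so the Lipschitz constant is
free of `k`. In `z` this gives absolute continuity across the kink; in `y` it gives the Lipschitz
bound for the Dirichlet Green function. -/
theorem abs_expKer_sub_le {k : ℝ} (hk : 0 < k) (y y' z z' : ℝ) :
    |expKer k y z - expKer k y' z'| ≤ |z - z'| + |y - y'| := by
  rw [expKer, expKer, ← sub_div, abs_div, abs_of_pos (by positivity : 0 < 2 * k),
    div_le_iff₀ (by positivity)]
  have h := abs_exp_neg_sub_exp_neg_le (a := k * |z - y|) (b := k * |z' - y'|) (by positivity)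
    (by positivity)
  rw [← neg_mul, ← neg_mul, ← mul_sub, abs_mul, abs_of_pos hk] at h
  have h2 : |(|z - y| - |z' - y'|)| ≤ |z - z'| + |y - y'| := by
    refine (abs_abs_sub_abs_le _ _).trans ?_
    have : z - y - (z' - y') = (z - z') - (y - y') := by ring
    rw [this]
    exact abs_sub _ _
  calc _ ≤ k * |(|z - y| - |z' - y'|)| := h
    _ ≤ k * (|z - z'| + |y - y'|) := by gcongr
    _ ≤ _ := by nlinarith [abs_nonneg (z - z'), abs_nonneg (y - y')]

theorem isPrim_expKer {k : ℝ} (hk : 0 < k) (y : ℝ) :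
    IsPrim (fun z => (expKer k y z : ℂ)) (fun z => (expKer' k y z : ℂ)) := by
  refine IsPrim.of_ac (memLp_expKer' hk y).locallyIntegrable' (fun a b => ?_) ?_
  · refine LipschitzOnWith.absolutelyContinuousOnInterval (K := 1)
      (LipschitzWith.lipschitzOnWith (LipschitzWith.of_dist_le_mul fun z z' => ?_))
    rw [dist_eq_norm, ← Complex.ofReal_sub, Complex.norm_real, Real.norm_eq_abs, Real.dist_eq]
    simpa using abs_expKer_sub_le hk y y z z'
  · have hne : ∀ᵐ z : ℝ, z ≠ y := by simp [ae_iff]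
    filter_upwards [hne] with z hz
    refine HasDerivAt.ofReal_comp ?_
    rcases lt_or_gt_of_ne hz with h | h
    · have hd : HasDerivAt (fun z => Real.exp (k * (z - y)) / (2 * k))
          (Real.exp (k * (z - y)) * (k * 1) / (2 * k)) z :=
        (((hasDerivAt_id z).sub_const y).const_mul k).exp.div_const _
      have hv : expKer' k y z = Real.exp (k * (z - y)) * (k * 1) / (2 * k) := by
        rw [expKer', if_pos h, abs_of_neg (by linarith)]
        field_simp
      rw [hv]
      refine hd.congr_of_eventuallyEq ?_
      filter_upwards [Iio_mem_nhds h] with x hx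
      rw [expKer, abs_of_neg (by linarith [mem_Iio.1 hx])]
      ring_nf
    · have hd : HasDerivAt (fun z => Real.exp (-k * (z - y)) / (2 * k))
          (Real.exp (-k * (z - y)) * (-k * 1) / (2 * k)) z :=
        (((hasDerivAt_id z).sub_const y).const_mul (-k)).exp.div_const _
      have hv : expKer' k y z = Real.exp (-k * (z - y)) * (-k * 1) / (2 * k) := by
        rw [expKer', if_neg (by linarith), abs_of_pos (by linarith)]
        field_simp
      rw [hv]
      refine hd.congr_of_eventuallyEq ?_
      filter_upwards [Ioi_mem_nhds h] with x hx
      rw [expKer, abs_of_pos (by linarith [mem_Ioi.1 hx])]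

/-- Hölder continuity of order `1/2` permits growth of order `√R` only, which the exponential beats.
The signs `s = ±1` treat the boundary terms at the two ends of the line. -/
theorem tendsto_exp_mul_of_holder {k : ℝ} (hk : 0 < k) {f : ℝ → ℂ} {C : ℝ}
    (hf : ∀ x y, ‖f y - f x‖ ≤ √|y - x| * C) (y s : ℝ) (hs : |s| = 1) :
    Filter.Tendsto (fun R : ℝ => (Real.exp (-k * R) : ℂ) * f (y + s * R)) Filter.atTop
      (nhds 0) := by
  have hC : 0 ≤ C := by
    have h := (norm_nonneg _).trans (hf 0 1)
    simpa using h
  have hb : ∀ R : ℝ, 0 ≤ R → ‖(Real.exp (-k * R) : ℂ) * f (y + s * R)‖ ≤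
      (‖f y‖ + C) * Real.exp (-k * R) + C * (R ^ 1 * Real.exp (-k * R)) := fun R hR => by
    have h1 := hf y (y + s * R)
    rw [add_sub_cancel_left, abs_mul, hs, one_mul, abs_of_nonneg hR] at h1
    have h2 : √R ≤ 1 + R := by
      rw [Real.sqrt_le_iff]; constructor <;> nlinarith
    have h3 : ‖f (y + s * R)‖ ≤ ‖f y‖ + (1 + R) * C := by
      calc ‖f (y + s * R)‖ = ‖f y + (f (y + s * R) - f y)‖ := by ring_nf
        _ ≤ ‖f y‖ + ‖f (y + s * R) - f y‖ := norm_add_le _ _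
        _ ≤ ‖f y‖ + (1 + R) * C := by
          gcongr
          exact h1.trans (by gcongr)
    rw [norm_mul, Complex.norm_real, Real.norm_eq_abs, abs_of_pos (Real.exp_pos _)]
    calc _ ≤ Real.exp (-k * R) * (‖f y‖ + (1 + R) * C) := by gcongr
      _ = _ := by ring
  refine squeeze_zero_norm' (Filter.eventually_atTop.2 ⟨0, hb⟩) ?_
  have t1 : Filter.Tendsto (fun R : ℝ => R ^ 0 * Real.exp (-k * R)) Filter.atTop (nhds 0) := by
    refine ((isLittleO_pow_exp_pos_mul_atTop 0 hk).tendsto_div_nhds_zero).congr fun R => ?_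
    rw [neg_mul, Real.exp_neg, div_eq_mul_inv]
  have t2 : Filter.Tendsto (fun R : ℝ => R ^ 1 * Real.exp (-k * R)) Filter.atTop (nhds 0) := by
    refine ((isLittleO_pow_exp_pos_mul_atTop 1 hk).tendsto_div_nhds_zero).congr fun R => ?_
    rw [neg_mul, Real.exp_neg, div_eq_mul_inv]
  simpa using (t1.const_mul (‖f y‖ + C)).add (t2.const_mul C)

/-- The reproducing property of the exponential kernel. -/
theorem integral_expKer_mul {k : ℝ} (hk : 0 < k) {f g : ℝ → ℂ} (h : IsPrim f g)
    (hf : MemLp f 2 volume) (hg : MemLp g 2 volume) (y : ℝ) :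
    ∫ z, ((k : ℂ) ^ 2 * (expKer k y z * f z) + expKer' k y z * g z) = f y := by
  have hI : Integrable fun z => (k : ℂ) ^ 2 * (expKer k y z * f z) + expKer' k y z * g z :=
    (((memLp_expKer hk y).integrable_mul hf).const_mul _).add ((memLp_expKer' hk y).integrable_mul hg)
  have hold := h.norm_sub_le' hg
  have hR : Filter.Tendsto
      (fun R : ℝ => ∫ z in (y - R)..(y + R),
        ((k : ℂ) ^ 2 * (expKer k y z * f z) + expKer' k y z * g z)) Filter.atTop
      (nhds (∫ z, ((k : ℂ) ^ 2 * (expKer k y z * f z) + expKer' k y z * g z))) :=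
    intervalIntegral_tendsto_integral hI
      (Filter.tendsto_atBot_add_const_left _ y Filter.tendsto_neg_atTop_atBot)
      (Filter.tendsto_atTop_add_const_left _ y Filter.tendsto_id)
  refine tendsto_nhds_unique hR ?_
  -- On each side of the pole `expKer'` is smooth with derivative `k ^ 2 * expKer`, so the integrand
  -- is the derivative of `expKer' * f`. The one-sided values `±1/2` at the pole contribute `f y /
  -- 2` from each side.
  have e1 : ∀ R : ℝ, 0 ≤ R → ∫ z in y..(y + R),
        ((k : ℂ) ^ 2 * (expKer k y z * f z) + expKer' k y z * g z) =
      f y / 2 - (Real.exp (-k * R) : ℂ) * f (y + 1 * R) / 2 := fun R hR => by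
    have hD : IsPrim (fun z => ((-(Real.exp (-k * (z - y)) / 2) : ℝ) : ℂ))
        (fun z => ((-(Real.exp (-k * (z - y)) * (-k * 1) / 2) : ℝ) : ℂ)) := by
      refine IsPrim.of_hasDerivAt (fun z => HasDerivAt.ofReal_comp ?_) (by fun_prop)
      exact ((((hasDerivAt_id z).sub_const y).const_mul (-k)).exp.div_const 2).neg
    have hp := (hD.mul h).sub_eq y (y + R)
    rw [intervalIntegral.integral_congr (g := fun z =>
      ((-(Real.exp (-k * (z - y)) * (-k * 1) / 2) : ℝ) : ℂ) * f z +
        ((-(Real.exp (-k * (z - y)) / 2) : ℝ) : ℂ) * g z), ← hp]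
    · simp; ring
    · intro z hz
      rw [uIcc_of_le (by linarith)] at hz
      simp only
      rw [expKer, expKer', if_neg (by linarith [hz.1]), abs_of_nonneg (by linarith [hz.1])]
      have : (k : ℂ) ≠ 0 := by exact_mod_cast hk.ne'
      push_cast
      field_simp
  have e2 : ∀ R : ℝ, 0 ≤ R → ∫ z in (y - R)..y,
        ((k : ℂ) ^ 2 * (expKer k y z * f z) + expKer' k y z * g z) =
      f y / 2 - (Real.exp (-k * R) : ℂ) * f (y + (-1) * R) / 2 := fun R hR => by
    have hD : IsPrim (fun z => (((Real.exp (k * (z - y)) / 2) : ℝ) : ℂ))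
        (fun z => (((Real.exp (k * (z - y)) * (k * 1) / 2) : ℝ) : ℂ)) := by
      refine IsPrim.of_hasDerivAt (fun z => HasDerivAt.ofReal_comp ?_) (by fun_prop)
      exact ((((hasDerivAt_id z).sub_const y).const_mul k).exp.div_const 2)
    have hp := (hD.mul h).sub_eq (y - R) y
    have hne : ∀ᵐ z : ℝ, z ≠ y := by simp [ae_iff]
    rw [intervalIntegral.integral_congr_ae (g := fun z =>
      (((Real.exp (k * (z - y)) * (k * 1) / 2) : ℝ) : ℂ) * f z +
        (((Real.exp (k * (z - y)) / 2) : ℝ) : ℂ) * g z), ← hp]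
    · simp [sub_eq_add_neg]; ring
    · filter_upwards [hne] with z hzy hz
      rw [uIoc_of_le (by linarith)] at hz
      have hlt : z < y := lt_of_le_of_ne hz.2 hzy
      rw [expKer, expKer', if_pos hlt, abs_of_neg (by linarith)]
      have hk0 : (k : ℂ) ≠ 0 := by exact_mod_cast hk.ne'
      have : -k * -(z - y) = k * (z - y) := by ring
      rw [this]
      push_cast
      field_simp
  have hsum : ∀ R : ℝ, 0 ≤ R → ∫ z in (y - R)..(y + R),
        ((k : ℂ) ^ 2 * (expKer k y z * f z) + expKer' k y z * g z) =
      f y - ((Real.exp (-k * R) : ℂ) * f (y + 1 * R) +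
        (Real.exp (-k * R) : ℂ) * f (y + (-1) * R)) / 2 := fun R hR => by
    rw [← intervalIntegral.integral_add_adjacent_intervals (b := y) hI.intervalIntegrable
      hI.intervalIntegrable, e1 R hR, e2 R hR]
    ring
  refine Filter.Tendsto.congr' (Filter.eventuallyEq_of_mem (Filter.Ici_mem_atTop 0)
    fun R hR => (hsum R hR).symm) ?_
  have := (((tendsto_exp_mul_of_holder hk hold y 1 (by simp)).add
    (tendsto_exp_mul_of_holder hk hold y (-1) (by simp))).div_const 2).const_sub (f y)
  simpa using this

/-! ### The Hilbert space `H¹_k` -/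

/-- Pairs of square integrable functions. -/
abbrev L2Pair := WithLp 2 (Lp ℂ 2 (volume : Measure ℝ) × Lp ℂ 2 (volume : Measure ℝ))

/-- The Hilbert space of pairs `(k f, f')` with `f ∈ H¹(ℝ)`. -/
def h1Submodule (k : ℝ) : Submodule ℂ L2Pair :=
  (Submodule.span ℂ {p : L2Pair | ∃ φ : ℝ → ℝ, ContDiff ℝ ∞ φ ∧ HasCompactSupport φ ∧
    p.fst =ᵐ[volume] (fun x => ((deriv φ x : ℝ) : ℂ)) ∧
    p.snd =ᵐ[volume] fun x => ((k * φ x : ℝ) : ℂ)})ᗮ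

/-- The Hilbert space `H¹(ℝ)` with the squared norm `k² ‖f‖² + ‖f'‖²`. -/
def H1 (k : ℝ) : Type := ↥(h1Submodule k)

instance (k : ℝ) : NormedAddCommGroup (H1 k) := inferInstanceAs (NormedAddCommGroup (h1Submodule k))

instance (k : ℝ) : InnerProductSpace ℂ (H1 k) :=
  inferInstanceAs (InnerProductSpace ℂ (h1Submodule k))

instance (k : ℝ) : CompleteSpace (H1 k) :=
  inferInstanceAs (CompleteSpace (Submodule.span ℂ _)ᗮ)

theorem L2Pair.inner_eq (p q : L2Pair) :
    ⟪p, q⟫_ℂ = (∫ x, conj (p.fst x) * q.fst x) + ∫ x, conj (p.snd x) * q.snd x := by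
  rw [WithLp.prod_inner_apply, L2.inner_def, L2.inner_def]
  simp only [RCLike.inner_apply, mul_comm]
  rfl

/-- Orthogonality to the pairs `(φ', k φ)` is the weak formulation of `fst' = k snd`. An orthogonal
complement is closed, so completeness of `H1 k` needs no argument. -/
theorem mem_H1_iff {k : ℝ} {u : L2Pair} :
    u ∈ h1Submodule k ↔ ∀ φ : ℝ → ℝ, ContDiff ℝ ∞ φ → HasCompactSupport φ →
      (∫ x, deriv φ x • u.fst x) + ∫ x, (k * φ x) • u.snd x = 0 := by
  have hval : ∀ (φ : ℝ → ℝ) (p : L2Pair), p.fst =ᵐ[volume] (fun x => ((deriv φ x : ℝ) : ℂ)) →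
      p.snd =ᵐ[volume] (fun x => ((k * φ x : ℝ) : ℂ)) →
      ⟪p, u⟫_ℂ = (∫ x, deriv φ x • u.fst x) + ∫ x, (k * φ x) • u.snd x := fun φ p h1 h2 => by
    rw [L2Pair.inner_eq]
    congr 1 <;> refine integral_congr_ae ?_
    · filter_upwards [h1] with x hx
      rw [hx, Complex.conj_ofReal, Complex.real_smul]
    · filter_upwards [h2] with x hx
      rw [hx, Complex.conj_ofReal, Complex.real_smul]
  rw [h1Submodule, Submodule.mem_orthogonal]
  constructor
  · intro h φ hφ hc
    have m1 : MemLp (fun x => ((deriv φ x : ℝ) : ℂ)) 2 volume :=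
      (Complex.continuous_ofReal.comp (hφ.continuous_deriv (by simp))).memLp_of_hasCompactSupport
        (hc.deriv.comp_left (g := ((↑) : ℝ → ℂ)) (by simp))
    have m2 : MemLp (fun x => ((k * φ x : ℝ) : ℂ)) 2 volume :=
      (Complex.continuous_ofReal.comp (continuous_const.mul hφ.continuous)).memLp_of_hasCompactSupport
        ((hc.mul_left (f := fun _ => k)).comp_left (g := ((↑) : ℝ → ℂ)) (by simp))
    rw [← hval φ (WithLp.toLp 2 (m1.toLp, m2.toLp)) m1.coeFn_toLp m2.coeFn_toLp]
    exact h _ (Submodule.subset_span ⟨φ, hφ, hc, m1.coeFn_toLp, m2.coeFn_toLp⟩)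
  · intro h p hp
    induction hp using Submodule.span_induction with
    | mem p hp =>
      obtain ⟨φ, hφ, hc, h1, h2⟩ := hp
      rw [hval φ p h1 h2, h φ hφ hc]
    | zero => simp
    | add p q _ _ hp hq => rw [inner_add_left, hp, hq, add_zero]
    | smul c p _ hp => rw [inner_smul_left, hp, mul_zero]

/-- The pair `(k f, g)` as an element of `H1 k`. -/
def H1.mk (k : ℝ) {f g : ℝ → ℂ} (hf : MemLp f 2 volume) (hg : MemLp g 2 volume)
    (h : IsPrim f g) : H1 k :=
  ⟨WithLp.toLp 2 ((k : ℂ) • hf.toLp, hg.toLp), by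
    rw [mem_H1_iff]
    intro φ hφ hc
    have h1 : ((k : ℂ) • hf.toLp : Lp ℂ 2 (volume : Measure ℝ)) =ᵐ[volume] fun x => k * f x := by
      filter_upwards [Lp.coeFn_smul (k : ℂ) hf.toLp, hf.coeFn_toLp] with x h1 h2
      rw [h1, Pi.smul_apply, h2, smul_eq_mul]
    have e1 : ∫ x, deriv φ x • ((k : ℂ) • hf.toLp : Lp ℂ 2 (volume : Measure ℝ)) x =
        k * ∫ x, deriv φ x • f x := by
      rw [← integral_const_mul]
      refine integral_congr_ae ?_
      filter_upwards [h1] with x hx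
      rw [hx, Complex.real_smul, Complex.real_smul]; ring
    have e2 : ∫ x, (k * φ x) • (hg.toLp : Lp ℂ 2 (volume : Measure ℝ)) x =
        k * ∫ x, φ x • g x := by
      rw [← integral_const_mul]
      refine integral_congr_ae ?_
      filter_upwards [hg.coeFn_toLp] with x hx
      rw [hx, Complex.real_smul, Complex.real_smul]; push_cast; ring
    refine (congrArg₂ (· + ·) e1 e2).trans ?_
    rw [h.hasWeakDeriv.2.2 φ hφ hc]; ring⟩

namespace H1

variable {k : ℝ}

theorem inner_coe (u v : H1 k) : ⟪u, v⟫_ℂ = ⟪u.1, v.1⟫_ℂ := rfl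

/-- The derivative of an element of `H1 k`. -/
def der (u : H1 k) : ℝ → ℂ := u.1.snd

theorem memLp_der (u : H1 k) : MemLp u.der 2 volume := Lp.memLp _

theorem mk_fst_ae {f g : ℝ → ℂ} (hf : MemLp f 2 volume) (hg : MemLp g 2 volume)
    (h : IsPrim f g) : (mk k hf hg h).1.fst =ᵐ[volume] fun x => k * f x := by
  filter_upwards [Lp.coeFn_smul (k : ℂ) hf.toLp, hf.coeFn_toLp] with x h1 h2
  exact h1.trans (by rw [Pi.smul_apply, h2, smul_eq_mul])

theorem der_mk_ae {f g : ℝ → ℂ} (hf : MemLp f 2 volume) (hg : MemLp g 2 volume)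
    (h : IsPrim f g) : (mk k hf hg h).der =ᵐ[volume] g := hg.coeFn_toLp

/-- The exponential kernel as an element of `H1 k` (zero if `k ≤ 0`). -/
def ker (k y : ℝ) : H1 k :=
  if hk : 0 < k then mk k (memLp_expKer hk y) (memLp_expKer' hk y) (isPrim_expKer hk y) else 0

/-- Evaluation at a point, as a continuous linear functional. -/
def ev (y : ℝ) : H1 k →L[ℂ] ℂ := innerSL ℂ (ker k y)

/-- The continuous representative of an element of `H1 k`. -/
def fn (u : H1 k) (y : ℝ) : ℂ := ev y u

theorem fn_eq_inner (u : H1 k) (y : ℝ) : u.fn y = ⟪ker k y, u⟫_ℂ := rfl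

@[simp] theorem fn_add (u v : H1 k) (y : ℝ) : (u + v).fn y = u.fn y + v.fn y := map_add _ _ _
@[simp] theorem fn_sub (u v : H1 k) (y : ℝ) : (u - v).fn y = u.fn y - v.fn y := map_sub _ _ _
@[simp] theorem fn_neg (u : H1 k) (y : ℝ) : (-u).fn y = -u.fn y := map_neg _ _
@[simp] theorem fn_zero (y : ℝ) : (0 : H1 k).fn y = 0 := map_zero _
@[simp] theorem fn_smul (c : ℂ) (u : H1 k) (y : ℝ) : (c • u).fn y = c * u.fn y := map_smul _ _ _

theorem der_add_ae (u v : H1 k) : (u + v).der =ᵐ[volume] fun x => u.der x + v.der x :=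
  Lp.coeFn_add u.1.snd v.1.snd
theorem der_smul_ae (c : ℂ) (u : H1 k) : (c • u).der =ᵐ[volume] fun x => c * u.der x :=
  Lp.coeFn_smul c u.1.snd

theorem exists_isPrim (hk : 0 < k) (u : H1 k) :
    ∃ f, IsPrim f u.der ∧ MemLp f 2 volume ∧ u.1.fst =ᵐ[volume] fun x => k * f x := by
  have hk' : (k : ℂ) ≠ 0 := by exact_mod_cast hk.ne'
  have hF : MemLp (fun x => (k : ℂ)⁻¹ * u.1.fst x) 2 volume := (Lp.memLp u.1.fst).const_mul _
  have hw : HasWeakDeriv (fun x => (k : ℂ)⁻¹ * u.1.fst x) u.der := by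
    refine ⟨hF.locallyIntegrable', u.memLp_der.locallyIntegrable', fun φ hφ hc => ?_⟩
    have h := mem_H1_iff.1 u.2 φ hφ hc
    have e1 : ∫ x, deriv φ x • ((k : ℂ)⁻¹ * u.1.fst x) =
        (k : ℂ)⁻¹ * ∫ x, deriv φ x • u.1.fst x := by
      rw [← integral_const_mul]
      congr 1; ext x
      simp only [Complex.real_smul]; ring
    have e2 : ∫ x, (k * φ x) • u.1.snd x = k * ∫ x, φ x • u.der x := by
      rw [← integral_const_mul]
      congr 1; ext x
      simp only [Complex.real_smul, der]; push_cast; ring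
    rw [e2] at h
    rw [e1, eq_neg_of_add_eq_zero_left h]
    field_simp
  obtain ⟨f, hf, hae⟩ := hw.exists_isPrim
  refine ⟨f, hf, (memLp_congr_ae hae).1 hF, ?_⟩
  filter_upwards [hae] with x hx
  rw [← hx]; field_simp

/-- The values `fn` are inner products with the kernel; by the reproducing property
`integral_expKer_mul` they are the values of the absolutely continuous representative. -/
theorem fn_eq_of_isPrim (hk : 0 < k) {u : H1 k} {f g : ℝ → ℂ} (hp : IsPrim f g)
    (hf : MemLp f 2 volume) (hg : u.der =ᵐ[volume] g)
    (hae : u.1.fst =ᵐ[volume] fun x => k * f x) : u.fn = f := by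
  have hgm : MemLp g 2 volume := (memLp_congr_ae hg).1 u.memLp_der
  funext y
  rw [← integral_expKer_mul hk hp hf hgm y, fn_eq_inner, ker, dif_pos hk, inner_coe,
    L2Pair.inner_eq]
  rw [integral_add]
  · congr 1 <;> refine integral_congr_ae ?_
    · filter_upwards [mk_fst_ae (k := k) (memLp_expKer hk y) (memLp_expKer' hk y)
        (isPrim_expKer hk y), hae] with x h1 h2
      rw [h1, h2]
      simp only [map_mul, Complex.conj_ofReal]
      ring
    · filter_upwards [der_mk_ae (k := k) (memLp_expKer hk y) (memLp_expKer' hk y)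
        (isPrim_expKer hk y), hg] with x h1 h2
      simp only [der] at h1 h2
      rw [h1, h2, Complex.conj_ofReal]
  · exact ((memLp_expKer hk y).integrable_mul hf).const_mul _
  · exact (memLp_expKer' hk y).integrable_mul hgm

theorem isPrim (hk : 0 < k) (u : H1 k) : IsPrim u.fn u.der := by
  obtain ⟨f, h1, h2, h3⟩ := u.exists_isPrim hk
  rwa [fn_eq_of_isPrim hk h1 h2 (ae_eq_refl _) h3]

theorem memLp_fn (hk : 0 < k) (u : H1 k) : MemLp u.fn 2 volume := by
  obtain ⟨f, h1, h2, h3⟩ := u.exists_isPrim hk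
  rwa [fn_eq_of_isPrim hk h1 h2 (ae_eq_refl _) h3]

theorem fst_ae (hk : 0 < k) (u : H1 k) : u.1.fst =ᵐ[volume] fun x => k * u.fn x := by
  obtain ⟨f, h1, h2, h3⟩ := u.exists_isPrim hk
  rwa [fn_eq_of_isPrim hk h1 h2 (ae_eq_refl _) h3]

theorem continuous_fn (hk : 0 < k) (u : H1 k) : Continuous u.fn := (u.isPrim hk).continuous

theorem fn_mk (hk : 0 < k) {f g : ℝ → ℂ} (hf : MemLp f 2 volume) (hg : MemLp g 2 volume)
    (h : IsPrim f g) : (mk k hf hg h).fn = f :=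
  fn_eq_of_isPrim hk h hf (der_mk_ae hf hg h) (mk_fst_ae hf hg h)

theorem fn_ker (hk : 0 < k) (y z : ℝ) : (ker k y).fn z = expKer k y z := by
  rw [ker, dif_pos hk, fn_mk hk]

theorem inner_eq (hk : 0 < k) (u v : H1 k) :
    ⟪u, v⟫_ℂ = k ^ 2 * (∫ x, conj (u.fn x) * v.fn x) + ∫ x, conj (u.der x) * v.der x := by
  rw [inner_coe, L2Pair.inner_eq, ← integral_const_mul]
  congr 1
  refine integral_congr_ae ?_
  filter_upwards [u.fst_ae hk, v.fst_ae hk] with x h1 h2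
  rw [h1, h2, map_mul, Complex.conj_ofReal]
  ring

theorem norm_sq_eq (hk : 0 < k) (u : H1 k) :
    ‖u‖ ^ 2 = k ^ 2 * (∫ x, ‖u.fn x‖ ^ 2) + ∫ x, ‖u.der x‖ ^ 2 := by
  have h := inner_self_eq_norm_sq_to_K (𝕜 := ℂ) u
  rw [inner_eq hk] at h
  have h1 : ∀ f : ℝ → ℂ, ∫ x, conj (f x) * f x = ((∫ x, ‖f x‖ ^ 2 : ℝ) : ℂ) := fun f => by
    rw [← integral_complex_ofReal]
    congr 1; ext x
    rw [mul_comm, Complex.mul_conj, Complex.normSq_eq_norm_sq]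
  rw [h1, h1] at h
  refine Complex.ofReal_injective ?_
  push_cast
  exact h.symm

theorem ext_fn (hk : 0 < k) {u v : H1 k} (h : u.fn = v.fn) : u = v := by
  have h0 : (u - v).fn = 0 := by funext y; simp [h]
  have hd : (u - v).der =ᵐ[volume] 0 := by
    have := (u - v).isPrim hk
    rw [h0] at this
    have h1 : HasWeakDeriv (0 : ℝ → ℂ) 0 := (IsPrim.of_hasDerivAt (f := 0) (g := 0)
      (fun x => hasDerivAt_const x 0) continuous_const).hasWeakDeriv
    exact this.hasWeakDeriv.ae_eq h1
  have hn := norm_sq_eq hk (u - v)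
  have h2 : ∫ x, ‖(u - v).der x‖ ^ 2 = 0 := by
    rw [integral_congr_ae (g := fun _ => (0 : ℝ)), integral_zero]
    filter_upwards [hd] with x hx
    rw [hx]; simp
  rw [h2, h0] at hn
  simp only [Pi.zero_apply, norm_zero] at hn
  rw [← sub_eq_zero, ← norm_eq_zero]
  simpa using hn

/-- The squared norm of the kernel is its value at its own pole. The factor `1 / √(2 * k)` that this
gives for point evaluations is the source of the decay of the singular operator in `k`. -/
theorem norm_ker_sq (hk : 0 < k) (y : ℝ) : ‖ker k y‖ ^ 2 = 1 / (2 * k) := by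
  have h := inner_self_eq_norm_sq_to_K (𝕜 := ℂ) (ker k y)
  rw [← fn_eq_inner, fn_ker hk, expKer] at h
  simp only [sub_self, abs_zero, mul_zero, Real.exp_zero] at h
  refine Complex.ofReal_injective ?_
  push_cast at h ⊢
  exact h.symm

theorem norm_fn_le (hk : 0 < k) (u : H1 k) (y : ℝ) : ‖u.fn y‖ ≤ 1 / √(2 * k) * ‖u‖ := by
  have h : ‖ker k y‖ = 1 / √(2 * k) := by
    rw [← Real.sqrt_sq (norm_nonneg (ker k y)), norm_ker_sq hk, Real.sqrt_div zero_le_one,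
      Real.sqrt_one]
  rw [← h]
  exact norm_inner_le_norm (𝕜 := ℂ) (ker k y) u

theorem norm_fn_le' (hk : 1 ≤ k) (u : H1 k) (y : ℝ) : ‖u.fn y‖ ≤ ‖u‖ := by
  refine (norm_fn_le (by linarith) u y).trans ?_
  refine mul_le_of_le_one_left (norm_nonneg _) ?_
  rw [div_le_one (by positivity)]
  exact Real.one_le_sqrt.2 (by linarith)

theorem sqrt_der_le (hk : 0 < k) (u : H1 k) : √(∫ x, ‖u.der x‖ ^ 2) ≤ ‖u‖ := by
  rw [Real.sqrt_le_iff]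
  refine ⟨norm_nonneg _, ?_⟩
  rw [norm_sq_eq hk]
  have : 0 ≤ ∫ x, ‖u.fn x‖ ^ 2 := integral_nonneg fun x => by positivity
  nlinarith [mul_nonneg (sq_nonneg k) this]

theorem sqrt_fn_le (hk : 0 < k) (u : H1 k) : k * √(∫ x, ‖u.fn x‖ ^ 2) ≤ ‖u‖ := by
  have h0 : 0 ≤ ∫ x, ‖u.fn x‖ ^ 2 := integral_nonneg fun x => by positivity
  have h1 : 0 ≤ ∫ x, ‖u.der x‖ ^ 2 := integral_nonneg fun x => by positivity
  refine abs_le_of_sq_le_sq' ?_ (norm_nonneg _) |>.2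
  rw [norm_sq_eq hk, mul_pow, Real.sq_sqrt h0]
  linarith

theorem norm_le (hk : 0 < k) (u : H1 k) :
    ‖u‖ ≤ k * √(∫ x, ‖u.fn x‖ ^ 2) + √(∫ x, ‖u.der x‖ ^ 2) := by
  have h0 : 0 ≤ ∫ x, ‖u.fn x‖ ^ 2 := integral_nonneg fun x => by positivity
  have h1 : 0 ≤ ∫ x, ‖u.der x‖ ^ 2 := integral_nonneg fun x => by positivity
  refine abs_le_of_sq_le_sq' ?_ (by positivity) |>.2
  rw [norm_sq_eq hk, add_sq, mul_pow, Real.sq_sqrt h0, Real.sq_sqrt h1]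
  have : 0 ≤ 2 * (k * √(∫ x, ‖u.fn x‖ ^ 2)) * √(∫ x, ‖u.der x‖ ^ 2) := by positivity
  linarith

theorem norm_fn_sub_le (hk : 0 < k) (u : H1 k) (x y : ℝ) :
    ‖u.fn y - u.fn x‖ ≤ √|y - x| * ‖u‖ :=
  ((u.isPrim hk).norm_sub_le' u.memLp_der x y).trans (by gcongr; exact u.sqrt_der_le hk)

end H1

/-! ### The singular form -/

theorem opNorm_le_of_inner {E : Type*} [NormedAddCommGroup E] [InnerProductSpace ℂ E]
    {A : E →L[ℂ] E} {K : ℝ} (hK : 0 ≤ K) (h : ∀ u v, ‖⟪v, A u⟫_ℂ‖ ≤ K * ‖u‖ * ‖v‖) : ‖A‖ ≤ K := by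
  refine A.opNorm_le_bound hK fun u => ?_
  have h1 := h u (A u)
  rw [inner_self_eq_norm_sq_to_K, norm_pow] at h1
  simp only [RCLike.norm_ofReal, abs_norm] at h1
  rcases (norm_nonneg (A u)).eq_or_lt with h0 | h0
  · rw [← h0]; positivity
  · rw [sq] at h1
    exact le_of_mul_le_mul_right h1 h0

/-- A bounded sesquilinear form on a Hilbert space is represented by a bounded operator. -/
theorem exists_clm_of_form {E : Type*} [NormedAddCommGroup E] [InnerProductSpace ℂ E]
    [CompleteSpace E] (F : E → E → ℂ) (K : ℝ) (h1 : ∀ u u' v, F (u + u') v = F u v + F u' v)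
    (h2 : ∀ u v v', F u (v + v') = F u v + F u v') (h3 : ∀ (c : ℂ) u v, F (c • u) v = c * F u v)
    (h4 : ∀ (c : ℂ) u v, F u (c • v) = conj c * F u v) (hK : ∀ u v, ‖F u v‖ ≤ K * ‖u‖ * ‖v‖) :
    ∃ A : E →L[ℂ] E, ∀ u v, ⟪v, A u⟫_ℂ = F u v := by
  let B : E →ₗ⋆[ℂ] E →ₗ[ℂ] ℂ := LinearMap.mk₂'ₛₗ (starRingEnd ℂ) (RingHom.id ℂ)
    (fun v u => F u v) (fun v v' u => h2 u v v') (fun c v u => h4 c u v)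
    (fun v u u' => h1 u u' v) (fun c v u => h3 c u v)
  let B' : E →L⋆[ℂ] E →L[ℂ] ℂ := B.mkContinuous₂ K fun v u =>
    (hK u v).trans (le_of_eq (by ring))
  -- The operator attached to a bilinear form acts on the conjugate-linear slot; the adjoint moves
  -- it to the linear one.
  refine ⟨ContinuousLinearMap.adjoint (InnerProductSpace.continuousLinearMapOfBilin B'),
    fun u v => ?_⟩
  rw [ContinuousLinearMap.adjoint_inner_right,
    InnerProductSpace.continuousLinearMapOfBilin_apply]
  rfl

/-- The derivative of `β u v̄`. -/
def formDensity {k : ℝ} (β : ℝ → ℝ) (u v : H1 k) (z : ℝ) : ℂ :=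
  ((deriv β z : ℝ) : ℂ) * (u.fn z * conj (v.fn z)) +
    (β z : ℂ) * (u.der z * conj (v.fn z) + u.fn z * conj (v.der z))

/-- The form `- ∫ l (β u v̄)'` over `[-2, 2]`. -/
def form {k : ℝ} (β : ℝ → ℝ) (l : ℝ → ℂ) (u v : H1 k) : ℂ :=
  -∫ z in Ioc (-2 : ℝ) 2, l z * formDensity β u v z

/-- A smooth coefficient which is bounded by `C`, together with its derivative, on `[-2, 2]`. -/
structure IsCoeff (β : ℝ → ℝ) (C : ℝ) : Prop where
  smooth : ContDiff ℝ ∞ β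
  nonneg : 0 ≤ C
  bound : ∀ z ∈ Icc (-2 : ℝ) 2, |β z| ≤ C
  bound_deriv : ∀ z ∈ Icc (-2 : ℝ) 2, |deriv β z| ≤ C

theorem isPrim_ofReal {β : ℝ → ℝ} (hβ : ContDiff ℝ ∞ β) :
    IsPrim (fun z => (β z : ℂ)) (fun z => ((deriv β z : ℝ) : ℂ)) :=
  IsPrim.of_hasDerivAt (fun z => ((hβ.differentiable (by simp)) z).hasDerivAt.ofReal_comp)
    (Complex.continuous_ofReal.comp (hβ.continuous_deriv (by simp)))

section

variable {k : ℝ} {β : ℝ → ℝ} {C : ℝ}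

theorem isPrim_formDensity (hk : 0 < k) (hβ : ContDiff ℝ ∞ β) (u v : H1 k) :
    IsPrim (fun z => β z * (u.fn z * conj (v.fn z))) (formDensity β u v) :=
  (isPrim_ofReal hβ).mul ((u.isPrim hk).mul (v.isPrim hk).conj)

theorem norm_formDensity_le (hβ : IsCoeff β C) (u v : H1 k) {z : ℝ} (hz : z ∈ Ioc (-2 : ℝ) 2) :
    ‖formDensity β u v z‖ ≤ C * (‖u.fn z‖ * ‖v.fn z‖ + ‖v.fn z‖ * ‖u.der z‖ +
      ‖u.fn z‖ * ‖v.der z‖) := by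
  have h1 := hβ.bound z (Ioc_subset_Icc_self hz)
  have h2 := hβ.bound_deriv z (Ioc_subset_Icc_self hz)
  have hC := hβ.nonneg
  calc ‖formDensity β u v z‖ ≤ |deriv β z| * (‖u.fn z‖ * ‖v.fn z‖) +
        |β z| * (‖u.der z‖ * ‖v.fn z‖ + ‖u.fn z‖ * ‖v.der z‖) := by
        refine (norm_add_le _ _).trans ?_
        rw [norm_mul, norm_mul, norm_mul, Complex.norm_real, Complex.norm_real, RCLike.norm_conj,
          Real.norm_eq_abs, Real.norm_eq_abs]
        gcongr
        refine (norm_add_le _ _).trans ?_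
        rw [norm_mul, norm_mul, RCLike.norm_conj, RCLike.norm_conj]
    _ ≤ C * (‖u.fn z‖ * ‖v.fn z‖) + C * (‖u.der z‖ * ‖v.fn z‖ + ‖u.fn z‖ * ‖v.der z‖) := by
        gcongr
    _ = _ := by ring

theorem integral_Ioc_sq_le {f : ℝ → ℂ} (hf : MemLp f 2 volume) (s : Set ℝ) :
    √(∫ z in s, ‖f z‖ ^ 2) ≤ √(∫ z, ‖f z‖ ^ 2) :=
  Real.sqrt_le_sqrt (setIntegral_le_integral (memLp_two_norm hf)
    (Filter.Eventually.of_forall fun _ => sq_nonneg _))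

theorem integrable_mul_formDensity (hk : 0 < k) (hβ : IsCoeff β C) {l : ℝ → ℂ}
    (hl : MemLp l 2 (volume.restrict (Ioc (-2 : ℝ) 2))) (u v : H1 k) :
    IntegrableOn (fun z => l z * formDensity β u v z) (Ioc (-2 : ℝ) 2) := by
  have hm : AEStronglyMeasurable (formDensity β u v) (volume.restrict (Ioc (-2 : ℝ) 2)) :=
    (isPrim_formDensity hk hβ.smooth u v).locInt.aestronglyMeasurable.restrict
  set P := 1 / √(2 * k) * ‖u‖
  set Q := 1 / √(2 * k) * ‖v‖
  have hQ : 0 ≤ Q := by positivity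
  have hP : 0 ≤ P := by positivity
  refine Integrable.mono' (g := fun z => C * (P * (‖l z‖ * ‖v.fn z‖) + Q * (‖l z‖ * ‖u.der z‖) +
      P * (‖l z‖ * ‖v.der z‖))) ?_ (hl.1.mul hm) ?_
  · refine Integrable.const_mul (((Integrable.const_mul ?_ _).add (Integrable.const_mul ?_ _)).add
      (Integrable.const_mul ?_ _)) _
    · exact integrable_norm_mul_norm hl ((v.memLp_fn hk).restrict _)
    · exact integrable_norm_mul_norm hl (u.memLp_der.restrict _)
    · exact integrable_norm_mul_norm hl (v.memLp_der.restrict _)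
  · filter_upwards [ae_restrict_mem measurableSet_Ioc] with z hz
    have hC := hβ.nonneg
    have h1 := u.norm_fn_le hk z
    have h2 := v.norm_fn_le hk z
    rw [norm_mul]
    calc _ ≤ ‖l z‖ * (C * (P * ‖v.fn z‖ + Q * ‖u.der z‖ + P * ‖v.der z‖)) := by
          gcongr
          refine (norm_formDensity_le hβ u v hz).trans ?_
          gcongr
      _ = _ := by ring

/-- Bounds `P`, `Q` for the values are kept apart from the norms, because they are used in two ways:
the bound of order `1/√k` from point evaluation gives decay in `k`, and the smallness of functions
vanishing at many nodes gives compactness. -/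
theorem norm_form_le (hk : 1 ≤ k) (hβ : IsCoeff β C) {l : ℝ → ℂ}
    (hl : MemLp l 2 (volume.restrict (Ioc (-2 : ℝ) 2))) (u v : H1 k) {P Q : ℝ}
    (hP : ∀ z ∈ Ioc (-2 : ℝ) 2, ‖u.fn z‖ ≤ P) (hQ : ∀ z ∈ Ioc (-2 : ℝ) 2, ‖v.fn z‖ ≤ Q) :
    ‖form β l u v‖ ≤
      C * √(∫ z in Ioc (-2 : ℝ) 2, ‖l z‖ ^ 2) * (2 * P * ‖v‖ + Q * ‖u‖) := by
  have hk0 : 0 < k := by linarith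
  have hP0 : 0 ≤ P := (norm_nonneg _).trans (hP 0 (by constructor <;> norm_num))
  have hQ0 : 0 ≤ Q := (norm_nonneg _).trans (hQ 0 (by constructor <;> norm_num))
  have hC := hβ.nonneg
  set Λ := √(∫ z in Ioc (-2 : ℝ) 2, ‖l z‖ ^ 2)
  have hΛ : 0 ≤ Λ := Real.sqrt_nonneg _
  have i1 := integrable_norm_mul_norm hl ((v.memLp_fn hk0).restrict (Ioc (-2 : ℝ) 2))
  have i2 := integrable_norm_mul_norm hl (u.memLp_der.restrict (Ioc (-2 : ℝ) 2))
  have i3 := integrable_norm_mul_norm hl (v.memLp_der.restrict (Ioc (-2 : ℝ) 2))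
  have b1 := integral_norm_mul_norm_le hl ((v.memLp_fn hk0).restrict (Ioc (-2 : ℝ) 2))
  have b2 := integral_norm_mul_norm_le hl (u.memLp_der.restrict (Ioc (-2 : ℝ) 2))
  have b3 := integral_norm_mul_norm_le hl (v.memLp_der.restrict (Ioc (-2 : ℝ) 2))
  have n1 : √(∫ z in Ioc (-2 : ℝ) 2, ‖v.fn z‖ ^ 2) ≤ ‖v‖ := by
    refine (integral_Ioc_sq_le (v.memLp_fn hk0) _).trans (le_trans ?_ (v.sqrt_fn_le hk0))
    exact le_mul_of_one_le_left (Real.sqrt_nonneg _) hk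
  have n2 : √(∫ z in Ioc (-2 : ℝ) 2, ‖u.der z‖ ^ 2) ≤ ‖u‖ :=
    (integral_Ioc_sq_le u.memLp_der _).trans (u.sqrt_der_le hk0)
  have n3 : √(∫ z in Ioc (-2 : ℝ) 2, ‖v.der z‖ ^ 2) ≤ ‖v‖ :=
    (integral_Ioc_sq_le v.memLp_der _).trans (v.sqrt_der_le hk0)
  rw [form, norm_neg]
  calc ‖∫ z in Ioc (-2 : ℝ) 2, l z * formDensity β u v z‖
      ≤ ∫ z in Ioc (-2 : ℝ) 2, C * (P * (‖l z‖ * ‖v.fn z‖) + Q * (‖l z‖ * ‖u.der z‖) +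
          P * (‖l z‖ * ‖v.der z‖)) := by
        refine norm_integral_le_of_norm_le ((((i1.const_mul _).add (i2.const_mul _)).add
          (i3.const_mul _)).const_mul _) ?_
        filter_upwards [ae_restrict_mem measurableSet_Ioc] with z hz
        have h1 := hP z hz
        have h2 := hQ z hz
        rw [norm_mul]
        calc _ ≤ ‖l z‖ * (C * (P * ‖v.fn z‖ + Q * ‖u.der z‖ + P * ‖v.der z‖)) := by
              gcongr
              refine (norm_formDensity_le hβ u v hz).trans ?_
              gcongr
          _ = _ := by ring
    _ = C * (P * (∫ z in Ioc (-2 : ℝ) 2, ‖l z‖ * ‖v.fn z‖) +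
          Q * (∫ z in Ioc (-2 : ℝ) 2, ‖l z‖ * ‖u.der z‖) +
          P * ∫ z in Ioc (-2 : ℝ) 2, ‖l z‖ * ‖v.der z‖) := by
        have i12 : IntegrableOn (fun z => P * (‖l z‖ * ‖v.fn z‖) + Q * (‖l z‖ * ‖u.der z‖))
            (Ioc (-2 : ℝ) 2) := (i1.const_mul _).add (i2.const_mul _)
        rw [integral_const_mul, integral_add i12 (i3.const_mul _), integral_add (i1.const_mul _) (i2.const_mul _), integral_const_mul,
          integral_const_mul, integral_const_mul]
    _ ≤ C * (P * (Λ * ‖v‖) + Q * (Λ * ‖u‖) + P * (Λ * ‖v‖)) := by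
        gcongr
        · exact b1.trans (by gcongr)
        · exact b2.trans (by gcongr)
        · exact b3.trans (by gcongr)
    _ = _ := by ring

theorem norm_form_le' (hk : 1 ≤ k) (hβ : IsCoeff β C) {l : ℝ → ℂ}
    (hl : MemLp l 2 (volume.restrict (Ioc (-2 : ℝ) 2))) (u v : H1 k) :
    ‖form β l u v‖ ≤
      3 * C * √(∫ z in Ioc (-2 : ℝ) 2, ‖l z‖ ^ 2) / √k * ‖u‖ * ‖v‖ := by
  have hk0 : 0 < k := by linarith
  have hC := hβ.nonneg
  have hs : 1 / √(2 * k) ≤ 1 / √k := by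
    gcongr; linarith
  have hu : ∀ u : H1 k, ∀ z ∈ Ioc (-2 : ℝ) 2, ‖u.fn z‖ ≤ 1 / √k * ‖u‖ := fun u z _ =>
    (u.norm_fn_le hk0 z).trans (by gcongr)
  refine (norm_form_le hk hβ hl u v (hu u) (hu v)).trans (le_of_eq ?_)
  ring

theorem form_add_left (hk : 0 < k) (hβ : IsCoeff β C) {l : ℝ → ℂ}
    (hl : MemLp l 2 (volume.restrict (Ioc (-2 : ℝ) 2))) (u u' v : H1 k) :
    form β l (u + u') v = form β l u v + form β l u' v := by
  rw [form, form, form, ← neg_add, ← integral_add (integrable_mul_formDensity hk hβ hl u v)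
    (integrable_mul_formDensity hk hβ hl u' v)]
  congr 1
  refine integral_congr_ae (ae_restrict_of_ae ?_)
  filter_upwards [H1.der_add_ae u u'] with z hz
  simp only [formDensity, hz, H1.fn_add]
  ring

theorem form_add_right (hk : 0 < k) (hβ : IsCoeff β C) {l : ℝ → ℂ}
    (hl : MemLp l 2 (volume.restrict (Ioc (-2 : ℝ) 2))) (u v v' : H1 k) :
    form β l u (v + v') = form β l u v + form β l u v' := by
  rw [form, form, form, ← neg_add, ← integral_add (integrable_mul_formDensity hk hβ hl u v)
    (integrable_mul_formDensity hk hβ hl u v')]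
  congr 1
  refine integral_congr_ae (ae_restrict_of_ae ?_)
  filter_upwards [H1.der_add_ae v v'] with z hz
  simp only [formDensity, hz, H1.fn_add, map_add]
  ring

theorem form_smul_left (l : ℝ → ℂ) (c : ℂ) (u v : H1 k) :
    form β l (c • u) v = c * form β l u v := by
  rw [form, form, mul_neg, ← integral_const_mul]
  congr 1
  refine integral_congr_ae (ae_restrict_of_ae ?_)
  filter_upwards [H1.der_smul_ae c u] with z hz
  simp only [formDensity, hz, H1.fn_smul]
  ring

theorem form_smul_right (l : ℝ → ℂ) (c : ℂ) (u v : H1 k) :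
    form β l u (c • v) = conj c * form β l u v := by
  rw [form, form, mul_neg, ← integral_const_mul]
  congr 1
  refine integral_congr_ae (ae_restrict_of_ae ?_)
  filter_upwards [H1.der_smul_ae c v] with z hz
  simp only [formDensity, hz, H1.fn_smul, map_mul]
  ring

theorem form_sub_weight (hk : 0 < k) (hβ : IsCoeff β C) {l l' : ℝ → ℂ}
    (hl : MemLp l 2 (volume.restrict (Ioc (-2 : ℝ) 2)))
    (hl' : MemLp l' 2 (volume.restrict (Ioc (-2 : ℝ) 2))) (u v : H1 k) :
    form β (fun z => l z - l' z) u v = form β l u v - form β l' u v := by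
  have h := integral_sub (integrable_mul_formDensity hk hβ hl u v)
    (integrable_mul_formDensity hk hβ hl' u v)
  simp only [form, sub_mul]
  rw [h]; ring

/-- Integration by parts in the singular form. -/
theorem form_eq_integral (hk : 0 < k) (hβ : IsCoeff β C) (h2 : β 2 = 0) (h2' : β (-2) = 0)
    {l l' : ℝ → ℂ} (hd : ∀ z, HasDerivAt l (l' z) z) (hc : Continuous l') (u v : H1 k) :
    form β l u v = ∫ z in Ioc (-2 : ℝ) 2, l' z * (β z * (u.fn z * conj (v.fn z))) := by
  have hp := isPrim_formDensity hk hβ.smooth u v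
  have hlp := IsPrim.of_hasDerivAt hd hc
  have h := (hlp.mul hp).sub_eq (-2) 2
  rw [h2, h2', intervalIntegral.integral_add] at h
  · simp only [Complex.ofReal_zero, zero_mul, mul_zero, sub_self] at h
    rw [form, ← intervalIntegral.integral_of_le (by norm_num),
      ← intervalIntegral.integral_of_le (by norm_num)]
    exact neg_eq_of_add_eq_zero_left h.symm
  · exact (hc.mul hp.continuous).intervalIntegrable _ _
  · exact (hp.intervalIntegrable _ _).continuousOn_mul hlp.continuous.continuousOn

theorem exists_opA (hk : 1 ≤ k) (hβ : IsCoeff β C) {l : ℝ → ℂ}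
    (hl : MemLp l 2 (volume.restrict (Ioc (-2 : ℝ) 2))) :
    ∃ A : H1 k →L[ℂ] H1 k, ∀ u v, ⟪v, A u⟫_ℂ = form β l u v :=
  have hk0 : 0 < k := by linarith
  exists_clm_of_form (form β l) _ (form_add_left hk0 hβ hl) (form_add_right hk0 hβ hl)
    (form_smul_left l) (form_smul_right l) (norm_form_le' hk hβ hl)

open Classical in
/-- The bounded operator representing the form `form β l` (zero if there is none). -/
def opA (k : ℝ) (β : ℝ → ℝ) (l : ℝ → ℂ) : H1 k →L[ℂ] H1 k :=
  if h : ∃ A : H1 k →L[ℂ] H1 k, ∀ u v, ⟪v, A u⟫_ℂ = form β l u v then h.choose else 0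

theorem inner_opA (hk : 1 ≤ k) (hβ : IsCoeff β C) {l : ℝ → ℂ}
    (hl : MemLp l 2 (volume.restrict (Ioc (-2 : ℝ) 2))) (u v : H1 k) :
    ⟪v, opA k β l u⟫_ℂ = form β l u v := by
  have h := exists_opA hk hβ hl
  rw [opA, dif_pos h]
  exact h.choose_spec u v

theorem norm_opA_le (hk : 1 ≤ k) (hβ : IsCoeff β C) {l : ℝ → ℂ}
    (hl : MemLp l 2 (volume.restrict (Ioc (-2 : ℝ) 2))) :
    ‖opA k β l‖ ≤ 3 * C * √(∫ z in Ioc (-2 : ℝ) 2, ‖l z‖ ^ 2) / √k := by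
  have hC := hβ.nonneg
  refine opNorm_le_of_inner (by positivity) fun u v => ?_
  rw [inner_opA hk hβ hl]
  exact norm_form_le' hk hβ hl u v

theorem norm_opA_sub_le (hk : 1 ≤ k) (hβ : IsCoeff β C) {l l' : ℝ → ℂ}
    (hl : MemLp l 2 (volume.restrict (Ioc (-2 : ℝ) 2)))
    (hl' : MemLp l' 2 (volume.restrict (Ioc (-2 : ℝ) 2))) :
    ‖opA k β l - opA k β l'‖ ≤
      3 * C * √(∫ z in Ioc (-2 : ℝ) 2, ‖l z - l' z‖ ^ 2) / √k := by
  have hC := hβ.nonneg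
  refine opNorm_le_of_inner (by positivity) fun u v => ?_
  rw [sub_apply, inner_sub_right, inner_opA hk hβ hl, inner_opA hk hβ hl',
    ← form_sub_weight (by linarith) hβ hl hl']
  exact norm_form_le' hk hβ (hl.sub hl') u v

/-! ### Compactness of the operator of the form. -/

/-- The span of the kernels with poles at `-2 + 4 i / (n + 1)`, `i ≤ n + 1`. -/
def nodeSpan (k : ℝ) (n : ℕ) : Submodule ℂ (H1 k) :=
  Submodule.span ℂ (Set.range fun i : Fin (n + 2) => H1.ker k (-2 + 4 * (i : ℕ) / (n + 1)))

instance (k : ℝ) (n : ℕ) : FiniteDimensional ℂ (nodeSpan k n) :=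
  FiniteDimensional.span_of_finite ℂ (Set.finite_range _)

/-- Orthogonality to the kernels means vanishing at the nodes. Each point is within `4 / (n + 1)` of
a node, and elements of `H1 k` are Hölder of order `1/2`. -/
theorem norm_fn_le_of_mem_orthogonal (hk : 0 < k) {n : ℕ} {u : H1 k} (hu : u ∈ (nodeSpan k n)ᗮ)
    {z : ℝ} (hz : z ∈ Ioc (-2 : ℝ) 2) : ‖u.fn z‖ ≤ √(4 / (n + 1)) * ‖u‖ := by
  -- The index of the closest node to the left of `z`. The point `z = 2` has index `n + 1`, which is
  -- why there are `n + 2` nodes.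
  set i := ⌊(z + 2) / 4 * (n + 1)⌋₊ with hi
  have hn : (0 : ℝ) < n + 1 := by positivity
  have hpos : 0 ≤ (z + 2) / 4 * (n + 1) := by
    have := hz.1; have : 0 ≤ z + 2 := by linarith
    positivity
  have h1 : (i : ℝ) ≤ (z + 2) / 4 * (n + 1) := Nat.floor_le hpos
  have h2 : (z + 2) / 4 * (n + 1) < i + 1 := Nat.lt_floor_add_one _
  have h3 : i < n + 2 := by
    have : (i : ℝ) ≤ n + 1 := h1.trans (by nlinarith [hz.2])
    have : i ≤ n + 1 := by exact_mod_cast this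
    omega
  set x : ℝ := -2 + 4 * (i : ℕ) / (n + 1) with hx
  have h0 : u.fn x = 0 := by
    rw [H1.fn_eq_inner]
    exact (Submodule.mem_orthogonal _ _).1 hu _ (Submodule.subset_span ⟨⟨i, h3⟩, rfl⟩)
  have h4 := u.norm_fn_sub_le hk x z
  rw [h0, sub_zero] at h4
  refine h4.trans ?_
  gcongr
  have e : z - x = ((z + 2) / 4 * (n + 1) - i) * (4 / (n + 1)) := by
    rw [hx]; field_simp; ring
  rw [e, abs_of_nonneg (mul_nonneg (by linarith) (by positivity))]
  exact mul_le_of_le_one_left (by positivity) (by linarith)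

/-- With `P` the projection onto the span of the kernels, `F n = P A + (1 - P) A P` has finite rank
and `A - F n = (1 - P) A (1 - P)`. The form of this remainder only sees functions vanishing at the
nodes, so `norm_form_le` makes it small. -/
theorem isCompactOperator_opA (hk : 1 ≤ k) (hβ : IsCoeff β C) {l : ℝ → ℂ}
    (hl : MemLp l 2 (volume.restrict (Ioc (-2 : ℝ) 2))) : IsCompactOperator (opA k β l) := by
  have hk0 : 0 < k := by linarith
  set A := opA k β l
  let P : ℕ → H1 k →L[ℂ] H1 k := fun n => (nodeSpan k n).starProjection
  have hP : ∀ n, IsCompactOperator (P n) := fun n =>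
    haveI : ProperSpace (nodeSpan k n) := FiniteDimensional.proper ℂ _
    (isCompactOperator_of_locallyCompactSpace_dom
      (nodeSpan k n).orthogonalProjectionOnto).clm_comp (nodeSpan k n).subtypeL
  have hC := hβ.nonneg
  let F : ℕ → H1 k →L[ℂ] H1 k := fun n => P n ∘L A + (A - P n ∘L A) ∘L P n
  have hF : ∀ n, IsCompactOperator (F n) := fun n =>
    ((hP n).comp_clm A).add ((hP n).clm_comp (A - P n ∘L A))
  set Λ := √(∫ z in Ioc (-2 : ℝ) 2, ‖l z‖ ^ 2)
  have hbound : ∀ n, ‖A - F n‖ ≤ 3 * C * Λ * √(4 / (n + 1)) := fun n => by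
    refine opNorm_le_of_inner (by positivity) fun u v => ?_
    set u' := u - P n u with hu'
    set v' := v - P n v with hv'
    have hu : u' ∈ (nodeSpan k n)ᗮ := Submodule.sub_starProjection_mem_orthogonal u
    have hv : v' ∈ (nodeSpan k n)ᗮ := Submodule.sub_starProjection_mem_orthogonal v
    have nu : ‖u'‖ ≤ ‖u‖ := by
      rw [hu', ← Submodule.starProjection_orthogonal_val]
      exact Submodule.norm_starProjection_apply_le _ _
    have nv : ‖v'‖ ≤ ‖v‖ := by
      rw [hv', ← Submodule.starProjection_orthogonal_val]
      exact Submodule.norm_starProjection_apply_le _ _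
    have e : ⟪v, (A - F n) u⟫_ℂ = form β l u' v' := by
      rw [← inner_opA hk hβ hl]
      have : (A - F n) u = A u' - P n (A u') := by
        simp only [F, hu', sub_apply, add_apply,
          ContinuousLinearMap.comp_apply, map_sub]
        abel
      rw [this, hv', inner_sub_right, inner_sub_left]
      congr 1
      exact (Submodule.inner_starProjection_left_eq_right _ _ _).symm
    rw [e]
    calc ‖form β l u' v'‖ ≤ C * Λ * (2 * (√(4 / (n + 1)) * ‖u'‖) * ‖v'‖ +
          (√(4 / (n + 1)) * ‖v'‖) * ‖u'‖) :=
        norm_form_le hk hβ hl u' v' (fun z hz => norm_fn_le_of_mem_orthogonal hk0 hu hz)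
          (fun z hz => norm_fn_le_of_mem_orthogonal hk0 hv hz)
      _ = 3 * C * Λ * √(4 / (n + 1)) * ‖u'‖ * ‖v'‖ := by ring
      _ ≤ _ := by gcongr
  refine isCompactOperator_of_tendsto (F := F) (l := Filter.atTop) ?_
    (Filter.Eventually.of_forall hF)
  rw [tendsto_iff_norm_sub_tendsto_zero]
  refine squeeze_zero (fun _ => norm_nonneg _) (fun n =>
    (norm_sub_rev (F n) A).trans_le (hbound n)) ?_
  have t : Filter.Tendsto (fun n : ℕ => √(4 / ((n : ℝ) + 1))) Filter.atTop (nhds 0) := by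
    have := (tendsto_one_div_add_atTop_nhds_zero_nat (𝕜 := ℝ)).const_mul 4
    have h2 := (Real.continuous_sqrt.tendsto _).comp this
    simp only [mul_zero, Real.sqrt_zero] at h2
    refine h2.congr fun n => ?_
    simp [div_eq_mul_inv]
  simpa only [mul_zero] using t.const_mul (3 * C * Λ)

end

/-! ### Elementary properties of the shear flow -/

namespace IsShearFlow

variable {b : ℝ → ℝ}

theorem differentiable (hb : IsShearFlow b) : Differentiable ℝ b :=
  hb.smooth.differentiable (by simp)

theorem continuous (hb : IsShearFlow b) : Continuous b := hb.smooth.continuous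

theorem contDiff_deriv (hb : IsShearFlow b) : ContDiff ℝ ∞ (deriv b) :=
  (contDiff_infty_iff_deriv.1 hb.smooth).2

theorem contDiff_deriv2 (hb : IsShearFlow b) : ContDiff ℝ ∞ (deriv (deriv b)) :=
  (contDiff_infty_iff_deriv.1 hb.contDiff_deriv).2

theorem deriv_pos (hb : IsShearFlow b) (y : ℝ) : 0 < deriv b y := by
  obtain ⟨c, hc, h⟩ := hb.deriv_gt
  exact hc.trans (h y)

theorem mul_abs_sub_le (hb : IsShearFlow b) {c : ℝ} (h : ∀ y, c < deriv b y)
    (y z : ℝ) : c * |z - y| ≤ |b z - b y| := by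
  wlog hyz : y ≤ z generalizing y z
  · rw [abs_sub_comm, abs_sub_comm (b z)]
    exact this z y (not_le.1 hyz).le
  rw [abs_of_nonneg (by linarith)]
  refine le_trans ?_ (le_abs_self _)
  exact mul_sub_le_image_sub_of_le_deriv hb.differentiable (fun x => (h x).le) hyz

theorem strictMono (hb : IsShearFlow b) : StrictMono b :=
  strictMono_of_deriv_pos hb.deriv_pos

theorem surjective (hb : IsShearFlow b) : Function.Surjective b := by
  obtain ⟨c, hc, h⟩ := hb.deriv_gt
  refine hb.continuous.surjective ?_ ?_
  · refine Filter.tendsto_atTop_mono' _ ?_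
      (Filter.tendsto_atTop_add_const_left _ (b 0) (Filter.tendsto_id.const_mul_atTop hc))
    filter_upwards [Filter.eventually_ge_atTop 0] with z hz
    have := mul_sub_le_image_sub_of_le_deriv hb.differentiable (fun x => (h x).le) hz
    simp only [id]
    linarith
  · refine Filter.tendsto_atBot_mono' _ ?_
      (Filter.tendsto_atBot_add_const_left _ (b 0) (Filter.tendsto_id.const_mul_atBot hc))
    filter_upwards [Filter.eventually_le_atBot 0] with z hz
    have := mul_sub_le_image_sub_of_le_deriv hb.differentiable (fun x => (h x).le) hz
    simp only [id]
    linarith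

/-- The hypothesis covers only the exterior of the closed interval; continuity adds the endpoints,
so integration by parts on `[-2, 2]` has no boundary terms. -/
theorem deriv2_two (hb : IsShearFlow b) : deriv (deriv b) 2 = 0 ∧ deriv (deriv b) (-2) = 0 := by
  have hc : Continuous (deriv (deriv b)) := hb.contDiff_deriv2.continuous
  have hcl : IsClosed {y | deriv (deriv b) y = 0} := isClosed_eq hc continuous_const
  constructor
  · have : (2 : ℝ) ∈ closure (Ioi 2) := by rw [closure_Ioi]; exact self_mem_Ici
    refine hcl.closure_subset_iff.2 (fun y hy => ?_) this
    exact hb.deriv_deriv_eq_zero y fun h => by linarith [h.2, mem_Ioi.1 hy]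
  · have : (-2 : ℝ) ∈ closure (Iio (-2)) := by rw [closure_Iio]; exact self_mem_Iic
    refine hcl.closure_subset_iff.2 (fun y hy => ?_) this
    exact hb.deriv_deriv_eq_zero y fun h => by linarith [h.1, mem_Iio.1 hy]

end IsShearFlow

/-! ### The logarithmic weight -/

/-- The limit of `arctan (x / t)`, extended to `t = 0`. -/
def angle (t x : ℝ) : ℝ := if t = 0 then Real.pi / 2 * Real.sign x else Real.arctan (x / t)

/-- A primitive of `b' / (b - w + i s t)`, where `s = ± 1`, extended to `t = 0`. -/
def logW (b : ℝ → ℝ) (s t w z : ℝ) : ℂ :=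
  (((1 / 2) * Real.log ((b z - w) ^ 2 + t ^ 2) : ℝ) : ℂ) -
    Complex.I * ((s * angle t (b z - w) : ℝ) : ℂ)

theorem abs_angle_le (t x : ℝ) : |angle t x| ≤ Real.pi / 2 := by
  have hpi := Real.pi_pos
  unfold angle
  split_ifs
  · rw [abs_mul, abs_of_pos (by positivity)]
    refine mul_le_of_le_one_right (by positivity) ?_
    rcases Real.sign_apply_eq x with h | h | h <;> rw [h] <;> norm_num
  · exact abs_le.2 ⟨(Real.neg_pi_div_two_lt_arctan _).le, (Real.arctan_lt_pi_div_two _).le⟩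

theorem measurable_sign' : Measurable Real.sign := by
  unfold Real.sign
  exact Measurable.ite measurableSet_Iio measurable_const
    (Measurable.ite measurableSet_Ioi measurable_const measurable_const)

theorem measurable_angle (t : ℝ) : Measurable (angle t) := by
  unfold angle
  by_cases h : t = 0
  · simp only [h, if_true]
    exact measurable_sign'.const_mul _
  · simp only [h, if_false]
    exact Real.measurable_arctan.comp (measurable_id.div_const t)

theorem measurable_logW {b : ℝ → ℝ} (hb : Continuous b) (s t w : ℝ) :
    Measurable (logW b s t w) := by
  unfold logW
  refine (Complex.measurable_ofReal.comp ?_).sub (measurable_const.mul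
    (Complex.measurable_ofReal.comp ?_))
  · have := hb.measurable
    fun_prop
  · exact ((measurable_angle t).comp (hb.measurable.sub_const w)).const_mul s

/-- As `s ^ 2 = 1`, the product `(x + i s t) (x - i s t)` is `x² + t²`. The weight is a logarithm of
`x + i s t` up to a constant, chosen so that the imaginary part is odd in `x = b z - w`. -/
theorem hasDerivAt_logW {b : ℝ → ℝ} (hb : Differentiable ℝ b) {s t : ℝ} (hs : s ^ 2 = 1)
    (ht : 0 < t) (w z : ℝ) :
    HasDerivAt (logW b s t w)
      (((deriv b z : ℝ) : ℂ) / (((b z - w : ℝ) : ℂ) + Complex.I * ((s * t : ℝ) : ℂ))) z := by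
  have hx : HasDerivAt (fun z => b z - w) (deriv b z) z := (hb z).hasDerivAt.sub_const w
  have hpos : 0 < (b z - w) ^ 2 + t ^ 2 := by positivity
  have h1 : HasDerivAt (fun z => (1 / 2) * Real.log ((b z - w) ^ 2 + t ^ 2))
      ((1 / 2) * ((2 * (b z - w) ^ (2 - 1) * deriv b z) / ((b z - w) ^ 2 + t ^ 2))) z := by
    exact_mod_cast (((hx.pow 2).add_const (t ^ 2)).log hpos.ne').const_mul (1 / 2)
  have h2 : HasDerivAt (fun z => s * angle t (b z - w))
      (s * (1 / (1 + ((b z - w) / t) ^ 2) * (deriv b z / t))) z := by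
    have : (fun z => s * angle t (b z - w)) = fun z => s * Real.arctan ((b z - w) / t) := by
      funext z; rw [angle, if_neg ht.ne']
    rw [this]
    exact ((hx.div_const t).arctan).const_mul s
  have h := h1.ofReal_comp.sub (h2.ofReal_comp.const_mul Complex.I)
  refine h.congr_deriv ?_
  have hden : (((b z - w : ℝ) : ℂ) + Complex.I * ((s * t : ℝ) : ℂ)) ≠ 0 := by
    intro h0
    have := congrArg Complex.im h0
    simp at this
    rcases this with h | h
    · rw [h] at hs; norm_num at hs
    · exact ht.ne' h
  rw [eq_div_iff hden]
  have hposC : (((b z - w : ℝ) : ℂ)) ^ 2 + (t : ℂ) ^ 2 ≠ 0 := by exact_mod_cast hpos.ne'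
  have e2 : s * (1 / (1 + ((b z - w) / t) ^ 2) * (deriv b z / t)) =
      s * t * deriv b z / ((b z - w) ^ 2 + t ^ 2) := by
    field_simp
    ring
  rw [e2]
  set x := b z - w
  push_cast
  have hs' : (s : ℂ) ^ 2 = 1 := by exact_mod_cast hs
  field_simp
  ring_nf
  rw [Complex.I_sq, hs']
  ring

/-! ### Uniform square integrability and convergence of the logarithmic weights. -/

/-- The inverse square root of the distance. -/
def invSqrt (x : ℝ) : ℝ := |x| ^ (-(1 / 2) : ℝ)

theorem invSqrt_nonneg (x : ℝ) : 0 ≤ invSqrt x := Real.rpow_nonneg (abs_nonneg _) _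

theorem measurable_invSqrt : Measurable invSqrt := by
  unfold invSqrt; fun_prop

theorem integrable_invSqrt_indicator :
    Integrable (indicator (Icc (-1 : ℝ) 1) invSqrt) := by
  rw [integrable_indicator_iff measurableSet_Icc]
  have h1 : IntegrableOn invSqrt (Ioc 0 1) := by
    have := (intervalIntegrable_iff_integrableOn_Ioc_of_le (zero_le_one' ℝ)).1
      (intervalIntegral.intervalIntegrable_rpow' (a := 0) (b := 1) (r := -(1 / 2)) (by norm_num))
    refine this.congr_fun (fun x hx => ?_) measurableSet_Ioc
    rw [invSqrt, abs_of_pos hx.1]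
  have h1' : IntegrableOn invSqrt (Icc 0 1) := by
    rwa [integrableOn_Icc_iff_integrableOn_Ioc]
  have h2 : IntegrableOn invSqrt (Icc (-1) 0) := by
    have := h1'.comp_neg
    simp only [invSqrt, abs_neg, Set.neg_Icc, neg_zero] at this
    exact this
  rw [← Icc_union_Icc_eq_Icc (by norm_num : (-1 : ℝ) ≤ 0) zero_le_one]
  exact h2.union h1'

theorem invSqrt_le (x : ℝ) : invSqrt x ≤ indicator (Icc (-1 : ℝ) 1) invSqrt x + 1 := by
  by_cases h : x ∈ Icc (-1 : ℝ) 1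
  · rw [indicator_of_mem h]; linarith
  · rw [indicator_of_notMem h, zero_add, invSqrt]
    refine Real.rpow_le_one_of_one_le_of_nonpos ?_ (by norm_num)
    by_contra hcon
    exact h (abs_le.1 (not_le.1 hcon).le)

theorem integrableOn_invSqrt (y : ℝ) :
    IntegrableOn (fun z => invSqrt (z - y)) (Ioc (-2 : ℝ) 2) := by
  refine Integrable.mono' (g := fun z => indicator (Icc (-1 : ℝ) 1) invSqrt (z - y) + 1) ?_
    (measurable_invSqrt.comp (measurable_id.sub_const y)).aestronglyMeasurable
    (Filter.Eventually.of_forall fun z => ?_)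
  · exact (integrable_invSqrt_indicator.comp_sub_right y).integrableOn.add
      (integrable_const _)
  · rw [Real.norm_eq_abs, abs_of_nonneg (invSqrt_nonneg _)]
    exact invSqrt_le _

theorem exists_integral_invSqrt_le :
    ∃ J : ℝ, 0 ≤ J ∧ ∀ y, ∫ z in Ioc (-2 : ℝ) 2, invSqrt (z - y) ≤ J := by
  have hpos : ∀ x, 0 ≤ indicator (Icc (-1 : ℝ) 1) invSqrt x := fun x =>
    indicator_nonneg (fun x _ => invSqrt_nonneg x) x
  refine ⟨(∫ x, indicator (Icc (-1 : ℝ) 1) invSqrt x) + 4,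
    add_nonneg (integral_nonneg hpos) (by norm_num), fun y => ?_⟩
  have hi := integrable_invSqrt_indicator.comp_sub_right y
  calc ∫ z in Ioc (-2 : ℝ) 2, invSqrt (z - y)
      ≤ ∫ z in Ioc (-2 : ℝ) 2, (indicator (Icc (-1 : ℝ) 1) invSqrt (z - y) + 1) :=
        integral_mono (integrableOn_invSqrt y) (hi.integrableOn.add (integrable_const _))
          fun z => invSqrt_le _
    _ = (∫ z in Ioc (-2 : ℝ) 2, indicator (Icc (-1 : ℝ) 1) invSqrt (z - y)) + 4 := by
        rw [integral_add hi.integrableOn (integrable_const _)]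
        congr 1
        simp
        norm_num
    _ ≤ _ := by
        gcongr
        refine (setIntegral_le_integral hi (Filter.Eventually.of_forall fun z => hpos _)).trans ?_
        exact (integral_sub_right_eq_self (indicator (Icc (-1 : ℝ) 1) invSqrt) y).le

theorem invSqrt_le_of_le {x y : ℝ} (hx : x ≠ 0) (h : |x| ≤ y) : y ^ (-(1 / 2) : ℝ) ≤ invSqrt x :=
  Real.rpow_le_rpow_of_nonpos (abs_pos.2 hx) h (by norm_num)

theorem IsShearFlow.invSqrt_sub_le {b : ℝ → ℝ} (hb : IsShearFlow b) {c : ℝ} (hc : 0 < c)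
    (h : ∀ y, c < deriv b y) {y z : ℝ} (hyz : z ≠ y) :
    invSqrt (b z - b y) ≤ c ^ (-(1 / 2) : ℝ) * invSqrt (z - y) := by
  rw [invSqrt, invSqrt, ← Real.mul_rpow hc.le (abs_nonneg _)]
  exact Real.rpow_le_rpow_of_nonpos (mul_pos hc (abs_pos.2 (sub_ne_zero.2 hyz)))
    (hb.mul_abs_sub_le h y z) (by norm_num)

/-- For `y ≤ x` put `r = (x - y) / y`. Then `log (1 + r) = 4 log ((1 + r) ^ (1/4)) ≤ 4 r ^ (1/4)`,
and squaring leaves `√|x - y|` times the integrable singularity `y ^ (-1/2)`. The second singular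
term only restores symmetry. With `y = 1` the estimate controls the size of the logarithm; in
general it gives continuity in the parameters. -/
theorem sq_log_sub_log_le {x y : ℝ} (hx : 0 < x) (hy : 0 < y) :
    (Real.log x - Real.log y) ^ 2 ≤
      16 * √|x - y| * (x ^ (-(1 / 2) : ℝ) + y ^ (-(1 / 2) : ℝ)) := by
  wlog hxy : y ≤ x generalizing x y
  · have := this hy hx (not_le.1 hxy).le
    rw [abs_sub_comm, add_comm (x ^ _)]
    calc _ = (Real.log y - Real.log x) ^ 2 := by ring
      _ ≤ _ := this
  have h0 : 0 ≤ (x - y) / y := div_nonneg (by linarith) hy.le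
  have h1 : Real.log x - Real.log y ≤ 4 * ((x - y) / y) ^ (1 / 4 : ℝ) := by
    have e : Real.log x - Real.log y = 4 * Real.log ((1 + (x - y) / y) ^ (1 / 4 : ℝ)) := by
      rw [Real.log_rpow (by positivity), ← Real.log_div hx.ne' hy.ne']
      have : 1 + (x - y) / y = x / y := by field_simp; ring
      rw [this]; ring
    have h2 : (1 + (x - y) / y) ^ (1 / 4 : ℝ) ≤ 1 + ((x - y) / y) ^ (1 / 4 : ℝ) := by
      simpa using Real.rpow_add_le_add_rpow zero_le_one h0 (by norm_num : (0 : ℝ) ≤ 1 / 4)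
        (by norm_num)
    have h3 := Real.log_le_sub_one_of_pos
      (Real.rpow_pos_of_pos (by positivity : 0 < 1 + (x - y) / y) (1 / 4))
    rw [e]; linarith
  have h4 : 0 ≤ Real.log x - Real.log y := sub_nonneg.2 (Real.log_le_log hy hxy)
  have h5 : (((x - y) / y) ^ (1 / 4 : ℝ)) ^ 2 = √|x - y| * y ^ (-(1 / 2) : ℝ) := by
    rw [← Real.rpow_natCast, ← Real.rpow_mul h0, abs_of_nonneg (by linarith), Real.sqrt_eq_rpow,
      Real.div_rpow (by linarith) hy.le, Real.rpow_neg hy.le]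
    norm_num
    rfl
  calc (Real.log x - Real.log y) ^ 2 ≤ (4 * ((x - y) / y) ^ (1 / 4 : ℝ)) ^ 2 := by gcongr
    _ = 16 * √|x - y| * y ^ (-(1 / 2) : ℝ) := by rw [mul_pow, h5]; ring
    _ ≤ _ := by
      gcongr
      have : 0 ≤ x ^ (-(1 / 2) : ℝ) := by positivity
      linarith

theorem half_log_eq (x t : ℝ) : (1 / 2) * Real.log (x ^ 2 + t ^ 2) = Real.log √(x ^ 2 + t ^ 2) := by
  rw [Real.log_sqrt (by positivity)]; ring

theorem abs_le_sqrt_add (x t : ℝ) : |x| ≤ √(x ^ 2 + t ^ 2) :=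
  Real.abs_le_sqrt (by nlinarith [sq_nonneg t])

theorem abs_sqrt_sub_le (x x' t : ℝ) (ht : 0 ≤ t) : |√(x ^ 2 + t ^ 2) - (|x'|)| ≤ |x - x'| + t := by
  have h1 : √(x ^ 2 + t ^ 2) ≤ |x| + t := by
    rw [Real.sqrt_le_iff]
    refine ⟨by positivity, ?_⟩
    nlinarith [sq_abs x, abs_nonneg x]
  have h2 := abs_le_sqrt_add x t
  have h3 := abs_abs_sub_abs_le x x'
  rw [abs_le] at h3 ⊢
  constructor <;> linarith

theorem norm_logW_sq_le {b : ℝ → ℝ} {s t w z R : ℝ} (hs : s ^ 2 = 1)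
    (hR : √((b z - w) ^ 2 + t ^ 2) ≤ R) (hz : b z ≠ w) :
    ‖logW b s t w z‖ ^ 2 ≤ 2 * R ^ 2 + Real.pi ^ 2 + 32 * invSqrt (b z - w) := by
  set x := b z - w with hx
  have hx0 : x ≠ 0 := sub_ne_zero.2 hz
  set a := √(x ^ 2 + t ^ 2) with ha
  have hpi := Real.pi_pos
  have hxa : |x| ≤ a := abs_le_sqrt_add x t
  have ha0 : 0 < a := (abs_pos.2 hx0).trans_le hxa
  have h1 : ‖logW b s t w z‖ ^ 2 = Real.log a ^ 2 + (s * angle t x) ^ 2 := by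
    rw [logW, half_log_eq, ← Complex.normSq_eq_norm_sq, Complex.normSq_apply]
    simp [← hx, ← ha]
    ring
  have h2 : (s * angle t x) ^ 2 ≤ Real.pi ^ 2 := by
    rw [mul_pow, hs, one_mul]
    have := abs_angle_le t x
    exact sq_le_sq' (by linarith [(abs_le.1 this).1]) (by linarith [(abs_le.1 this).2])
  have h3 : Real.log a ^ 2 ≤ 2 * R ^ 2 + 32 * invSqrt x := by
    have hi := invSqrt_nonneg x
    -- For `a ≥ 1` the logarithm is at most `a ≤ R`; for `a < 1` it is compared with `log 1`, and
    -- only this case uses the singular term.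
    rcases le_or_gt 1 a with h | h
    · have h4 : Real.log a ≤ R := (Real.log_le_sub_one_of_pos ha0).trans (by linarith)
      have h5 := Real.log_nonneg h
      nlinarith
    · have h6 := sq_log_sub_log_le ha0 one_pos
      rw [Real.log_one, sub_zero, Real.one_rpow] at h6
      have h7 : √|a - 1| ≤ 1 := by
        rw [Real.sqrt_le_one]
        rw [abs_le]; constructor <;> linarith
      have h8 : a ^ (-(1 / 2) : ℝ) ≤ invSqrt x := invSqrt_le_of_le hx0 hxa
      have h9 : 1 ≤ a ^ (-(1 / 2) : ℝ) :=
        Real.one_le_rpow_of_pos_of_le_one_of_nonpos ha0 h.le (by norm_num)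
      calc Real.log a ^ 2 ≤ 16 * 1 * (a ^ (-(1 / 2) : ℝ) + 1) := h6.trans (by gcongr)
        _ ≤ 2 * R ^ 2 + 32 * invSqrt x := by nlinarith [sq_nonneg R]
  rw [h1]; linarith

theorem ae_ne (y : ℝ) : ∀ᵐ z : ℝ, z ≠ y := by simp [ae_iff]

theorem exists_bound_Icc {f : ℝ → ℝ} (hf : Continuous f) (a b : ℝ) :
    ∃ M, 0 ≤ M ∧ ∀ z ∈ Icc a b, |f z| ≤ M := by
  obtain ⟨M, hM⟩ := isCompact_Icc.exists_bound_of_continuousOn (s := Icc a b) hf.continuousOn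
  exact ⟨|M|, abs_nonneg _, fun z hz => (hM z hz).trans (le_abs_self M)⟩

/-- The logarithmic weights are uniformly square integrable. -/
theorem exists_logW_bound {b : ℝ → ℝ} (hb : IsShearFlow b) (W : ℝ) :
    ∃ K : ℝ, 0 ≤ K ∧ ∀ s t w : ℝ, s ^ 2 = 1 → 0 ≤ t → t ≤ 1 → |w| ≤ W →
      MemLp (logW b s t w) 2 (volume.restrict (Ioc (-2 : ℝ) 2)) ∧
        ∫ z in Ioc (-2 : ℝ) 2, ‖logW b s t w z‖ ^ 2 ≤ K := by
  obtain ⟨c, hc, hbc⟩ := hb.deriv_gt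
  obtain ⟨M, hM0, hM⟩ := exists_bound_Icc hb.continuous (-2) 2
  obtain ⟨J, hJ0, hJ⟩ := exists_integral_invSqrt_le
  set R := M + W + 1
  set D := 2 * R ^ 2 + Real.pi ^ 2
  set E := 32 * c ^ (-(1 / 2) : ℝ)
  have hE : 0 ≤ E := by positivity
  refine ⟨D * 4 + E * J, by positivity, fun s t w hs ht0 ht1 hw => ?_⟩
  -- Every `w` has a critical point on the extended line. Since `|b z - b y| ≥ c |z - y|`, the
  -- singularity is a translate of a fixed integrable one, which makes the bound uniform in `w`.
  obtain ⟨y, rfl⟩ := hb.surjective w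
  have hi : IntegrableOn (fun z => D + E * invSqrt (z - y)) (Ioc (-2 : ℝ) 2) :=
    (integrable_const _).add ((integrableOn_invSqrt y).const_mul _)
  have hle : ∀ᵐ z ∂(volume.restrict (Ioc (-2 : ℝ) 2)),
      ‖logW b s t (b y) z‖ ^ 2 ≤ D + E * invSqrt (z - y) := by
    filter_upwards [ae_restrict_mem measurableSet_Ioc, ae_restrict_of_ae (ae_ne y)] with z hz hzy
    have hne : b z ≠ b y := hb.strictMono.injective.ne hzy
    have hR : √((b z - b y) ^ 2 + t ^ 2) ≤ R := by
      have h1 := abs_sqrt_sub_le (b z - b y) 0 t ht0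
      rw [abs_zero, sub_zero, sub_zero] at h1
      have h2 := hM z (Ioc_subset_Icc_self hz)
      have h3 : |b z - b y| ≤ |b z| + |b y| := abs_sub _ _
      have h4 := le_abs_self √((b z - b y) ^ 2 + t ^ 2)
      simp only [R]; linarith
    refine (norm_logW_sq_le hs hR hne).trans ?_
    have := hb.invSqrt_sub_le hc hbc hzy
    simp only [E, D]
    linarith
  have hm := (measurable_logW hb.continuous s t (b y)).aestronglyMeasurable
    (μ := volume.restrict (Ioc (-2 : ℝ) 2))
  have hsq : IntegrableOn (fun z => ‖logW b s t (b y) z‖ ^ 2) (Ioc (-2 : ℝ) 2) := by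
    refine hi.mono' (hm.norm.pow 2) ?_
    filter_upwards [hle] with z hz
    rwa [Real.norm_eq_abs, abs_of_nonneg (sq_nonneg _)]
  refine ⟨(memLp_two_iff_integrable_sq_norm hm).2 hsq, ?_⟩
  calc ∫ z in Ioc (-2 : ℝ) 2, ‖logW b s t (b y) z‖ ^ 2
      ≤ ∫ z in Ioc (-2 : ℝ) 2, (D + E * invSqrt (z - y)) := integral_mono_ae hsq hi hle
    _ = D * 4 + E * ∫ z in Ioc (-2 : ℝ) 2, invSqrt (z - y) := by
        rw [integral_add (integrable_const _) ((integrableOn_invSqrt y).const_mul _),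
          integral_const_mul]
        congr 1
        simp
        ring
    _ ≤ _ := by gcongr; exact hJ y

theorem memLp_logW {b : ℝ → ℝ} (hb : IsShearFlow b) {s t : ℝ} (w : ℝ) (hs : s ^ 2 = 1)
    (ht : 0 ≤ t) (ht1 : t ≤ 1) : MemLp (logW b s t w) 2 (volume.restrict (Ioc (-2 : ℝ) 2)) := by
  obtain ⟨K, -, h⟩ := exists_logW_bound hb |w|
  exact (h s t w hs ht ht1 le_rfl).1

theorem tendsto_angle {x : ℝ} (hx : x ≠ 0) {xn tn : ℕ → ℝ}
    (hxn : Filter.Tendsto xn Filter.atTop (nhds x)) (htn : Filter.Tendsto tn Filter.atTop (nhds 0))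
    (ht : ∀ n, 0 < tn n) :
    Filter.Tendsto (fun n => angle (tn n) (xn n)) Filter.atTop (nhds (angle 0 x)) := by
  have hinv : Filter.Tendsto (fun n => (tn n)⁻¹) Filter.atTop Filter.atTop :=
    (tendsto_nhdsWithin_iff.2 ⟨htn, Filter.Eventually.of_forall ht⟩).inv_tendsto_nhdsGT_zero
  have e : ∀ n, angle (tn n) (xn n) = Real.arctan (xn n * (tn n)⁻¹) := fun n => by
    rw [angle, if_neg (ht n).ne', div_eq_mul_inv]
  simp only [e]
  rw [angle, if_pos rfl]
  rcases lt_or_gt_of_ne hx with h | h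
  · rw [Real.sign_of_neg h, mul_neg, mul_one]
    exact (Real.tendsto_arctan_atBot.mono_right nhdsWithin_le_nhds).comp
      (hxn.neg_mul_atTop h hinv)
  · rw [Real.sign_of_pos h, mul_one]
    exact (Real.tendsto_arctan_atTop.mono_right nhdsWithin_le_nhds).comp
      (hxn.pos_mul_atTop h hinv)

/-- The real parts converge at the rate `√d` by `sq_log_sub_log_le`, even though the singular point
moves with `wn`. The imaginary parts are bounded and converge away from the critical point, so
dominated convergence applies. -/
theorem tendsto_logW {b : ℝ → ℝ} (hb : IsShearFlow b) {s w : ℝ} (hs : s ^ 2 = 1)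
    {wn tn : ℕ → ℝ} (hwn : Filter.Tendsto wn Filter.atTop (nhds w))
    (htn : Filter.Tendsto tn Filter.atTop (nhds 0)) (ht : ∀ n, 0 < tn n) :
    Filter.Tendsto (fun n => ∫ z in Ioc (-2 : ℝ) 2, ‖logW b s (tn n) (wn n) z - logW b s 0 w z‖ ^ 2)
      Filter.atTop (nhds 0) := by
  obtain ⟨c, hc, hbc⟩ := hb.deriv_gt
  obtain ⟨J, hJ0, hJ⟩ := exists_integral_invSqrt_le
  obtain ⟨y, rfl⟩ := hb.surjective w
  choose yn hyn using fun n => hb.surjective (wn n)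
  set d : ℕ → ℝ := fun n => |wn n - b y| + tn n with hd
  have hd0 : Filter.Tendsto d Filter.atTop (nhds 0) := by
    have h1 : Filter.Tendsto (fun n => |wn n - b y|) Filter.atTop (nhds 0) := by
      have := (hwn.sub_const (b y)).abs
      simpa using this
    simpa using h1.add htn
  set E := 16 * c ^ (-(1 / 2) : ℝ) with hE
  have hE0 : 0 ≤ E := by positivity
  have hpi := Real.pi_pos
  set ang : ℕ → ℝ → ℝ := fun n z => (angle (tn n) (b z - wn n) - angle 0 (b z - b y)) ^ 2
  have hangm : ∀ n, Measurable (ang n) := fun n =>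
    (((measurable_angle _).comp (hb.continuous.measurable.sub_const _)).sub
      ((measurable_angle _).comp (hb.continuous.measurable.sub_const _))).pow_const 2
  have hangb : ∀ n z, ‖ang n z‖ ≤ Real.pi ^ 2 := fun n z => by
    have h1 := abs_angle_le (tn n) (b z - wn n)
    have h2 := abs_angle_le 0 (b z - b y)
    rw [Real.norm_eq_abs, abs_of_nonneg (sq_nonneg _)]
    rw [abs_le] at h1 h2
    exact sq_le_sq' (by linarith) (by linarith)
  have hangi : ∀ n, IntegrableOn (ang n) (Ioc (-2 : ℝ) 2) := fun n =>
    (integrable_const (Real.pi ^ 2)).mono' (hangm n).aestronglyMeasurable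
      (Filter.Eventually.of_forall (hangb n))
  have hang : Filter.Tendsto (fun n => ∫ z in Ioc (-2 : ℝ) 2, ang n z) Filter.atTop (nhds 0) := by
    have := tendsto_integral_of_dominated_convergence (μ := volume.restrict (Ioc (-2 : ℝ) 2))
      (F := ang) (f := fun _ => 0) (fun _ => Real.pi ^ 2)
      (fun n => (hangm n).aestronglyMeasurable) (integrable_const _)
      (fun n => Filter.Eventually.of_forall (hangb n)) ?_
    · simpa using this
    · filter_upwards [ae_restrict_of_ae (ae_ne y)] with z hz
      have hne : b z - b y ≠ 0 := sub_ne_zero.2 (hb.strictMono.injective.ne hz)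
      have := ((tendsto_angle hne (hwn.const_sub (b z)) htn ht).sub_const
        (angle 0 (b z - b y))).pow 2
      simpa using this
  have hle : ∀ n, ∀ᵐ z ∂(volume.restrict (Ioc (-2 : ℝ) 2)),
      ‖logW b s (tn n) (wn n) z - logW b s 0 (b y) z‖ ^ 2 ≤
        √(d n) * (E * invSqrt (z - yn n) + E * invSqrt (z - y)) + ang n z := fun n => by
    filter_upwards [ae_restrict_of_ae (ae_ne y), ae_restrict_of_ae (ae_ne (yn n))] with z hz hzn
    have hx : b z - b y ≠ 0 := sub_ne_zero.2 (hb.strictMono.injective.ne hz)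
    have hxn : b z - wn n ≠ 0 := by
      rw [← hyn n]; exact sub_ne_zero.2 (hb.strictMono.injective.ne hzn)
    have e : ‖logW b s (tn n) (wn n) z - logW b s 0 (b y) z‖ ^ 2 =
        (Real.log √((b z - wn n) ^ 2 + tn n ^ 2) - Real.log |b z - b y|) ^ 2 + ang n z := by
      rw [logW, logW, half_log_eq, half_log_eq, ← Complex.normSq_eq_norm_sq, Complex.normSq_apply]
      simp only [ang]
      have : √((b z - b y) ^ 2 + 0 ^ 2) = |b z - b y| := by
        rw [zero_pow two_ne_zero, add_zero, Real.sqrt_sq_eq_abs]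
      rw [this]
      simp
      linear_combination (angle (tn n) (b z - wn n) - angle 0 (b z - b y)) ^ 2 * hs
    rw [e]
    gcongr
    have ha : |b z - wn n| ≤ √((b z - wn n) ^ 2 + tn n ^ 2) := abs_le_sqrt_add _ _
    have h1 := sq_log_sub_log_le ((abs_pos.2 hxn).trans_le ha) (abs_pos.2 hx)
    have h2 : |√((b z - wn n) ^ 2 + tn n ^ 2) - (|b z - b y|)| ≤ d n := by
      refine (abs_sqrt_sub_le _ (b z - b y) _ (ht n).le).trans (le_of_eq ?_)
      rw [hd]
      simp only
      rw [abs_sub_comm (wn n)]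
      congr 2; ring
    have h3 := invSqrt_le_of_le hxn ha
    have h4 := hb.invSqrt_sub_le hc hbc hzn
    rw [hyn n] at h4
    have h5 := hb.invSqrt_sub_le hc hbc hz
    have h6 : |b z - b y| ^ (-(1 / 2) : ℝ) = invSqrt (b z - b y) := rfl
    calc _ ≤ _ := h1
      _ ≤ 16 * √(d n) * (c ^ (-(1 / 2) : ℝ) * invSqrt (z - yn n) +
          c ^ (-(1 / 2) : ℝ) * invSqrt (z - y)) := by
        rw [h6]
        gcongr
        · exact add_nonneg (by positivity) (invSqrt_nonneg _)
        · exact h3.trans h4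
      _ = _ := by rw [hE]; ring
  have hint : ∀ n, ∫ z in Ioc (-2 : ℝ) 2, ‖logW b s (tn n) (wn n) z - logW b s 0 (b y) z‖ ^ 2 ≤
      √(d n) * (E * J + E * J) + ∫ z in Ioc (-2 : ℝ) 2, ang n z := fun n => by
    have i1 := (integrableOn_invSqrt (yn n)).const_mul E
    have i2 := (integrableOn_invSqrt y).const_mul E
    have i3 : IntegrableOn (fun z => √(d n) * (E * invSqrt (z - yn n) + E * invSqrt (z - y)))
      (Ioc (-2 : ℝ) 2) := (i1.add i2).const_mul _
    refine (integral_mono_of_nonneg (Filter.Eventually.of_forall fun z => sq_nonneg _)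
      (i3.add (hangi n)) (hle n)).trans ?_
    rw [Pi.add_def, integral_add i3 (hangi n), integral_const_mul, integral_add i1 i2,
      integral_const_mul, integral_const_mul]
    gcongr
    · exact hJ _
    · exact hJ _
  refine squeeze_zero (fun n => integral_nonneg fun z => sq_nonneg _) hint ?_
  have hsd : Filter.Tendsto (fun n => √(d n)) Filter.atTop (nhds 0) := by
    have := (Real.continuous_sqrt.tendsto 0).comp hd0
    simpa [Function.comp_def] using this
  simpa using (hsd.mul_const (E * J + E * J)).add hang

/-! ### The coefficient of the form -/

/-- The coefficient `b'' / b'`. -/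
def flowCoeff (b : ℝ → ℝ) (z : ℝ) : ℝ := deriv (deriv b) z / deriv b z

theorem IsShearFlow.exists_isCoeff {b : ℝ → ℝ} (hb : IsShearFlow b) :
    ∃ C, IsCoeff (flowCoeff b) C := by
  have hs : ContDiff ℝ ∞ (flowCoeff b) :=
    hb.contDiff_deriv2.div hb.contDiff_deriv fun y => (hb.deriv_pos y).ne'
  obtain ⟨M, hM0, hM⟩ := exists_bound_Icc hs.continuous (-2) 2
  obtain ⟨N, hN0, hN⟩ := exists_bound_Icc (hs.continuous_deriv (by simp)) (-2) 2
  exact ⟨max M N, hs, le_max_of_le_left hM0, fun z hz => (hM z hz).trans (le_max_left _ _),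
    fun z hz => (hN z hz).trans (le_max_right _ _)⟩

theorem denom_ne_zero {s t : ℝ} (hs : s ^ 2 = 1) (ht : 0 < t) (x : ℝ) :
    (x : ℂ) + Complex.I * ((s * t : ℝ) : ℂ) ≠ 0 := by
  intro h0
  have := congrArg Complex.im h0
  simp at this
  rcases this with h | h
  · rw [h] at hs; norm_num at hs
  · exact ht.ne' h

theorem abs_le_norm_denom (x y : ℝ) : |x| ≤ ‖(x : ℂ) + Complex.I * (y : ℂ)‖ := by
  have := Complex.abs_re_le_norm ((x : ℂ) + Complex.I * (y : ℂ))
  simpa using this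

/-- The coefficient `b'' / b'` is chosen so that the `b'` in the derivative of the weight cancels,
leaving the regularized kernel `b'' / (b - w + i s t)`. -/
theorem form_logW {k : ℝ} (hk : 0 < k) {b : ℝ → ℝ} (hb : IsShearFlow b) {s t : ℝ}
    (hs : s ^ 2 = 1) (ht : 0 < t) (w : ℝ) (u v : H1 k) :
    form (flowCoeff b) (logW b s t w) u v =
      ∫ z in Ioc (-2 : ℝ) 2, ((deriv (deriv b) z : ℝ) : ℂ) * (u.fn z * conj (v.fn z)) /
        (((b z - w : ℝ) : ℂ) + Complex.I * ((s * t : ℝ) : ℂ)) := by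
  obtain ⟨C, hC⟩ := hb.exists_isCoeff
  have hcont : Continuous fun z => ((deriv b z : ℝ) : ℂ) /
      (((b z - w : ℝ) : ℂ) + Complex.I * ((s * t : ℝ) : ℂ)) := by
    refine Continuous.div ?_ ?_ fun z => denom_ne_zero hs ht _
    · exact Complex.continuous_ofReal.comp hb.contDiff_deriv.continuous
    · have := hb.continuous
      fun_prop
  rw [form_eq_integral hk hC (by rw [flowCoeff, hb.deriv2_two.1, zero_div])
    (by rw [flowCoeff, hb.deriv2_two.2, zero_div])
    (fun z => hasDerivAt_logW hb.differentiable hs ht w z) hcont]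
  congr 1
  ext z
  have h1 : ((deriv b z : ℝ) : ℂ) ≠ 0 := by exact_mod_cast (hb.deriv_pos z).ne'
  have h2 := denom_ne_zero hs ht (b z - w)
  rw [flowCoeff, Complex.ofReal_div]
  field_simp

/-- Smallness of the operator for large `w`. -/
theorem exists_norm_opA_le_of_large {b : ℝ → ℝ} (hb : IsShearFlow b) {η : ℝ} (hη : 0 < η) :
    ∃ W : ℝ, 0 ≤ W ∧ ∀ k s t w : ℝ, 1 ≤ k → s ^ 2 = 1 → 0 < t → t ≤ 1 → W ≤ |w| →
      ‖opA k (flowCoeff b) (logW b s t w)‖ ≤ η := by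
  obtain ⟨M, hM0, hM⟩ := exists_bound_Icc hb.continuous (-2) 2
  obtain ⟨N, hN0, hN⟩ := exists_bound_Icc hb.contDiff_deriv2.continuous (-2) 2
  obtain ⟨C, hC⟩ := hb.exists_isCoeff
  -- With `|b| ≤ M` and `|b''| ≤ N` on `[-2, 2]`, this threshold forces `|b z - w| ≥ (N + 1) / η`,
  -- so the kernel is at most `η`. The `+ 1` keeps the denominator positive when `N = 0`.
  refine ⟨M + (N + 1) / η, by positivity, fun k s t w hk hs ht ht1 hw => ?_⟩
  have hk0 : 0 < k := by linarith
  refine opNorm_le_of_inner hη.le fun u v => ?_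
  rw [inner_opA hk hC (memLp_logW hb w hs ht.le ht1), form_logW hk0 hb hs ht]
  have hu := (u.memLp_fn hk0)
  have hv := (v.memLp_fn hk0)
  have i1 := integrable_norm_mul_norm hu hv
  have hsu : √(∫ x, ‖u.fn x‖ ^ 2) ≤ ‖u‖ :=
    (le_mul_of_one_le_left (Real.sqrt_nonneg _) hk).trans (u.sqrt_fn_le hk0)
  have hsv : √(∫ x, ‖v.fn x‖ ^ 2) ≤ ‖v‖ :=
    (le_mul_of_one_le_left (Real.sqrt_nonneg _) hk).trans (v.sqrt_fn_le hk0)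
  calc _ ≤ ∫ z in Ioc (-2 : ℝ) 2, η * (‖u.fn z‖ * ‖v.fn z‖) := by
        refine norm_integral_le_of_norm_le (i1.restrict.const_mul η) ?_
        filter_upwards [ae_restrict_mem measurableSet_Ioc] with z hz
        have h1 := hN z (Ioc_subset_Icc_self hz)
        have h2 := hM z (Ioc_subset_Icc_self hz)
        have h3 : (N + 1) / η ≤ ‖((b z - w : ℝ) : ℂ) + Complex.I * ((s * t : ℝ) : ℂ)‖ := by
          refine le_trans ?_ (abs_le_norm_denom _ _)
          have := abs_sub_abs_le_abs_sub w (b z)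
          rw [abs_sub_comm] at this
          linarith
        have h4 : 0 < (N + 1) / η := by positivity
        rw [norm_div, div_le_iff₀ (h4.trans_le h3), norm_mul, norm_mul, Complex.norm_real,
          RCLike.norm_conj, Real.norm_eq_abs]
        calc _ ≤ N * (‖u.fn z‖ * ‖v.fn z‖) := by gcongr
          _ ≤ η * ((N + 1) / η) * (‖u.fn z‖ * ‖v.fn z‖) := by
            gcongr
            rw [mul_div_cancel₀ _ hη.ne']; linarith
          _ = η * (‖u.fn z‖ * ‖v.fn z‖) * ((N + 1) / η) := by ring
          _ ≤ _ := by gcongr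
    _ = η * ∫ z in Ioc (-2 : ℝ) 2, ‖u.fn z‖ * ‖v.fn z‖ := by rw [integral_const_mul]
    _ ≤ η * ∫ z, ‖u.fn z‖ * ‖v.fn z‖ := by
        refine mul_le_mul_of_nonneg_left ?_ hη.le
        exact setIntegral_le_integral i1 (Filter.Eventually.of_forall fun z => by positivity)
    _ ≤ η * (‖u‖ * ‖v‖) := by
        gcongr
        exact (integral_norm_mul_norm_le hu hv).trans (by gcongr)
    _ = _ := by ring

/-! ### Multiplication operators and cutoffs -/

theorem l2_add_le {f g : ℝ → ℂ} (hf : MemLp f 2 volume) (hg : MemLp g 2 volume) :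
    √(∫ x, ‖f x + g x‖ ^ 2) ≤ √(∫ x, ‖f x‖ ^ 2) + √(∫ x, ‖g x‖ ^ 2) := by
  have h1 := eLpNorm_two_toReal (hf.add hg)
  simp only [Pi.add_apply] at h1
  rw [← h1, ← eLpNorm_two_toReal hf, ← eLpNorm_two_toReal hg,
    ← ENNReal.toReal_add hf.2.ne hg.2.ne]
  exact ENNReal.toReal_mono (ENNReal.add_ne_top.2 ⟨hf.2.ne, hg.2.ne⟩)
    (eLpNorm_add_le hf.1 hg.1 (by norm_num))

theorem l2_le_of_norm_le {f g : ℝ → ℂ} {C : ℝ} (hC : 0 ≤ C) (hg : MemLp g 2 volume)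
    (h : ∀ x, ‖f x‖ ≤ C * ‖g x‖) : √(∫ x, ‖f x‖ ^ 2) ≤ C * √(∫ x, ‖g x‖ ^ 2) := by
  rw [← Real.sqrt_sq hC, ← Real.sqrt_mul (sq_nonneg C), ← integral_const_mul]
  refine Real.sqrt_le_sqrt (integral_mono_of_nonneg (Filter.Eventually.of_forall fun x => sq_nonneg _)
    ((memLp_two_norm hg).const_mul _) (Filter.Eventually.of_forall fun x => ?_))
  calc ‖f x‖ ^ 2 ≤ (C * ‖g x‖) ^ 2 := by gcongr; exact h x
    _ = C ^ 2 * ‖g x‖ ^ 2 := by ring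

namespace H1

variable {k : ℝ}

theorem norm_mk_le (hk : 0 < k) {f g : ℝ → ℂ} (hf : MemLp f 2 volume) (hg : MemLp g 2 volume)
    (h : IsPrim f g) :
    ‖mk k hf hg h‖ ≤ k * √(∫ x, ‖f x‖ ^ 2) + √(∫ x, ‖g x‖ ^ 2) := by
  refine (norm_le hk _).trans (le_of_eq ?_)
  rw [fn_mk hk, integral_congr_ae (f := fun x => ‖(mk k hf hg h).der x‖ ^ 2)
    (g := fun x => ‖g x‖ ^ 2)]
  filter_upwards [der_mk_ae (k := k) hf hg h] with x hx
  rw [hx]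

/-- Multiplication by a smooth function with bounded derivative. -/
theorem exists_mul (hk : 0 < k) {ψ : ℝ → ℝ} (hψ : ContDiff ℝ ∞ ψ) {C : ℝ} (hC : 0 ≤ C)
    (h1 : ∀ y, |ψ y| ≤ 1) (h2 : ∀ y, |deriv ψ y| ≤ C * k) :
    ∃ X : H1 k →L[ℂ] H1 k, ‖X‖ ≤ 2 + C ∧ (∀ u y, (X u).fn y = ψ y * u.fn y) := by
  have hc := hψ.continuous
  have hc' := hψ.continuous_deriv (n := ∞) (by simp)
  have m1 : ∀ u : H1 k, MemLp (fun y => (ψ y : ℂ) * u.fn y) 2 volume := fun u =>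
    (u.memLp_fn hk).of_le_mul (c := 1) ((by fun_prop : Continuous fun y =>
      (ψ y : ℂ)).aestronglyMeasurable.mul (u.memLp_fn hk).1) (Filter.Eventually.of_forall fun y => by
        rw [norm_mul, Complex.norm_real, Real.norm_eq_abs]
        gcongr; exact h1 y)
  have m2 : ∀ u : H1 k, MemLp (fun y => ((deriv ψ y : ℝ) : ℂ) * u.fn y) 2 volume := fun u =>
    (u.memLp_fn hk).of_le_mul (c := C * k) ((by fun_prop : Continuous fun y =>
      ((deriv ψ y : ℝ) : ℂ)).aestronglyMeasurable.mul (u.memLp_fn hk).1)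
      (Filter.Eventually.of_forall fun y => by
        rw [norm_mul, Complex.norm_real, Real.norm_eq_abs]
        gcongr; exact h2 y)
  have m3 : ∀ u : H1 k, MemLp (fun y => (ψ y : ℂ) * u.der y) 2 volume := fun u =>
    u.memLp_der.of_le_mul (c := 1) ((by fun_prop : Continuous fun y =>
      (ψ y : ℂ)).aestronglyMeasurable.mul u.memLp_der.1) (Filter.Eventually.of_forall fun y => by
        rw [norm_mul, Complex.norm_real, Real.norm_eq_abs]
        gcongr; exact h1 y)
  let F : H1 k → H1 k := fun u => mk k (m1 u) ((m2 u).add (m3 u))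
    ((isPrim_ofReal hψ).mul (u.isPrim hk))
  have hF : ∀ u y, (F u).fn y = ψ y * u.fn y := fun u y => by
    simp only [F]; rw [fn_mk hk]
  have hb : ∀ u, ‖F u‖ ≤ (2 + C) * ‖u‖ := fun u => by
    refine (norm_mk_le hk _ _ _).trans ?_
    have e1 : √(∫ x, ‖(ψ x : ℂ) * u.fn x‖ ^ 2) ≤ 1 * √(∫ x, ‖u.fn x‖ ^ 2) :=
      l2_le_of_norm_le zero_le_one (u.memLp_fn hk) fun y => by
        rw [norm_mul, Complex.norm_real, Real.norm_eq_abs]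
        gcongr; exact h1 y
    have e2 : √(∫ x, ‖((deriv ψ x : ℝ) : ℂ) * u.fn x‖ ^ 2) ≤ (C * k) * √(∫ x, ‖u.fn x‖ ^ 2) :=
      l2_le_of_norm_le (by positivity) (u.memLp_fn hk) fun y => by
        rw [norm_mul, Complex.norm_real, Real.norm_eq_abs]
        gcongr; exact h2 y
    have e3 : √(∫ x, ‖(ψ x : ℂ) * u.der x‖ ^ 2) ≤ 1 * √(∫ x, ‖u.der x‖ ^ 2) :=
      l2_le_of_norm_le zero_le_one u.memLp_der fun y => by
        rw [norm_mul, Complex.norm_real, Real.norm_eq_abs]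
        gcongr; exact h1 y
    have e4 := l2_add_le (m2 u) (m3 u)
    have e5 := u.sqrt_fn_le hk
    have e6 := u.sqrt_der_le hk
    simp only [Pi.add_apply]
    calc _ ≤ k * (1 * √(∫ x, ‖u.fn x‖ ^ 2)) + ((C * k) * √(∫ x, ‖u.fn x‖ ^ 2) +
          1 * √(∫ x, ‖u.der x‖ ^ 2)) := by
          gcongr
          exact e4.trans (by gcongr)
      _ = (1 + C) * (k * √(∫ x, ‖u.fn x‖ ^ 2)) + √(∫ x, ‖u.der x‖ ^ 2) := by ring
      _ ≤ (1 + C) * ‖u‖ + ‖u‖ := by gcongr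
      _ = _ := by ring
  let L : H1 k →ₗ[ℂ] H1 k :=
    { toFun := F
      map_add' := fun u v => ext_fn hk (funext fun y => by
        rw [hF, fn_add, fn_add, hF, hF]; ring)
      map_smul' := fun c u => ext_fn hk (funext fun y => by
        rw [hF, RingHom.id_apply, fn_smul, fn_smul, hF]; ring) }
  exact ⟨L.mkContinuous (2 + C) hb, L.mkContinuous_norm_le (by positivity) hb, hF⟩

/-- The functions are compared pointwise with the exponential kernel, whose norm is already known,
so no exponential integral is computed. The growth `√(2 * k)` is later compensated by the norm of a
point evaluation. -/
theorem exists_of_le_exp (hk : 0 < k) {f g : ℝ → ℝ} (p : ℝ) {D D' : ℝ} (hD : 0 ≤ D) (hD' : 0 ≤ D')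
    (hfm : Measurable f) (hgm : Measurable g)
    (h : IsPrim (fun y => (f y : ℂ)) (fun y => (g y : ℂ)))
    (hf : ∀ y, |f y| ≤ D * Real.exp (-k * |y - p|))
    (hg : ∀ y, |g y| ≤ D' * k * Real.exp (-k * |y - p|)) :
    ∃ e : H1 k, ‖e‖ ≤ (D + D') * √(2 * k) ∧ ∀ y, e.fn y = f y := by
  refine ⟨mk k (memLp_of_norm_le_exp hk p D hfm hf) (memLp_of_norm_le_exp hk p (D' * k) hgm hg) h,
    ?_, fun y => by rw [fn_mk hk]⟩
  refine (norm_mk_le hk _ _ _).trans ?_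
  have hm := memLp_expKer hk p
  have hker : k * √(∫ x, ‖(expKer k p x : ℂ)‖ ^ 2) ≤ 1 / √(2 * k) := by
    have h1 := (ker k p).sqrt_fn_le hk
    have h2 : ‖ker k p‖ = 1 / √(2 * k) := by
      rw [← Real.sqrt_sq (norm_nonneg (ker k p)), norm_ker_sq hk, Real.sqrt_div zero_le_one,
        Real.sqrt_one]
    rw [h2] at h1
    simpa only [fn_ker hk] using h1
  have hexp : ∀ y, Real.exp (-k * |y - p|) = 2 * k * ‖(expKer k p y : ℂ)‖ := fun y => by
    have h0 : 0 ≤ expKer k p y := by unfold expKer; positivity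
    rw [Complex.norm_real, Real.norm_of_nonneg h0, expKer]
    field_simp
  have e1 : √(∫ x, ‖(f x : ℂ)‖ ^ 2) ≤ D * (2 * k) * √(∫ x, ‖(expKer k p x : ℂ)‖ ^ 2) :=
    l2_le_of_norm_le (by positivity) hm fun y => by
      rw [Complex.norm_real, Real.norm_eq_abs, mul_assoc, ← hexp]; exact hf y
  have e2 : √(∫ x, ‖(g x : ℂ)‖ ^ 2) ≤ D' * k * (2 * k) * √(∫ x, ‖(expKer k p x : ℂ)‖ ^ 2) :=
    l2_le_of_norm_le (by positivity) hm fun y => by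
      rw [Complex.norm_real, Real.norm_eq_abs, mul_assoc, ← hexp]; exact hg y
  have hs : 2 * k * (1 / √(2 * k)) = √(2 * k) := by
    have := Real.mul_self_sqrt (by positivity : 0 ≤ 2 * k)
    have h0 : √(2 * k) ≠ 0 := by positivity
    field_simp
    rw [sq, this]
  calc _ ≤ k * (D * (2 * k) * √(∫ x, ‖(expKer k p x : ℂ)‖ ^ 2)) +
        D' * k * (2 * k) * √(∫ x, ‖(expKer k p x : ℂ)‖ ^ 2) := by gcongr
    _ = (D + D') * (2 * k * (k * √(∫ x, ‖(expKer k p x : ℂ)‖ ^ 2))) := by ring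
    _ ≤ (D + D') * (2 * k * (1 / √(2 * k))) := by gcongr
    _ = _ := by rw [hs]

end H1

/-! ### The homogeneous solutions and the operator subtracting boundary values. -/

/-- The solution of `σ'' = k² σ` with `σ(0) = 1` and `σ(1) = 0`. -/
def sigma₀ (k y : ℝ) : ℝ := Real.sinh (k * (1 - y)) / Real.sinh k

/-- The solution of `σ'' = k² σ` with `σ(0) = 0` and `σ(1) = 1`. -/
def sigma₁ (k y : ℝ) : ℝ := Real.sinh (k * y) / Real.sinh k

theorem hasDerivAt_sigma₀ (k y : ℝ) :
    HasDerivAt (sigma₀ k) (-k * Real.cosh (k * (1 - y)) / Real.sinh k) y := by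
  have h : HasDerivAt (fun y => k * (1 - y)) (k * (-1)) y :=
    ((hasDerivAt_id y).const_sub 1).const_mul k
  exact (h.sinh.div_const _).congr_deriv (by ring)

theorem hasDerivAt_sigma₁ (k y : ℝ) :
    HasDerivAt (sigma₁ k) (k * Real.cosh (k * y) / Real.sinh k) y := by
  have h : HasDerivAt (fun y => k * y) (k * 1) y := (hasDerivAt_id y).const_mul k
  exact (h.sinh.div_const _).congr_deriv (by ring)

theorem exp_div_sinh_le {k : ℝ} (hk : 1 ≤ k) : Real.exp k ≤ 3 * Real.sinh k := by
  have h1 : (3 : ℝ) ≤ Real.exp (2 * k) := by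
    have := Real.add_one_le_exp (2 * k); linarith
  have h2 : Real.exp (2 * k) = Real.exp k * Real.exp k := by rw [← Real.exp_add]; ring_nf
  have h3 : Real.exp (-k) * Real.exp k = 1 := by rw [← Real.exp_add]; simp
  have h4 := Real.exp_pos k
  have h5 := Real.exp_pos (-k)
  rw [Real.sinh_eq]
  have : 3 * Real.exp (-k) ≤ Real.exp k := by nlinarith
  linarith

theorem cosh_le_exp_abs (x : ℝ) : Real.cosh x ≤ Real.exp |x| := by
  rw [Real.cosh_eq]
  have h1 : Real.exp x ≤ Real.exp |x| := Real.exp_le_exp.2 (le_abs_self x)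
  have h2 : Real.exp (-x) ≤ Real.exp |x| := Real.exp_le_exp.2 (neg_le_abs x)
  linarith

theorem abs_sinh_le_cosh (x : ℝ) : |Real.sinh x| ≤ Real.cosh x := by
  rw [Real.sinh_eq, Real.cosh_eq, abs_le]
  have h1 := Real.exp_pos x
  have h2 := Real.exp_pos (-x)
  constructor <;> linarith

/-- The cutoff reaches at most `δ / k` beyond the channel, that is `δ` after scaling by `k`. Leaving
`[0, 1]` therefore costs only `exp (2 * δ)`, independently of `k`. -/
theorem cosh_div_sinh_le {k δ y : ℝ} (hk : 1 ≤ k) (hδ : 0 ≤ δ) (h1 : -(δ / k) ≤ y)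
    (h2 : y ≤ 1 + δ / k) :
    Real.cosh (k * (1 - y)) / Real.sinh k ≤ 3 * Real.exp (2 * δ) * Real.exp (-k * |y - 0|) := by
  have hk0 : 0 < k := by linarith
  have hs : 0 < Real.sinh k := Real.sinh_pos_iff.2 hk0
  have h1' : -δ ≤ k * y := by
    have := mul_le_mul_of_nonneg_left h1 hk0.le
    rwa [mul_neg, mul_div_cancel₀ _ hk0.ne'] at this
  have h2' : k * y ≤ k + δ := by
    have := mul_le_mul_of_nonneg_left h2 hk0.le
    rwa [mul_add, mul_div_cancel₀ _ hk0.ne', mul_one] at this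
  rw [div_le_iff₀ hs, sub_zero]
  have h3 : |k * (1 - y)| ≤ 2 * δ + -k * |y| + k := by
    have e : -k * |y| = -|k * y| := by rw [abs_mul, abs_of_pos hk0]; ring
    rw [e]
    rcases abs_cases (k * (1 - y)) with ⟨ha, _⟩ | ⟨ha, _⟩ <;>
    rcases abs_cases (k * y) with ⟨hb, _⟩ | ⟨hb, _⟩ <;> rw [ha, hb] <;> nlinarith
  calc Real.cosh (k * (1 - y)) ≤ Real.exp |k * (1 - y)| := cosh_le_exp_abs _
    _ ≤ Real.exp (2 * δ + -k * |y| + k) := Real.exp_le_exp.2 h3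
    _ = Real.exp (2 * δ) * Real.exp (-k * |y|) * Real.exp k := by rw [Real.exp_add, Real.exp_add]
    _ ≤ Real.exp (2 * δ) * Real.exp (-k * |y|) * (3 * Real.sinh k) := by
        gcongr; exact exp_div_sinh_le hk
    _ = _ := by ring

theorem exists_cutoff_mul {k δ C D p : ℝ} (hk : 1 ≤ k) (hC : 0 ≤ C) (hD : 0 ≤ D)
    {ψ σ σ' : ℝ → ℝ} (hψ : ContDiff ℝ ∞ ψ) (h1 : ∀ y, |ψ y| ≤ 1)
    (h2 : ∀ y, |deriv ψ y| ≤ C * k) (hsupp : tsupport ψ ⊆ Icc (-(δ / k)) (1 + δ / k))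
    (hσ : ∀ y, HasDerivAt σ (σ' y) y) (hσ' : Continuous σ')
    (hb : ∀ y ∈ Icc (-(δ / k)) (1 + δ / k), |σ y| ≤ D * Real.exp (-k * |y - p|))
    (hb' : ∀ y ∈ Icc (-(δ / k)) (1 + δ / k), |σ' y| ≤ D * k * Real.exp (-k * |y - p|)) :
    ∃ e : H1 k, ‖e‖ ≤ (2 + C) * D * √(2 * k) ∧ ∀ y, e.fn y = ψ y * σ y := by
  have hk0 : 0 < k := by linarith
  have hσc : Continuous σ := continuous_iff_continuousAt.2 fun y => (hσ y).continuousAt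
  have hψd : ∀ y, HasDerivAt ψ (deriv ψ y) y := fun y =>
    ((hψ.differentiable (by simp)) y).hasDerivAt
  have hψc := hψ.continuous
  have hψc' := hψ.continuous_deriv (n := ∞) (by simp)
  have z1 : ∀ y, y ∉ Icc (-(δ / k)) (1 + δ / k) → ψ y = 0 := fun y hy => by
    by_contra hne
    exact hy (hsupp (subset_tsupport ψ hne))
  have z2 : ∀ y, y ∉ Icc (-(δ / k)) (1 + δ / k) → deriv ψ y = 0 := fun y hy => by
    by_contra hne
    exact hy (hsupp (support_deriv_subset hne))
  obtain ⟨e, he, hfn⟩ := H1.exists_of_le_exp hk0 (f := fun y => ψ y * σ y)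
    (g := fun y => deriv ψ y * σ y + ψ y * σ' y) p hD (D' := (1 + C) * D) (by positivity)
    (by fun_prop) (by fun_prop)
    (IsPrim.of_hasDerivAt (fun y => ((hψd y).mul (hσ y)).ofReal_comp) (by fun_prop))
    (fun y => by
      by_cases hy : y ∈ Icc (-(δ / k)) (1 + δ / k)
      · rw [abs_mul]
        exact (mul_le_of_le_one_left (abs_nonneg _) (h1 y)).trans (hb y hy)
      · rw [z1 y hy, zero_mul, abs_zero]; positivity)
    (fun y => by
      by_cases hy : y ∈ Icc (-(δ / k)) (1 + δ / k)
      · calc |deriv ψ y * σ y + ψ y * σ' y| ≤ |deriv ψ y| * |σ y| + |ψ y| * |σ' y| := by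
              rw [← abs_mul, ← abs_mul]; exact abs_add_le _ _
          _ ≤ (C * k) * (D * Real.exp (-k * |y - p|)) +
              1 * (D * k * Real.exp (-k * |y - p|)) := by
              gcongr
              · exact h2 y
              · exact hb y hy
              · exact h1 y
              · exact hb' y hy
          _ = _ := by ring
      · rw [z1 y hy, z2 y hy, zero_mul, zero_mul, add_zero, abs_zero]; positivity)
  refine ⟨e, he.trans (le_of_eq (by ring)), fun y => ?_⟩
  rw [hfn]; push_cast; rfl

/-- The operators of subtraction of boundary values and cutoff are uniformly bounded. -/
theorem exists_opM {δ₀ : ℝ} (hδ₀ : 0 < δ₀) {Ψ : ℕ → ℝ → ℝ} (hΨ : IsCutoffFamily δ₀ Ψ) :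
    ∃ K : ℝ, 0 < K ∧ ∀ k : ℕ, 1 ≤ k → ∃ M : H1 (k : ℝ) →L[ℂ] H1 (k : ℝ), ‖M‖ ≤ K ∧
      ∀ u y, (M u).fn y =
        Ψ k y * (u.fn y - sigma₀ k y * u.fn 0 - sigma₁ k y * u.fn 1) := by
  obtain ⟨C, hC⟩ := hΨ.deriv_bound
  have hC0 : 0 ≤ C := by
    have := (abs_nonneg _).trans (hC 1 le_rfl 0)
    simpa using this
  set D := 3 * Real.exp (2 * δ₀)
  have hD : 0 ≤ D := by positivity
  refine ⟨2 + C + (2 + C) * D + (2 + C) * D, by positivity, fun k hk => ?_⟩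
  have hk1 : (1 : ℝ) ≤ k := by exact_mod_cast hk
  have hk0 : (0 : ℝ) < k := by linarith
  have hs : 0 < Real.sinh k := Real.sinh_pos_iff.2 hk0
  have h1 : ∀ y, |Ψ k y| ≤ 1 := fun y => by
    have := hΨ.mem_Icc k hk y
    rw [abs_le]; constructor <;> linarith [this.1, this.2]
  obtain ⟨X, hX, hXf⟩ := H1.exists_mul hk0 (hΨ.smooth k hk) hC0 h1 (hC k hk)
  have b0 : ∀ y ∈ Icc (-(δ₀ / k)) (1 + δ₀ / k),
      Real.cosh (k * (1 - y)) / Real.sinh k ≤ D * Real.exp (-k * |y - 0|) := fun y hy =>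
    cosh_div_sinh_le hk1 hδ₀.le hy.1 hy.2
  have b1 : ∀ y ∈ Icc (-(δ₀ / k)) (1 + δ₀ / k),
      Real.cosh (k * y) / Real.sinh k ≤ D * Real.exp (-k * |y - 1|) := fun y hy => by
    have := cosh_div_sinh_le (y := 1 - y) hk1 hδ₀.le (by linarith [hy.2]) (by linarith [hy.1])
    rw [sub_zero, abs_sub_comm] at this
    simpa using this
  obtain ⟨e0, he0, hf0⟩ := exists_cutoff_mul hk1 hC0 hD (hΨ.smooth k hk) h1 (hC k hk)
    (hΨ.tsupport_subset k hk) (hasDerivAt_sigma₀ k) (by fun_prop)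
    (fun y hy => by
      rw [sigma₀, abs_div, abs_of_pos hs]
      exact (div_le_div_of_nonneg_right (abs_sinh_le_cosh _) hs.le).trans (b0 y hy))
    (fun y hy => by
      rw [abs_div, abs_of_pos hs, abs_mul, abs_neg, abs_of_pos hk0,
        abs_of_pos (Real.cosh_pos _), mul_div_assoc]
      calc _ ≤ (k : ℝ) * (D * Real.exp (-k * |y - 0|)) := by gcongr; exact b0 y hy
        _ = _ := by ring)
  obtain ⟨e1, he1, hf1⟩ := exists_cutoff_mul hk1 hC0 hD (hΨ.smooth k hk) h1 (hC k hk)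
    (hΨ.tsupport_subset k hk) (hasDerivAt_sigma₁ k) (by fun_prop)
    (fun y hy => by
      rw [sigma₁, abs_div, abs_of_pos hs]
      exact (div_le_div_of_nonneg_right (abs_sinh_le_cosh _) hs.le).trans (b1 y hy))
    (fun y hy => by
      rw [abs_div, abs_of_pos hs, abs_mul, abs_of_pos hk0,
        abs_of_pos (Real.cosh_pos _), mul_div_assoc]
      calc _ ≤ (k : ℝ) * (D * Real.exp (-k * |y - 1|)) := by gcongr; exact b1 y hy
        _ = _ := by ring)
  -- The rank one maps `u ↦ u(y) e` are uniformly bounded: evaluation has norm at most `1 / √(2 *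
  -- k)`, cancelling the factor `√(2 * k)` in the bound for `e`.
  have hev : ∀ (y : ℝ) (e : H1 (k : ℝ)), ‖e‖ ≤ (2 + C) * D * √(2 * k) →
      ‖(H1.ev y).smulRight e‖ ≤ (2 + C) * D := fun y e he => by
    refine ContinuousLinearMap.opNorm_le_bound _ (by positivity) fun u => ?_
    rw [ContinuousLinearMap.smulRight_apply, norm_smul]
    have h3 := u.norm_fn_le hk0 y
    have h4 : √(2 * (k : ℝ)) ≠ 0 := by positivity
    calc ‖H1.ev y u‖ * ‖e‖ ≤ (1 / √(2 * k) * ‖u‖) * ((2 + C) * D * √(2 * k)) := by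
          gcongr; exact h3
      _ = _ := by field_simp
  refine ⟨X - (H1.ev 0).smulRight e0 - (H1.ev 1).smulRight e1, ?_, fun u y => ?_⟩
  · refine (norm_sub_le _ _).trans (add_le_add ((norm_sub_le _ _).trans
      (add_le_add hX (hev 0 e0 he0))) (hev 1 e1 he1))
  · simp only [sub_apply, ContinuousLinearMap.smulRight_apply, H1.fn_sub, H1.fn_smul, hXf, hf0, hf1]
    have e : ∀ y, H1.ev y u = u.fn y := fun _ => rfl
    rw [e, e]; ring

/-! ### Tools for the limiting equation -/

theorem IsPrim.ae_eq_zero_of_open {f g : ℝ → ℂ} (h : IsPrim f g) {S : Set ℝ} (hS : IsOpen S)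
    (h0 : ∀ x ∈ S, f x = 0) : ∀ᵐ x, x ∈ S → g x = 0 := by
  filter_upwards [h.ae_hasDerivAt] with x hx hxS
  have : HasDerivAt f 0 x := (hasDerivAt_const x (0 : ℂ)).congr_of_eventuallyEq
    (Filter.eventuallyEq_of_mem (hS.mem_nhds hxS) h0)
  exact hx.unique this

theorem IsPrim.ae_eq {f g g' : ℝ → ℂ} (h : IsPrim f g) (h' : IsPrim f g') : g =ᵐ[volume] g' :=
  h.hasWeakDeriv.ae_eq h'.hasWeakDeriv

theorem H1.der_ae_zero {k : ℝ} (hk : 0 < k) (u : H1 k) {p q : ℝ}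
    (h : ∀ y ∉ Icc p q, u.fn y = 0) : ∀ᵐ z, z ∉ Icc p q → u.der z = 0 :=
  (u.isPrim hk).ae_eq_zero_of_open isClosed_Icc.isOpen_compl h

theorem integral_eq_Ioc_of_zero {f : ℝ → ℂ} {p q : ℝ} (h : ∀ᵐ z, z ∉ Icc p q → f z = 0) :
    ∫ z, f z = ∫ z in Ioc p q, f z := by
  rw [← integral_Icc_eq_integral_Ioc]
  exact (setIntegral_eq_integral_of_ae_compl_eq_zero h).symm

/-- An element of `H¹` with prescribed, compactly supported derivative of mean zero. -/
theorem H1.exists_bump {k : ℝ} (hk : 0 < k) {ζ : ℝ → ℂ} (hζ : MemLp ζ 2 volume) {p q : ℝ}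
    (hs : ∀ z ∉ Ioc p q, ζ z = 0) (h0 : ∫ z in p..q, ζ z = 0) :
    ∃ η : H1 k, η.der =ᵐ[volume] ζ ∧ (∀ y, η.fn y = ∫ z in p..y, ζ z) ∧
      ∀ y ∉ Icc p q, η.fn y = 0 := by
  have hp := IsPrim.integral hζ.locallyIntegrable' p
  have hz : ∀ y ∉ Icc p q, ∫ z in p..y, ζ z = 0 := fun y hy => by
    rcases lt_or_ge y p with h | h
    · refine intervalIntegral.integral_zero_ae (Filter.Eventually.of_forall fun z hz' => hs z ?_)
      rw [uIoc_of_ge h.le] at hz'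
      exact fun hc => by linarith [hc.1, hz'.2]
    · have hq : q < y := by
        by_contra hcon
        exact hy ⟨h, not_lt.1 hcon⟩
      rw [← intervalIntegral.integral_add_adjacent_intervals (hp.intervalIntegrable p q)
        (hp.intervalIntegrable q y), h0, zero_add]
      refine intervalIntegral.integral_zero_ae (Filter.Eventually.of_forall fun z hz' => hs z ?_)
      rw [uIoc_of_le hq.le] at hz'
      exact fun hc => by linarith [hc.2, hz'.1]
  have hm : MemLp (fun y => ∫ z in p..y, ζ z) 2 volume := by
    refine hp.continuous.memLp_of_hasCompactSupport
      (HasCompactSupport.intro (isCompact_Icc (a := p) (b := q)) hz)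
  refine ⟨H1.mk k hm hζ hp, H1.der_mk_ae _ _ _, fun y => by rw [H1.fn_mk hk], fun y hy => ?_⟩
  rw [H1.fn_mk hk]; exact hz y hy

theorem isPrim_of_real {f g : ℝ → ℝ} (h : ∀ y, HasDerivAt f (g y) y) (hg : Continuous g) :
    IsPrim (fun y => (f y : ℂ)) (fun y => (g y : ℂ)) :=
  IsPrim.of_hasDerivAt (fun y => (h y).ofReal_comp) (Complex.continuous_ofReal.comp hg)

/-- At `t = 0` the form is not an absolutely convergent integral against `1 / (b - w)` in general;
identities for it are obtained as limits of the regularized ones. -/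
theorem tendsto_form {b : ℝ → ℝ} (hb : IsShearFlow b) {k : ℝ} (hk : 1 ≤ k) {s : ℝ}
    (hs : s ^ 2 = 1) (w : ℝ) (u v : H1 k) :
    Filter.Tendsto (fun n : ℕ => form (flowCoeff b) (logW b s (1 / ((n : ℝ) + 1)) w) u v)
      Filter.atTop (nhds (form (flowCoeff b) (logW b s 0 w) u v)) := by
  obtain ⟨C, hC⟩ := hb.exists_isCoeff
  have hk0 : 0 < k := by linarith
  have ht : ∀ n : ℕ, (0 : ℝ) < 1 / ((n : ℝ) + 1) := fun n => by positivity
  have ht1 : ∀ n : ℕ, 1 / ((n : ℝ) + 1) ≤ 1 := fun n => by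
    rw [div_le_one (by positivity)]; linarith [(Nat.cast_nonneg n : (0 : ℝ) ≤ n)]
  have m0 := memLp_logW hb w hs le_rfl zero_le_one
  have mn := fun n => memLp_logW hb w hs (ht n).le (ht1 n)
  have hlim := tendsto_logW hb hs (w := w) (wn := fun _ => w) tendsto_const_nhds
    (tendsto_one_div_add_atTop_nhds_zero_nat (𝕜 := ℝ)) ht
  rw [tendsto_iff_norm_sub_tendsto_zero]
  refine squeeze_zero (fun _ => norm_nonneg _) (fun n => ?_)
    (g := fun n : ℕ => 3 * C * √(∫ z in Ioc (-2 : ℝ) 2,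
      ‖logW b s (1 / ((n : ℝ) + 1)) w z - logW b s 0 w z‖ ^ 2) / √k * ‖u‖ * ‖v‖) ?_
  · rw [← form_sub_weight hk0 hC (mn n) m0]
    exact norm_form_le' hk hC ((mn n).sub m0) u v
  · have h1 := (Real.continuous_sqrt.tendsto 0).comp hlim
    have h2 := ((((h1.const_mul (3 * C)).div_const (√k)).mul_const ‖u‖).mul_const ‖v‖)
    simpa [Function.comp_def] using h2

/-- The limiting form only depends on the product `u v̄`. -/
theorem form_congr {b : ℝ → ℝ} (hb : IsShearFlow b) {k : ℝ} (hk : 1 ≤ k) {s : ℝ}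
    (hs : s ^ 2 = 1) (w : ℝ) {u v u' v' : H1 k}
    (h : ∀ z, u.fn z * conj (v.fn z) = u'.fn z * conj (v'.fn z)) :
    form (flowCoeff b) (logW b s 0 w) u v = form (flowCoeff b) (logW b s 0 w) u' v' := by
  refine tendsto_nhds_unique (tendsto_form hb hk hs w u v)
    ((tendsto_form hb hk hs w u' v').congr fun n => ?_)
  have hk0 : 0 < k := by linarith
  rw [form_logW hk0 hb hs (by positivity), form_logW hk0 hb hs (by positivity)]
  simp only [h]

/-! ### The limiting equation -/

/-- `φ + M U = 0` with `U` the solution of the whole line problem with data `φ`. -/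
structure LimitSol (b : ℝ → ℝ) (k : ℕ) (ψ : ℝ → ℝ) (C s w : ℝ) (φ U : H1 (k : ℝ)) : Prop where
  flow : IsShearFlow b
  one_le : 1 ≤ k
  sign : s ^ 2 = 1
  smooth : ContDiff ℝ ∞ ψ
  eq_one : ∀ y ∈ Icc (0 : ℝ) 1, ψ y = 1
  bound : ∀ y, |ψ y| ≤ 1
  bound_deriv : ∀ y, |deriv ψ y| ≤ C
  inner_eq : ∀ η, ⟪η, U⟫_ℂ = form (flowCoeff b) (logW b s 0 w) φ η
  fn_eq : ∀ y, φ.fn y = -(ψ y * (U.fn y - sigma₀ k y * U.fn 0 - sigma₁ k y * U.fn 1))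

/-- The solution with the boundary values subtracted. -/
def stream {k : ℕ} (U : H1 (k : ℝ)) (y : ℝ) : ℂ :=
  U.fn y - sigma₀ k y * U.fn 0 - sigma₁ k y * U.fn 1

/-- The derivative of `stream U`. -/
def streamDer {k : ℕ} (U : H1 (k : ℝ)) (y : ℝ) : ℂ :=
  U.der y - ((-k * Real.cosh (k * (1 - y)) / Real.sinh k : ℝ) : ℂ) * U.fn 0 -
    ((k * Real.cosh (k * y) / Real.sinh k : ℝ) : ℂ) * U.fn 1

theorem isPrim_stream {k : ℕ} (hk : 1 ≤ k) (U : H1 (k : ℝ)) : IsPrim (stream U) (streamDer U) := by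
  have hk0 : (0 : ℝ) < k := by exact_mod_cast hk
  have h0 := isPrim_of_real (hasDerivAt_sigma₀ k) (by fun_prop)
  have h1 := isPrim_of_real (hasDerivAt_sigma₁ k) (by fun_prop)
  have := ((U.isPrim hk0).sub (h0.const_mul (U.fn 0))).sub (h1.const_mul (U.fn 1))
  simp only [mul_comm (U.fn 0), mul_comm (U.fn 1)] at this
  exact this

theorem stream_zero {k : ℕ} (hk : 1 ≤ k) (U : H1 (k : ℝ)) : stream U 0 = 0 := by
  have hs : Real.sinh k ≠ 0 := (Real.sinh_pos_iff.2 (by exact_mod_cast hk : (0 : ℝ) < k)).ne'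
  simp [stream, sigma₀, sigma₁, hs]

theorem stream_one {k : ℕ} (hk : 1 ≤ k) (U : H1 (k : ℝ)) : stream U 1 = 0 := by
  have hs : Real.sinh k ≠ 0 := (Real.sinh_pos_iff.2 (by exact_mod_cast hk : (0 : ℝ) < k)).ne'
  simp [stream, sigma₀, sigma₁, hs]

theorem memLp_restrict_of_continuous {f : ℝ → ℂ} (hf : Continuous f) (p q : ℝ) :
    MemLp f 2 (volume.restrict (Ioc p q)) := by
  obtain ⟨M, hM⟩ := isCompact_Icc.exists_bound_of_continuousOn (s := Icc p q) hf.continuousOn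
  refine MemLp.of_bound hf.aestronglyMeasurable M ?_
  filter_upwards [ae_restrict_mem measurableSet_Ioc] with z hz
  exact hM z (Ioc_subset_Icc_self hz)

theorem memLp_streamDer {k : ℕ} (U : H1 (k : ℝ)) (p q : ℝ) :
    MemLp (streamDer U) 2 (volume.restrict (Ioc p q)) := by
  refine ((U.memLp_der.restrict _).sub ?_).sub ?_
  · exact memLp_restrict_of_continuous (by fun_prop) p q
  · exact memLp_restrict_of_continuous (by fun_prop) p q

/-- Solutions of `σ'' = k² σ` are orthogonal to compactly supported elements of `H¹`. -/
theorem integral_homogeneous {k : ℝ} (hk : 0 < k) {σ σ' : ℝ → ℝ} (h : ∀ y, HasDerivAt σ (σ' y) y)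
    (h' : ∀ y, HasDerivAt σ' (k ^ 2 * σ y) y) (η : H1 k) {p q : ℝ} (hpq : p ≤ q)
    (hp : η.fn p = 0) (hq : η.fn q = 0) :
    ∫ z in Ioc p q, (conj (η.der z) * σ' z + k ^ 2 * (conj (η.fn z) * σ z)) = 0 := by
  have hσ : Continuous σ := continuous_iff_continuousAt.2 fun y => (h y).continuousAt
  have h1 := isPrim_of_real h' (by fun_prop)
  have h2 := (((η.isPrim hk).conj).mul h1).sub_eq p q
  rw [hp, hq, map_zero, zero_mul, zero_mul, sub_self,
    intervalIntegral.integral_of_le hpq] at h2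
  rw [h2]
  congr 1; ext z; push_cast; ring

namespace LimitSol

variable {b : ℝ → ℝ} {k : ℕ} {ψ : ℝ → ℝ} {C s w : ℝ} {φ U : H1 (k : ℝ)}

theorem k_pos (h : LimitSol b k ψ C s w φ U) : (0 : ℝ) < k := by exact_mod_cast h.one_le

theorem one_le' (h : LimitSol b k ψ C s w φ U) : (1 : ℝ) ≤ k := by exact_mod_cast h.one_le

theorem fn_eq_stream (h : LimitSol b k ψ C s w φ U) (y : ℝ) : φ.fn y = -(ψ y * stream U y) :=
  h.fn_eq y

/-- The weak form of the equation for the stream function. -/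
theorem weak_eq (h : LimitSol b k ψ C s w φ U) {p q : ℝ} (hpq : p ≤ q) (η : H1 (k : ℝ))
    (hη : ∀ y ∉ Ioo p q, η.fn y = 0) :
    ∫ z in Ioc p q, (conj (η.der z) * streamDer U z + k ^ 2 * (conj (η.fn z) * stream U z)) =
      form (flowCoeff b) (logW b s 0 w) φ η := by
  have hk := h.k_pos
  have hη' : ∀ y ∉ Icc p q, η.fn y = 0 := fun y hy => hη y fun hc => hy (Ioo_subset_Icc_self hc)
  have hd := η.der_ae_zero hk hη'
  have hp : η.fn p = 0 := hη p (by simp)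
  have hq : η.fn q = 0 := hη q (by simp)
  -- `σ₀` and `σ₁` solve the homogeneous equation, so subtracting them from `U` changes nothing when
  -- the test function vanishes at `p` and `q`.
  have e0 := integral_homogeneous hk (hasDerivAt_sigma₀ k) (fun y => by
    have hh : HasDerivAt (fun y => (k : ℝ) * (1 - y)) (k * (-1)) y :=
      ((hasDerivAt_id y).const_sub 1).const_mul _
    exact ((hh.cosh.const_mul (-(k : ℝ))).div_const _).congr_deriv (by rw [sigma₀]; ring))
    η hpq hp hq
  have e1 := integral_homogeneous hk (hasDerivAt_sigma₁ k) (fun y => by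
    have hh : HasDerivAt (fun y => (k : ℝ) * y) (k * 1) y := (hasDerivAt_id y).const_mul _
    exact ((hh.cosh.const_mul (k : ℝ)).div_const _).congr_deriv (by rw [sigma₁]; ring))
    η hpq hp hq
  have m1 := ((Complex.conjLIE.toContinuousLinearEquiv.toContinuousLinearMap.comp_memLp'
    η.memLp_der).restrict (Ioc p q))
  have m2 := ((Complex.conjLIE.toContinuousLinearEquiv.toContinuousLinearMap.comp_memLp'
    (η.memLp_fn hk)).restrict (Ioc p q))
  have i1 : IntegrableOn (fun z => conj (η.der z) * U.der z) (Ioc p q) :=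
    m1.integrable_mul (U.memLp_der.restrict _)
  have i2 : IntegrableOn (fun z => conj (η.fn z) * U.fn z) (Ioc p q) :=
    m2.integrable_mul ((U.memLp_fn hk).restrict _)
  have iσ : ∀ {σ σ' : ℝ → ℝ}, Continuous σ → Continuous σ' → IntegrableOn (fun z =>
      conj (η.der z) * σ' z + (k : ℂ) ^ 2 * (conj (η.fn z) * σ z)) (Ioc p q) := fun hσ hσ' =>
    (m1.integrable_mul (memLp_restrict_of_continuous (by fun_prop) p q)).add
      ((m2.integrable_mul (memLp_restrict_of_continuous (by fun_prop) p q)).const_mul _)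
  have c0 : Continuous (sigma₀ k) := by unfold sigma₀; fun_prop
  have c1 : Continuous (sigma₁ k) := by unfold sigma₁; fun_prop
  have j0 := iσ (σ' := fun y => -k * Real.cosh (k * (1 - y)) / Real.sinh k) c0 (by fun_prop)
  have j1 := iσ (σ' := fun y => k * Real.cosh (k * y) / Real.sinh k) c1 (by fun_prop)
  rw [← h.inner_eq, H1.inner_eq hk, integral_eq_Ioc_of_zero (p := p) (q := q),
    integral_eq_Ioc_of_zero (p := p) (q := q)]
  · have key : ∫ z in Ioc p q, (conj (η.der z) * streamDer U z +
        k ^ 2 * (conj (η.fn z) * stream U z)) =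
        ∫ z in Ioc p q, ((k ^ 2 * (conj (η.fn z) * U.fn z) + conj (η.der z) * U.der z) -
          U.fn 0 * (conj (η.der z) * ((-k * Real.cosh (k * (1 - z)) / Real.sinh k : ℝ) : ℂ) +
            k ^ 2 * (conj (η.fn z) * sigma₀ k z)) -
          U.fn 1 * (conj (η.der z) * ((k * Real.cosh (k * z) / Real.sinh k : ℝ) : ℂ) +
            k ^ 2 * (conj (η.fn z) * sigma₁ k z))) := by
      congr 1; ext z
      rw [streamDer, stream]; ring
    have i12 := (i2.const_mul ((k : ℂ) ^ 2)).add i1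
    have i3 := i12.sub (j0.const_mul (U.fn 0))
    have s1 := integral_sub i3 (j1.const_mul (U.fn 1))
    have s2 := integral_sub i12 (j0.const_mul (U.fn 0))
    have s3 := integral_add (i2.const_mul ((k : ℂ) ^ 2)) i1
    simp only [Pi.add_apply, Pi.sub_apply] at s1 s2 s3
    rw [key, s1, s2, s3, integral_const_mul, integral_const_mul, integral_const_mul]
    simp only [Complex.ofReal_natCast] at e0 e1 ⊢
    rw [e0, e1]; ring
  · filter_upwards [hd] with z hz hz'
    rw [hz hz', map_zero, zero_mul]
  · filter_upwards with z hz'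
    rw [hη' z hz', map_zero, zero_mul]

end LimitSol

/-! ### Vanishing in the channel -/

/-- The Dirichlet Green function as an element of `H¹`. -/
def greenH1 (k : ℕ) (y : ℝ) : H1 (k : ℝ) :=
  H1.ker k y - (sigma₀ k y : ℂ) • H1.ker k 0 - (sigma₁ k y : ℂ) • H1.ker k 1

theorem greenH1_fn {k : ℕ} (hk : 1 ≤ k) (y z : ℝ) :
    (greenH1 k y).fn z = (extGreen k (fun _ => 1) y z : ℝ) := by
  have hk0 : (0 : ℝ) < k := by exact_mod_cast hk
  simp only [greenH1, H1.fn_sub, H1.fn_smul, H1.fn_ker hk0, expKer, extGreen, sigma₀, sigma₁,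
    sub_zero]
  push_cast
  ring

/-- For a pole in the channel the three exponentials cancel outside it. Hence `greenH1 k y` is an
admissible test function for the channel problem. -/
theorem extGreen_one_eq_zero {k : ℕ} (hk : 1 ≤ k) {y z : ℝ} (hy : y ∈ Icc (0 : ℝ) 1)
    (hz : z ∉ Ioo (0 : ℝ) 1) : extGreen k (fun _ => 1) y z = 0 := by
  have hk' : (0 : ℝ) < k := by exact_mod_cast hk
  have hs : Real.sinh k ≠ 0 := (Real.sinh_pos_iff.2 hk').ne'
  have p1 := Real.exp_pos (k * y)
  have p2 := Real.exp_pos (k * z)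
  have p3 := Real.exp_pos (k : ℝ)
  have e1 : Real.sinh (k * (1 - y)) =
      (Real.exp k / Real.exp (k * y) - Real.exp (k * y) / Real.exp k) / 2 := by
    rw [Real.sinh_eq, ← Real.exp_sub, ← Real.exp_sub]
    ring_nf
  have e2 : ∀ x : ℝ, Real.sinh x = (Real.exp x - 1 / Real.exp x) / 2 := by
    intro x
    rw [Real.sinh_eq, Real.exp_neg, one_div]
  have key : ∀ X Y Y' Z Z' S : ℝ, S ≠ 0 → X * S - Y * Y' - Z * Z' = 0 →
      1 * (1 / (2 * (k : ℝ)) * X - Y / (2 * k * S) * Y' - Z / (2 * k * S) * Z') = 0 := by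
    intro X Y Y' Z Z' S hS h
    have : 1 * (1 / (2 * (k : ℝ)) * X - Y / (2 * k * S) * Y' - Z / (2 * k * S) * Z') =
        (X * S - Y * Y' - Z * Z') / (2 * k * S) := by field_simp
    rw [this, h, zero_div]
  rw [extGreen]
  refine key _ _ _ _ _ _ hs ?_
  rcases le_or_gt z 0 with h | h
  · rw [abs_of_nonpos (by linarith [hy.1] : z - y ≤ 0), abs_of_nonpos h,
      abs_of_nonpos (by linarith : z - 1 ≤ 0)]
    have a1 : Real.exp (-k * -(z - y)) = Real.exp (k * z) / Real.exp (k * y) := by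
      rw [← Real.exp_sub]; ring_nf
    have a2 : Real.exp (-k * -z) = Real.exp (k * z) := by ring_nf
    have a3 : Real.exp (-k * -(z - 1)) = Real.exp (k * z) / Real.exp k := by
      rw [← Real.exp_sub]; ring_nf
    rw [a1, a2, a3, e1, e2, e2]
    field_simp
    ring
  · have h1 : 1 ≤ z := by
      by_contra hcon
      exact hz ⟨h, not_le.1 hcon⟩
    rw [abs_of_nonneg (by linarith [hy.2] : 0 ≤ z - y), abs_of_nonneg h.le,
      abs_of_nonneg (by linarith : 0 ≤ z - 1)]
    have a1 : Real.exp (-k * (z - y)) = Real.exp (k * y) / Real.exp (k * z) := by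
      rw [← Real.exp_sub]; ring_nf
    have a2 : Real.exp (-k * z) = 1 / Real.exp (k * z) := by
      rw [one_div, ← Real.exp_neg]; ring_nf
    have a3 : Real.exp (-k * (z - 1)) = Real.exp k / Real.exp (k * z) := by
      rw [← Real.exp_sub]; ring_nf
    rw [a1, a2, a3, e1, e2, e2]
    field_simp
    ring

theorem formDensity_self_im {k : ℝ} (β : ℝ → ℝ) (u : H1 k) (z : ℝ) :
    (formDensity β u u z).im = 0 := by
  simp only [formDensity, Complex.add_im, Complex.mul_im, Complex.ofReal_re, Complex.ofReal_im,
    Complex.mul_re, Complex.conj_re, Complex.conj_im]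
  ring

/-- The imaginary part of the limiting form is concentrated at the critical point. -/
theorem form_self_im {b : ℝ → ℝ} (hb : IsShearFlow b) {k : ℝ} (hk : 1 ≤ k) {s : ℝ}
    (hs : s ^ 2 = 1) {y : ℝ} (hy : y ∈ Icc (-2 : ℝ) 2) (u : H1 k) :
    (form (flowCoeff b) (logW b s 0 (b y)) u u).im =
      -(s * Real.pi * (flowCoeff b y * ‖u.fn y‖ ^ 2)) := by
  obtain ⟨C, hC⟩ := hb.exists_isCoeff
  have hk0 : 0 < k := by linarith
  have hI := integrable_mul_formDensity hk0 hC (memLp_logW hb (b y) hs le_rfl zero_le_one) u u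
  have hp := isPrim_formDensity hk0 hC.smooth u u
  set D := formDensity (flowCoeff b) u u
  -- The density is the derivative of the real function `β |u|²`, so only the jump part of the
  -- weight contributes. Since `β` vanishes at `±2`, the two sides of `y` each give `-β(y) |u(y)|²`,
  -- and `π/2` becomes `π`.
  have him : (∫ z in Ioc (-2 : ℝ) 2, logW b s 0 (b y) z * D z).im =
      ∫ z in Ioc (-2 : ℝ) 2, -(s * (Real.pi / 2)) * (Real.sign (b z - b y) * (D z).re) := by
    refine (integral_im hI).symm.trans ?_
    congr 1; ext z
    have h1 : (D z).im = 0 := formDensity_self_im _ _ _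
    have h2 : (logW b s 0 (b y) z).im = -(s * (Real.pi / 2 * Real.sign (b z - b y))) := by
      rw [logW, angle, if_pos rfl]; simp
    show (logW b s 0 (b y) z * D z).im = _
    rw [Complex.mul_im, h1, h2]; ring
  have hre : ∀ p q, p ≤ q → ∫ z in Ioc p q, (D z).re =
      flowCoeff b q * ‖u.fn q‖ ^ 2 - flowCoeff b p * ‖u.fn p‖ ^ 2 := fun p q hpq => by
    have h1 := hp.sub_eq p q
    rw [intervalIntegral.integral_of_le hpq] at h1
    have h2 : ∫ z in Ioc p q, (D z).re = (∫ z in Ioc p q, D z).re :=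
      integral_re (hp.intervalIntegrable p q).1
    rw [h2, ← h1]
    simp only [Complex.mul_conj, Complex.normSq_eq_norm_sq]
    norm_cast
  have hDi : ∀ p q, p ≤ q → IntegrableOn (fun z => (D z).re) (Ioc p q) := fun p q _ =>
    (hp.intervalIntegrable p q).1.re
  have hz2 : flowCoeff b 2 = 0 := by rw [flowCoeff, hb.deriv2_two.1, zero_div]
  have hz2' : flowCoeff b (-2) = 0 := by rw [flowCoeff, hb.deriv2_two.2, zero_div]
  have el : ∫ z in Ioc (-2 : ℝ) y, Real.sign (b z - b y) * (D z).re =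
      -(flowCoeff b y * ‖u.fn y‖ ^ 2) := by
    have : ∫ z in Ioc (-2 : ℝ) y, Real.sign (b z - b y) * (D z).re =
        ∫ z in Ioc (-2 : ℝ) y, -(D z).re := by
      refine integral_congr_ae ?_
      filter_upwards [ae_restrict_mem measurableSet_Ioc, ae_restrict_of_ae (ae_ne y)] with z hz hne
      rw [Real.sign_of_neg (sub_neg.2 (hb.strictMono (lt_of_le_of_ne hz.2 hne)))]; ring
    rw [this, integral_neg, hre _ _ hy.1, hz2']; ring
  have er : ∫ z in Ioc y 2, Real.sign (b z - b y) * (D z).re =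
      -(flowCoeff b y * ‖u.fn y‖ ^ 2) := by
    have : ∫ z in Ioc y 2, Real.sign (b z - b y) * (D z).re =
        ∫ z in Ioc y 2, (D z).re := by
      refine integral_congr_ae ?_
      filter_upwards [ae_restrict_mem measurableSet_Ioc] with z hz
      rw [Real.sign_of_pos (sub_pos.2 (hb.strictMono hz.1))]; ring
    rw [this, hre _ _ hy.2, hz2]; ring
  have hSi : IntegrableOn (fun z => Real.sign (b z - b y) * (D z).re) (Ioc (-2 : ℝ) 2) := by
    refine (hDi (-2) 2 (by norm_num)).norm.mono'
      ((measurable_sign'.comp (hb.continuous.measurable.sub_const _)).aestronglyMeasurable.mul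
        (hDi (-2) 2 (by norm_num)).1) (Filter.Eventually.of_forall fun z => ?_)
    rw [norm_mul]
    refine mul_le_of_le_one_left (norm_nonneg _) ?_
    rcases Real.sign_apply_eq (b z - b y) with h | h | h <;> rw [h] <;> norm_num
  rw [form, Complex.neg_im, him, integral_const_mul, ← Ioc_union_Ioc_eq_Ioc hy.1 hy.2,
    setIntegral_union (Ioc_disjoint_Ioc_of_le le_rfl) measurableSet_Ioc
      (hSi.mono_set (Ioc_subset_Ioc_right hy.2)) (hSi.mono_set (Ioc_subset_Ioc_left hy.1)), el, er]
  ring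

/-- If `b'' u` vanishes to order `1/2` at the critical point, the limiting form is an integral. -/
theorem form_eq_of_holder {b : ℝ → ℝ} (hb : IsShearFlow b) {k : ℝ} (hk : 1 ≤ k) {s : ℝ}
    (hs : s ^ 2 = 1) {y K : ℝ} {u : H1 k}
    (hK : ∀ z, ‖((deriv (deriv b) z : ℝ) : ℂ) * u.fn z / ((b z - b y : ℝ) : ℂ)‖ ≤
      K * invSqrt (z - y)) (v : H1 k) :
    form (flowCoeff b) (logW b s 0 (b y)) u v =
      ∫ z in Ioc (-2 : ℝ) 2, ((deriv (deriv b) z : ℝ) : ℂ) * u.fn z / ((b z - b y : ℝ) : ℂ) *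
        conj (v.fn z) := by
  have hk0 : 0 < k := by linarith
  refine tendsto_nhds_unique (tendsto_form hb hk hs (b y) u v) ?_
  have ht : ∀ n : ℕ, (0 : ℝ) < 1 / ((n : ℝ) + 1) := fun n => by positivity
  have hc1 := hb.contDiff_deriv2.continuous
  have hc2 := hb.continuous
  have hc3 := u.continuous_fn hk0
  have hc4 := v.continuous_fn hk0
  have hconj : Continuous fun z => conj (v.fn z) := Complex.continuous_conj.comp hc4
  simp only [form_logW hk0 hb hs (ht _)]
  refine tendsto_integral_of_dominated_convergence (fun z => K * invSqrt (z - y) * ‖v‖) (fun n => ?_)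
    (((integrableOn_invSqrt y).const_mul K).mul_const _) (fun n => ?_) ?_
  · refine Continuous.aestronglyMeasurable (Continuous.div (by fun_prop) (by fun_prop) fun z =>
      denom_ne_zero hs (ht n) _)
  · filter_upwards [ae_restrict_of_ae (ae_ne y)] with z hz
    have hne : b z - b y ≠ 0 := sub_ne_zero.2 (hb.strictMono.injective.ne hz)
    have h1 := hK z
    have h2 := v.norm_fn_le' hk z
    have h3 := abs_le_norm_denom (b z - b y) (s * (1 / ((n : ℝ) + 1)))
    rw [norm_div, Complex.norm_real, Real.norm_eq_abs] at h1
    rw [← mul_assoc, norm_div, norm_mul, RCLike.norm_conj]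
    calc _ ≤ ‖((deriv (deriv b) z : ℝ) : ℂ) * u.fn z‖ * ‖v.fn z‖ / |b z - b y| := by
          have := abs_pos.2 hne
          gcongr
      _ = ‖((deriv (deriv b) z : ℝ) : ℂ) * u.fn z‖ / |b z - b y| * ‖v.fn z‖ := by ring
      _ ≤ _ := by
          gcongr
          exact (norm_nonneg _).trans (hK z)
  · filter_upwards [ae_restrict_of_ae (ae_ne y)] with z hz
    have hne : b z - b y ≠ 0 := sub_ne_zero.2 (hb.strictMono.injective.ne hz)
    have hneC : ((b z - b y : ℝ) : ℂ) ≠ 0 := by exact_mod_cast hne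
    have t1 : Filter.Tendsto (fun n : ℕ => ((b z - b y : ℝ) : ℂ) +
        Complex.I * ((s * (1 / ((n : ℝ) + 1)) : ℝ) : ℂ)) Filter.atTop
        (nhds ((b z - b y : ℝ) : ℂ)) := by
      have h1 := (tendsto_one_div_add_atTop_nhds_zero_nat (𝕜 := ℝ)).const_mul s
      have h2 := (Complex.continuous_ofReal.tendsto _).comp h1
      have h3 := (h2.const_mul Complex.I).const_add ((b z - b y : ℝ) : ℂ)
      simpa [Function.comp_def] using h3
    have t2 := (tendsto_const_nhds (x := ((deriv (deriv b) z : ℝ) : ℂ) *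
      (u.fn z * conj (v.fn z))) (f := Filter.atTop)).div t1 hneC
    have e : ((deriv (deriv b) z : ℝ) : ℂ) * u.fn z / ((b z - b y : ℝ) : ℂ) * conj (v.fn z) =
        ((deriv (deriv b) z : ℝ) : ℂ) * (u.fn z * conj (v.fn z)) / ((b z - b y : ℝ) : ℂ) := by ring
    rw [e]
    exact t2

/-- A solution of the limiting equation in the channel, with critical point `y`. -/
structure ChannelSol (b : ℝ → ℝ) (k : ℕ) (s y : ℝ) (φ : H1 (k : ℝ)) : Prop where
  flow : IsShearFlow b
  one_le : 1 ≤ k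
  sign : s ^ 2 = 1
  zero : ∀ z ∉ Ioo (0 : ℝ) 1, φ.fn z = 0
  inner_eq : ∀ η : H1 (k : ℝ), (∀ z ∉ Ioo (0 : ℝ) 1, η.fn z = 0) →
    ⟪η, φ⟫_ℂ = -form (flowCoeff b) (logW b s 0 (b y)) φ η

/-- The cutoff lets `φ` extend beyond the channel, so `φ` is replaced by `-stream U` on `[0, 1]`
extended by zero; this stays in `H¹` because `stream U` vanishes at both ends. The form depends only
on the product of its arguments, so tests supported in the channel do not notice the change. -/
theorem LimitSol.exists_channelSol {b : ℝ → ℝ} {k : ℕ} {ψ : ℝ → ℝ} {C s y : ℝ}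
    {φ U : H1 (k : ℝ)} (h : LimitSol b k ψ C s (b y) φ U) :
    ∃ φ₀ : H1 (k : ℝ), ChannelSol b k s y φ₀ ∧ ∀ z ∈ Icc (0 : ℝ) 1, φ₀.fn z = -stream U z := by
  have hk := h.k_pos
  have hp := isPrim_stream h.one_le U
  set ζ : ℝ → ℂ := indicator (Ioc (0 : ℝ) 1) fun z => -streamDer U z with hζ
  have hm : MemLp ζ 2 volume :=
    (memLp_indicator_iff_restrict measurableSet_Ioc).2 (memLp_streamDer U 0 1).neg
  have hint : ∀ z ∈ Icc (0 : ℝ) 1, ∫ x in (0 : ℝ)..z, ζ x = -stream U z := fun z hz => by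
    have h1 := hp.sub_eq 0 z
    rw [stream_zero h.one_le, sub_zero] at h1
    rw [h1, ← intervalIntegral.integral_neg]
    refine intervalIntegral.integral_congr_ae (Filter.Eventually.of_forall fun x hx => ?_)
    rw [uIoc_of_le hz.1] at hx
    have hx' : x ∈ Ioc (0 : ℝ) 1 := ⟨hx.1, hx.2.trans hz.2⟩
    rw [hζ, indicator_of_mem hx']
  obtain ⟨φ₀, h1, h2, h3⟩ := H1.exists_bump hk hm (p := 0) (q := 1)
    (fun z hz => indicator_of_notMem hz _)
    (by rw [hint 1 (by simp), stream_one h.one_le, neg_zero])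
  have hin : ∀ z ∈ Icc (0 : ℝ) 1, φ₀.fn z = -stream U z := fun z hz => by rw [h2, hint z hz]
  have hout : ∀ z ∉ Ioo (0 : ℝ) 1, φ₀.fn z = 0 := fun z hz => by
    by_cases hz' : z ∈ Icc (0 : ℝ) 1
    · rw [hin z hz']
      rcases eq_or_lt_of_le hz'.1 with h0 | h0
      · rw [← h0, stream_zero h.one_le, neg_zero]
      · rcases eq_or_lt_of_le hz'.2 with h4 | h4
        · rw [h4, stream_one h.one_le, neg_zero]
        · exact absurd ⟨h0, h4⟩ hz
    · exact h3 z hz'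
  refine ⟨φ₀, ⟨h.flow, h.one_le, h.sign, hout, fun η hη => ?_⟩, hin⟩
  have hη' : ∀ z ∉ Icc (0 : ℝ) 1, η.fn z = 0 := fun z hz => hη z fun hc =>
    hz (Ioo_subset_Icc_self hc)
  have e1 := h.weak_eq zero_le_one η hη
  have e2 : form (flowCoeff b) (logW b s 0 (b y)) φ η =
      form (flowCoeff b) (logW b s 0 (b y)) φ₀ η := by
    refine form_congr h.flow h.one_le' h.sign _ fun z => ?_
    by_cases hz : z ∈ Ioo (0 : ℝ) 1
    · have hz' := Ioo_subset_Icc_self hz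
      rw [h.fn_eq_stream, h.eq_one z hz', hin z hz', Complex.ofReal_one, one_mul]
    · rw [hη z hz]; simp
  rw [← e2, ← e1, H1.inner_eq hk, integral_eq_Ioc_of_zero (p := 0) (q := 1),
    integral_eq_Ioc_of_zero (p := 0) (q := 1), ← integral_const_mul, ← integral_add,
    ← integral_neg]
  · refine integral_congr_ae ?_
    filter_upwards [ae_restrict_mem measurableSet_Ioc, ae_restrict_of_ae h1] with z hz hz1
    rw [hz1, hζ, indicator_of_mem hz, hin z (Ioc_subset_Icc_self hz)]
    push_cast; ring
  · refine Integrable.const_mul ?_ _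
    exact ((Complex.continuous_conj.comp (η.continuous_fn hk)).mul
      (φ₀.continuous_fn hk)).integrableOn_Ioc
  · refine (MemLp.integrable_mul (p := 2) (q := 2) ?_ φ₀.memLp_der).integrableOn
    exact Complex.conjLIE.toContinuousLinearEquiv.toContinuousLinearMap.comp_memLp' η.memLp_der
  · filter_upwards [η.der_ae_zero hk hη'] with z hz hz'
    rw [hz hz', map_zero, zero_mul]
  · filter_upwards with z hz'
    rw [hη' z hz', map_zero, zero_mul]

theorem norm_div_le_invSqrt {x : ℂ} {D d A c : ℝ} (hc : 0 < c) (hA : 0 ≤ A)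
    (hx : ‖x‖ ≤ A * √|d|) (hD : c * |d| ≤ |D|) : ‖x / (D : ℂ)‖ ≤ A / c * invSqrt d := by
  rcases eq_or_ne d 0 with h0 | h0
  · have : x = 0 := by
      rw [h0, abs_zero, Real.sqrt_zero, mul_zero] at hx
      exact norm_le_zero_iff.1 hx
    rw [this, zero_div, norm_zero]
    exact mul_nonneg (by positivity) (invSqrt_nonneg _)
  · have hd : 0 < |d| := abs_pos.2 h0
    have e : invSqrt d = √|d| / |d| := by
      rw [invSqrt, Real.rpow_neg hd.le, ← Real.sqrt_eq_rpow, eq_div_iff hd.ne',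
        inv_mul_eq_div, Real.div_sqrt]
    rw [norm_div, Complex.norm_real, Real.norm_eq_abs, e]
    calc ‖x‖ / |D| ≤ A * √|d| / (c * |d|) := by gcongr
      _ = _ := by field_simp

theorem abs_sub_le_of_deriv_bound {f : ℝ → ℝ} (hf : ContDiff ℝ ∞ f) {N : ℝ}
    (hN : ∀ z ∈ Icc (0 : ℝ) 1, |deriv f z| ≤ N) {x y : ℝ} (hx : x ∈ Icc (0 : ℝ) 1)
    (hy : y ∈ Icc (0 : ℝ) 1) : |f y - f x| ≤ N * |y - x| :=
  (convex_Icc 0 1).norm_image_sub_le_of_norm_deriv_le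
    (fun z _ => (hf.differentiable (by simp)) z) hN hx hy

namespace ChannelSol

variable {b : ℝ → ℝ} {k : ℕ} {s y : ℝ} {φ : H1 (k : ℝ)}

theorem k_pos (h : ChannelSol b k s y φ) : (0 : ℝ) < k := by exact_mod_cast h.one_le

theorem one_le' (h : ChannelSol b k s y φ) : (1 : ℝ) ≤ k := by exact_mod_cast h.one_le

/-- The solution or the vorticity gradient vanishes at the critical point. -/
theorem zero_or (h : ChannelSol b k s y φ) :
    φ.fn y = 0 ∨ y ∈ Icc (0 : ℝ) 1 ∧ deriv (deriv b) y = 0 := by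
  by_cases hy : y ∈ Ioo (0 : ℝ) 1
  · have hy2 : y ∈ Icc (-2 : ℝ) 2 := ⟨by linarith [hy.1], by linarith [hy.2]⟩
    have h1 := form_self_im h.flow h.one_le' h.sign hy2 φ
    -- Tested with `φ` itself, the left side is `‖φ‖²`, which is real; so the contribution of the
    -- critical point to the imaginary part must vanish.
    have h2 := congrArg Complex.im (h.inner_eq φ h.zero)
    rw [inner_self_eq_norm_sq_to_K, Complex.neg_im, h1, neg_neg] at h2
    have h3 : (((‖φ‖ : ℝ) : ℂ) ^ 2).im = 0 := by norm_cast
    have h4 : s * Real.pi * (flowCoeff b y * ‖φ.fn y‖ ^ 2) = 0 := h2.symm.trans h3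
    have hs : s ≠ 0 := fun h0 => by have := h.sign; rw [h0] at this; norm_num at this
    have h5 := (mul_eq_zero.1 h4).resolve_left (mul_ne_zero hs Real.pi_ne_zero)
    rcases mul_eq_zero.1 h5 with h6 | h6
    · refine Or.inr ⟨Ioo_subset_Icc_self hy, ?_⟩
      exact (div_eq_zero_iff.1 h6).resolve_right (h.flow.deriv_pos y).ne'
    · exact Or.inl (norm_eq_zero.1 (pow_eq_zero_iff (by norm_num) |>.1 h6))
  · exact Or.inl (h.zero y hy)

/-- The vorticity `b'' φ / (b - w)` of the solution. -/
def vort (b : ℝ → ℝ) (y : ℝ) (φ : H1 (k : ℝ)) (z : ℝ) : ℂ :=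
  ((deriv (deriv b) z : ℝ) : ℂ) * φ.fn z / ((b z - b y : ℝ) : ℂ)

theorem vort_eq_zero (h : ChannelSol b k s y φ) {z : ℝ} (hz : z ∉ Ioo (0 : ℝ) 1) :
    vort b y φ z = 0 := by
  rw [vort, h.zero z hz, mul_zero, zero_div]

/-- First stage of the bootstrap. Either `φ` vanishes at `y` and is Hölder of order `1/2`, or `b''`
vanishes there and is Lipschitz on the channel. Both give a numerator of order `√|z - y|` over a
denominator at least `c |z - y|`. -/
theorem exists_vort_le_invSqrt (h : ChannelSol b k s y φ) :
    ∃ K, 0 ≤ K ∧ ∀ z, ‖vort b y φ z‖ ≤ K * invSqrt (z - y) := by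
  obtain ⟨c, hc, hcb⟩ := h.flow.deriv_gt
  have hcd := h.flow.contDiff_deriv2
  obtain ⟨N, hN0, hN⟩ := exists_bound_Icc hcd.continuous 0 1
  obtain ⟨N', hN0', hN'⟩ := exists_bound_Icc (hcd.continuous_deriv (by simp)) 0 1
  have hout : ∀ (K : ℝ), 0 ≤ K → ∀ z ∉ Ioo (0 : ℝ) 1, ‖vort b y φ z‖ ≤ K * invSqrt (z - y) :=
    fun K hK z hz => by
      rw [h.vort_eq_zero hz, norm_zero]
      exact mul_nonneg hK (invSqrt_nonneg _)
  rcases h.zero_or with h0 | ⟨hy, h0⟩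
  · refine ⟨N * ‖φ‖ / c, by positivity, fun z => ?_⟩
    by_cases hz : z ∈ Ioo (0 : ℝ) 1
    · refine norm_div_le_invSqrt hc (by positivity) ?_ (h.flow.mul_abs_sub_le hcb y z)
      have h1 := φ.norm_fn_sub_le h.k_pos y z
      rw [h0, sub_zero] at h1
      rw [norm_mul, Complex.norm_real, Real.norm_eq_abs]
      calc _ ≤ N * (√|z - y| * ‖φ‖) := by gcongr; exact hN z (Ioo_subset_Icc_self hz)
        _ = _ := by ring
    · exact hout _ (by positivity) z hz
  · refine ⟨N' * ‖φ‖ / c, by positivity, fun z => ?_⟩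
    by_cases hz : z ∈ Ioo (0 : ℝ) 1
    · refine norm_div_le_invSqrt hc (by positivity) ?_ (h.flow.mul_abs_sub_le hcb y z)
      have h1 := abs_sub_le_of_deriv_bound hcd hN' hy (Ioo_subset_Icc_self hz)
      rw [h0, sub_zero] at h1
      have h2 : |z - y| ≤ √|z - y| := by
        refine Real.le_sqrt_of_sq_le ?_
        have : |z - y| ≤ 1 := abs_le.2 ⟨by linarith [hz.1, hy.2], by linarith [hz.2, hy.1]⟩
        nlinarith [abs_nonneg (z - y)]
      rw [norm_mul, Complex.norm_real, Real.norm_eq_abs]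
      calc _ ≤ N' * √|z - y| * ‖φ‖ := by
            gcongr
            · exact h1.trans (by gcongr)
            · exact φ.norm_fn_le' h.one_le' z
        _ = _ := by ring
    · exact hout _ (by positivity) z hz

theorem measurable_vort (h : ChannelSol b k s y φ) : Measurable (vort b y φ) := by
  have h1 := h.flow.contDiff_deriv2.continuous.measurable
  have h2 := h.flow.continuous.measurable
  have h3 := (φ.continuous_fn h.k_pos).measurable
  unfold vort
  fun_prop

theorem integrableOn_vort (h : ChannelSol b k s y φ) :
    IntegrableOn (vort b y φ) (Ioc (-2 : ℝ) 2) := by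
  obtain ⟨K, hK, hv⟩ := h.exists_vort_le_invSqrt
  exact Integrable.mono' ((integrableOn_invSqrt y).const_mul K)
    h.measurable_vort.aestronglyMeasurable (Filter.Eventually.of_forall hv)

theorem inner_eq_integral (h : ChannelSol b k s y φ) (η : H1 (k : ℝ))
    (hη : ∀ z ∉ Ioo (0 : ℝ) 1, η.fn z = 0) :
    ⟪η, φ⟫_ℂ = -∫ z in Ioo (0 : ℝ) 1, vort b y φ z * conj (η.fn z) := by
  obtain ⟨K, hK, hv⟩ := h.exists_vort_le_invSqrt
  rw [h.inner_eq η hη, form_eq_of_holder h.flow h.one_le' h.sign hv]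
  congr 1
  refine setIntegral_eq_of_subset_of_forall_sdiff_eq_zero measurableSet_Ioc (fun z hz =>
    ⟨by linarith [hz.1], by linarith [hz.2]⟩) fun z hz => ?_
  rw [hη z hz.2, map_zero, mul_zero]

/-- The equation is tested with `greenH1 k x`. As `φ` vanishes at `0` and `1`, the correction terms
drop out and the pairing is the value at `x`. -/
theorem fn_eq_integral (h : ChannelSol b k s y φ) {x : ℝ} (hx : x ∈ Icc (0 : ℝ) 1) :
    φ.fn x = -∫ z in Ioo (0 : ℝ) 1, (dirichletGreen k x z : ℂ) * vort b y φ z := by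
  have h1 := h.inner_eq_integral (greenH1 k x) fun z hz => by
    rw [greenH1_fn h.one_le, extGreen_one_eq_zero h.one_le hx hz, Complex.ofReal_zero]
  have h2 : ⟪greenH1 k x, φ⟫_ℂ = φ.fn x := by
    rw [greenH1, inner_sub_left, inner_sub_left, inner_smul_left, inner_smul_left,
      ← H1.fn_eq_inner, ← H1.fn_eq_inner, ← H1.fn_eq_inner, h.zero 0 (by simp),
      h.zero 1 (by simp)]
    simp
  rw [← h2, h1]
  congr 1
  refine setIntegral_congr_fun measurableSet_Ioo fun z hz => ?_
  rw [greenH1_fn h.one_le, extGreen_eq_dirichletGreen h.one_le rfl (Ioo_subset_Icc_self hz),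
    Complex.conj_ofReal, mul_comm]

/-- Second stage of the bootstrap: the Green function is Lipschitz in `x` uniformly in `z`, and the
vorticity is integrable by the first stage. -/
theorem exists_lipschitz (h : ChannelSol b k s y φ) :
    ∃ N, 0 ≤ N ∧ ∀ x ∈ Icc (0 : ℝ) 1, ∀ x' ∈ Icc (0 : ℝ) 1,
      ‖φ.fn x' - φ.fn x‖ ≤ N * |x' - x| := by
  have hk := h.k_pos
  have s0 : ContDiff ℝ ∞ (sigma₀ k) := by unfold sigma₀; fun_prop
  have s1 : ContDiff ℝ ∞ (sigma₁ k) := by unfold sigma₁; fun_prop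
  obtain ⟨N₀, hN₀, h0⟩ := exists_bound_Icc (s0.continuous_deriv (by simp)) 0 1
  obtain ⟨N₁, hN₁, h1⟩ := exists_bound_Icc (s1.continuous_deriv (by simp)) 0 1
  have hker : ∀ x z, |expKer k x z| ≤ 1 := fun x z => by
    have h1 : Real.exp (-k * |z - x|) ≤ 1 := Real.exp_le_one_iff.2 (by
      have := mul_nonneg hk.le (abs_nonneg (z - x)); linarith)
    rw [expKer, abs_of_nonneg (by positivity), div_le_one (by positivity)]
    linarith [h.one_le']
  have hG : ∀ x ∈ Icc (0 : ℝ) 1, ∀ x' ∈ Icc (0 : ℝ) 1, ∀ z ∈ Ioo (0 : ℝ) 1,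
      |dirichletGreen k x' z - dirichletGreen k x z| ≤ (1 + N₀ + N₁) * |x' - x| :=
    fun x hx x' hx' z hz => by
    have hz' := Ioo_subset_Icc_self hz
    rw [← extGreen_eq_dirichletGreen h.one_le (Ψ := fun _ => 1) rfl hz',
      ← extGreen_eq_dirichletGreen h.one_le (Ψ := fun _ => 1) rfl hz']
    have e : extGreen k (fun _ => 1) x' z - extGreen k (fun _ => 1) x z =
        (expKer k x' z - expKer k x z) - (sigma₀ k x' - sigma₀ k x) * expKer k 0 z -
          (sigma₁ k x' - sigma₁ k x) * expKer k 1 z := by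
      simp only [extGreen, expKer, sigma₀, sigma₁, sub_zero]; ring
    rw [e]
    calc _ ≤ |expKer k x' z - expKer k x z| + |sigma₀ k x' - sigma₀ k x| * |expKer k 0 z| +
          |sigma₁ k x' - sigma₁ k x| * |expKer k 1 z| := by
          rw [← abs_mul, ← abs_mul]
          exact (abs_sub _ _).trans (by gcongr; exact abs_sub _ _)
      _ ≤ |x' - x| + N₀ * |x' - x| * 1 + N₁ * |x' - x| * 1 := by
          have a1 : |expKer k x' z - expKer k x z| ≤ |x' - x| := by
            simpa using abs_expKer_sub_le hk x' x z z
          have a2 := abs_sub_le_of_deriv_bound s0 h0 hx hx'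
          have a3 := abs_sub_le_of_deriv_bound s1 h1 hx hx'
          exact add_le_add (add_le_add a1 (mul_le_mul a2 (hker _ _) (abs_nonneg _) (by positivity)))
            (mul_le_mul a3 (hker _ _) (abs_nonneg _) (by positivity))
      _ = _ := by ring
  have hi : IntegrableOn (vort b y φ) (Ioo (0 : ℝ) 1) := h.integrableOn_vort.mono_set fun z hz =>
    ⟨by linarith [hz.1], by linarith [hz.2]⟩
  have hgi : ∀ x ∈ Icc (0 : ℝ) 1, IntegrableOn (fun z =>
      (dirichletGreen k x z : ℂ) * vort b y φ z) (Ioo (0 : ℝ) 1) := fun x hx => by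
    have hc : ∀ z ∈ Ioo (0 : ℝ) 1, (greenH1 k x).fn z * vort b y φ z =
        (dirichletGreen k x z : ℂ) * vort b y φ z := fun z hz => by
      rw [greenH1_fn h.one_le, extGreen_eq_dirichletGreen h.one_le rfl (Ioo_subset_Icc_self hz)]
    refine IntegrableOn.congr_fun ?_ hc measurableSet_Ioo
    exact hi.bdd_mul ((greenH1 k x).continuous_fn hk).aestronglyMeasurable
      (Filter.Eventually.of_forall ((greenH1 k x).norm_fn_le' h.one_le'))
  refine ⟨(1 + N₀ + N₁) * ∫ z in Ioo (0 : ℝ) 1, ‖vort b y φ z‖,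
    mul_nonneg (by positivity) (integral_nonneg fun _ => norm_nonneg _), fun x hx x' hx' => ?_⟩
  rw [h.fn_eq_integral hx, h.fn_eq_integral hx', neg_sub_neg, ← integral_sub (hgi x hx) (hgi x' hx')]
  calc _ ≤ ∫ z in Ioo (0 : ℝ) 1, (1 + N₀ + N₁) * |x' - x| * ‖vort b y φ z‖ := by
        refine norm_integral_le_of_norm_le (hi.norm.const_mul _) ?_
        filter_upwards [ae_restrict_mem measurableSet_Ioo] with z hz
        rw [← sub_mul, norm_mul, ← Complex.ofReal_sub, Complex.norm_real, Real.norm_eq_abs,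
          abs_sub_comm]
        gcongr
        exact hG x hx x' hx' z hz
    _ = _ := by rw [integral_const_mul]; ring

/-- Last stage of the bootstrap: with `φ` Lipschitz, `b'' φ` is of order `|z - y|`. Boundedness puts
the vorticity in `L²`, as an eigenfunction requires. -/
theorem exists_vort_bound (h : ChannelSol b k s y φ) (hy : y ∈ Icc (0 : ℝ) 1) :
    ∃ K, ∀ z, ‖vort b y φ z‖ ≤ K := by
  obtain ⟨c, hc, hcb⟩ := h.flow.deriv_gt
  have hcd := h.flow.contDiff_deriv2
  obtain ⟨N, hN0, hN⟩ := exists_bound_Icc hcd.continuous 0 1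
  obtain ⟨N', hN0', hN'⟩ := exists_bound_Icc (hcd.continuous_deriv (by simp)) 0 1
  obtain ⟨P, hP0, hP⟩ := h.exists_lipschitz
  have key : ∀ A : ℝ, 0 ≤ A → (∀ z ∈ Ioo (0 : ℝ) 1,
      ‖((deriv (deriv b) z : ℝ) : ℂ) * φ.fn z‖ ≤ A * |z - y|) →
      ∃ K, ∀ z, ‖vort b y φ z‖ ≤ K := fun A hA hAz => by
    refine ⟨A / c, fun z => ?_⟩
    by_cases hz : z ∈ Ioo (0 : ℝ) 1
    · rw [vort, norm_div, Complex.norm_real, Real.norm_eq_abs]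
      rcases eq_or_ne z y with rfl | hne
      -- At the critical point the quotient takes the default value zero.
      · rw [sub_self, abs_zero, div_zero]; positivity
      · have hd : 0 < |z - y| := abs_pos.2 (sub_ne_zero.2 hne)
        calc _ ≤ A * |z - y| / (c * |z - y|) := by
              gcongr
              · exact hAz z hz
              · exact h.flow.mul_abs_sub_le hcb y z
          _ = A / c := by field_simp
    · rw [h.vort_eq_zero hz, norm_zero]; positivity
  rcases h.zero_or with h0 | ⟨-, h0⟩
  · refine key (N * P) (by positivity) fun z hz => ?_
    have hz' := Ioo_subset_Icc_self hz
    have h1 := hP y hy z hz'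
    rw [h0, sub_zero] at h1
    rw [norm_mul, Complex.norm_real, Real.norm_eq_abs, mul_assoc]
    gcongr
    exact hN z hz'
  · refine key (N' * ‖φ‖) (by positivity) fun z hz => ?_
    have h1 := abs_sub_le_of_deriv_bound hcd hN' hy (Ioo_subset_Icc_self hz)
    rw [h0, sub_zero] at h1
    rw [norm_mul, Complex.norm_real, Real.norm_eq_abs]
    calc _ ≤ N' * |z - y| * ‖φ‖ := by
          gcongr
          exact φ.norm_fn_le' h.one_le' z
      _ = _ := by ring

/-- Without embedded eigenvalues there is no solution with critical point in the channel. -/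
theorem fn_eq_zero_of_mem (h : ChannelSol b k s y φ) (hL : NoEmbeddedEigenvalue b k)
    (hy : y ∈ Icc (0 : ℝ) 1) (x : ℝ) : φ.fn x = 0 := by
  obtain ⟨K, hK⟩ := h.exists_vort_bound hy
  have hm : MemLp (vort b y φ) 2 (volume.restrict (Ioo (0 : ℝ) 1)) :=
    MemLp.of_bound h.measurable_vort.aestronglyMeasurable K (Filter.Eventually.of_forall hK)
  have hmem : b y ∈ Icc (b 0) (b 1) :=
    ⟨h.flow.strictMono.monotone hy.1, h.flow.strictMono.monotone hy.2⟩
  have h0 : vort b y φ =ᵐ[volume.restrict (Ioo (0 : ℝ) 1)] 0 := by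
    by_contra hne
    -- The vorticity `ω` is the eigenfunction: `(b - b y) ω = b'' φ` and `φ = -∫ G ω`, so `b ω + b''
    -- ∫ G ω = b(y) ω`.
    refine hL (b y) hmem ⟨vort b y φ, hm, hne, ?_⟩
    filter_upwards [ae_restrict_mem measurableSet_Ioo, ae_restrict_of_ae (ae_ne y)] with z hz hzy
    have h1 := h.fn_eq_integral (Ioo_subset_Icc_self hz)
    have hd : ((b z - b y : ℝ) : ℂ) ≠ 0 := by
      exact_mod_cast sub_ne_zero.2 (h.flow.strictMono.injective.ne hzy)
    have h2 : ((b z - b y : ℝ) : ℂ) * vort b y φ z = deriv (deriv b) z * φ.fn z := by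
      rw [vort, mul_div_cancel₀ _ hd]
    rw [linearizedOp, ← neg_eq_iff_eq_neg.2 h1, mul_neg, ← h2]
    push_cast; ring
  by_cases hx : x ∈ Icc (0 : ℝ) 1
  · rw [h.fn_eq_integral hx, integral_eq_zero_of_ae, neg_zero]
    filter_upwards [h0] with z hz
    rw [hz]; simp
  · exact h.zero x fun hc => hx (Ioo_subset_Icc_self hc)

end ChannelSol

/-- A function with continuous derivative on `[0, 1]` has an extension with primitive. -/
theorem exists_isPrim_of_hasDerivAt_Icc {f g : ℝ → ℝ}
    (h : ∀ z ∈ Icc (0 : ℝ) 1, HasDerivAt f (g z) z) (hg : ContinuousOn g (Icc (0 : ℝ) 1)) :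
    ∃ F G : ℝ → ℂ, IsPrim F G ∧ (∀ z ∈ Icc (0 : ℝ) 1, F z = f z) ∧
      ∀ z ∈ Ioc (0 : ℝ) 1, G z = g z := by
  set G : ℝ → ℂ := indicator (Ioc (0 : ℝ) 1) fun z => (g z : ℂ) with hG
  have hgc : ContinuousOn (fun z => (g z : ℂ)) (Icc (0 : ℝ) 1) :=
    Complex.continuous_ofReal.comp_continuousOn hg
  have hi : IntegrableOn (fun z => (g z : ℂ)) (Ioc (0 : ℝ) 1) :=
    (hgc.integrableOn_Icc).mono_set Ioc_subset_Icc_self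
  have hl : LocallyIntegrable G :=
    ((integrable_indicator_iff measurableSet_Ioc).2 hi).locallyIntegrable
  have hp := IsPrim.integral hl 0
  refine ⟨fun z => f 0 + ∫ x in (0 : ℝ)..z, G x, G, ⟨hl, fun x y => ?_⟩, fun z hz => ?_,
    fun z hz => indicator_of_mem hz _⟩
  · rw [add_sub_add_left_eq_sub]; exact hp.sub_eq x y
  · have e : ∫ x in (0 : ℝ)..z, G x = ∫ x in (0 : ℝ)..z, (g x : ℂ) := by
      refine intervalIntegral.integral_congr_ae (Filter.Eventually.of_forall fun x hx => ?_)
      rw [uIoc_of_le hz.1] at hx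
      have hx' : x ∈ Ioc (0 : ℝ) 1 := ⟨hx.1, hx.2.trans hz.2⟩
      rw [hG, indicator_of_mem hx']
    have hsub : uIcc 0 z ⊆ Icc (0 : ℝ) 1 := by
      rw [uIcc_of_le hz.1]; exact Icc_subset_Icc_right hz.2
    have e2 := intervalIntegral.integral_eq_sub_of_hasDerivAt (f := fun z => (f z : ℂ))
      (a := 0) (b := z) (fun x hx => (h x (hsub hx)).ofReal_comp)
      ((hgc.mono hsub).intervalIntegrable)
    simp only [e, e2]; ring

namespace ChannelSol

variable {b : ℝ → ℝ} {k : ℕ} {s y : ℝ} {φ : H1 (k : ℝ)}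

/-- There is no solution with critical point outside the channel. -/
theorem fn_eq_zero_of_notMem (h : ChannelSol b k s y φ) (hy : y ∉ Icc (0 : ℝ) 1) (x : ℝ) :
    φ.fn x = 0 := by
  have hk := h.k_pos
  have hne : ∀ z ∈ Icc (0 : ℝ) 1, b z - b y ≠ 0 := fun z hz =>
    sub_ne_zero.2 (h.flow.strictMono.injective.ne fun hc => hy (hc ▸ hz))
  have hb1 : Continuous (deriv b) := h.flow.contDiff_deriv.continuous
  have hb2 : Continuous (deriv (deriv b)) := h.flow.contDiff_deriv2.continuous
  have hb0 := h.flow.continuous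
  -- Rayleigh's device. With `F = b' / (b - b y)`, regular on the channel, one has `|φ'|² + b'' |φ|²
  -- / (b - b y) = |φ' - F φ|² + (F |φ|²)'`. The last term integrates to zero, and the equation
  -- becomes `k² ∫ |φ|² + ∫ |φ' - F φ|² = 0`.
  obtain ⟨F, G, hp, hF, hG⟩ := exists_isPrim_of_hasDerivAt_Icc
    (f := fun z => deriv b z / (b z - b y))
    (g := fun z => (deriv (deriv b) z * (b z - b y) - deriv b z * deriv b z) / (b z - b y) ^ 2)
    (fun z hz => by
      have d1 := ((h.flow.contDiff_deriv.differentiable (by simp)) z).hasDerivAt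
      have d0 := (h.flow.differentiable z).hasDerivAt.sub_const (b y)
      exact d1.div d0 (hne z hz))
    (ContinuousOn.div (by fun_prop) (by fun_prop) fun z hz => pow_ne_zero 2 (hne z hz))
  have hφ := φ.isPrim hk
  have hQ := hp.mul (hφ.mul hφ.conj)
  have hQ0 := hQ.sub_eq 0 1
  rw [h.zero 0 (by simp), h.zero 1 (by simp), zero_mul, mul_zero, mul_zero, sub_self,
    intervalIntegral.integral_of_le zero_le_one] at hQ0
  have iQ := (hQ.intervalIntegrable 0 1).1
  have iA : IntegrableOn (fun z => conj (φ.der z) * φ.der z) (Ioc (0 : ℝ) 1) := by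
    refine (MemLp.integrable_mul (p := 2) (q := 2) ?_ φ.memLp_der).integrableOn
    exact Complex.conjLIE.toContinuousLinearEquiv.toContinuousLinearMap.comp_memLp' φ.memLp_der
  have hv : IntegrableOn (vort b y φ) (Ioc (0 : ℝ) 1) := h.integrableOn_vort.mono_set fun z hz =>
    ⟨by linarith [hz.1], by linarith [hz.2]⟩
  have iB : IntegrableOn (fun z => vort b y φ z * conj (φ.fn z)) (Ioc (0 : ℝ) 1) := by
    refine hv.mul_bdd (c := ‖φ‖)
      (Complex.continuous_conj.comp (φ.continuous_fn hk)).aestronglyMeasurable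
      (Filter.Eventually.of_forall fun z => ?_)
    rw [RCLike.norm_conj]
    exact φ.norm_fn_le' h.one_le' z
  have key : ∀ z ∈ Ioc (0 : ℝ) 1, conj (φ.der z) * φ.der z + vort b y φ z * conj (φ.fn z) -
      (G z * (φ.fn z * conj (φ.fn z)) +
        F z * (φ.der z * conj (φ.fn z) + φ.fn z * conj (φ.der z))) =
      ((‖φ.der z - F z * φ.fn z‖ ^ 2 : ℝ) : ℂ) := fun z hz => by
    have hz' := Ioc_subset_Icc_self hz
    have hd : ((b z : ℂ) - b y) ≠ 0 := by exact_mod_cast hne z hz'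
    rw [← Complex.normSq_eq_norm_sq, ← Complex.mul_conj, hF z hz', hG z hz, vort]
    simp only [map_sub, map_mul, Complex.conj_ofReal]
    push_cast
    field_simp
    ring
  have e1 := h.inner_eq_integral φ h.zero
  have hz' : ∀ z ∉ Icc (0 : ℝ) 1, φ.fn z = 0 := fun z hz => h.zero z fun hc =>
    hz (Ioo_subset_Icc_self hc)
  have e2 := H1.inner_eq hk φ φ
  rw [e1, integral_eq_Ioc_of_zero (f := fun x => conj (φ.der x) * φ.der x) (p := 0) (q := 1)
    (by filter_upwards [φ.der_ae_zero hk hz'] with z h1 h2; rw [h1 h2, map_zero, zero_mul]),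
    ← integral_Ioc_eq_integral_Ioo] at e2
  have e3 : ∫ z in Ioc (0 : ℝ) 1, ((‖φ.der z - F z * φ.fn z‖ ^ 2 : ℝ) : ℂ) =
      (∫ z in Ioc (0 : ℝ) 1, conj (φ.der z) * φ.der z) +
        ∫ z in Ioc (0 : ℝ) 1, vort b y φ z * conj (φ.fn z) := by
    have s1 := integral_sub (iA.add iB) iQ
    simp only [Pi.add_apply] at s1
    rw [← setIntegral_congr_fun measurableSet_Ioc key, s1, ← hQ0, sub_zero]
    exact integral_add iA iB
  have e4 : ∫ z, conj (φ.fn z) * φ.fn z = ((∫ z, ‖φ.fn z‖ ^ 2 : ℝ) : ℂ) := by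
    rw [← integral_complex_ofReal]
    congr 1; ext z
    rw [mul_comm, Complex.mul_conj, Complex.normSq_eq_norm_sq]
  have e5 : (∫ z in Ioc (0 : ℝ) 1, ‖φ.der z - F z * φ.fn z‖ ^ 2) =
      -((k : ℝ) ^ 2 * ∫ z, ‖φ.fn z‖ ^ 2) := by
    refine Complex.ofReal_injective ?_
    rw [← integral_complex_ofReal, e3]
    rw [e4] at e2
    push_cast at e2 ⊢
    linear_combination -e2
  have p1 : 0 ≤ ∫ z in Ioc (0 : ℝ) 1, ‖φ.der z - F z * φ.fn z‖ ^ 2 :=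
    integral_nonneg fun z => by positivity
  have p2 : 0 ≤ ∫ z, ‖φ.fn z‖ ^ 2 := integral_nonneg fun z => by positivity
  have p3 : ∫ z, ‖φ.fn z‖ ^ 2 = 0 := by
    have hk2 : 0 < (k : ℝ) ^ 2 := by positivity
    nlinarith
  rw [integral_eq_zero_iff_of_nonneg (fun z => by positivity) (memLp_two_norm (φ.memLp_fn hk))] at p3
  have hc : Continuous fun z => ‖φ.fn z‖ ^ 2 := by
    have := φ.continuous_fn hk
    fun_prop
  have p4 := (hc.ae_eq_iff_eq volume continuous_zero).1 p3
  simpa using congrFun p4 x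

end ChannelSol

/-! ### From the channel to the whole line: unique continuation. -/

namespace LimitSol

variable {b : ℝ → ℝ} {k : ℕ} {ψ : ℝ → ℝ} {C s w : ℝ} {φ U : H1 (k : ℝ)}

theorem stream_eq_zero_Icc (h : LimitSol b k ψ C s w φ U) (hL : NoEmbeddedEigenvalue b k) :
    ∀ z ∈ Icc (0 : ℝ) 1, stream U z = 0 := fun z hz => by
  obtain ⟨y, rfl⟩ := h.flow.surjective w
  obtain ⟨φ₀, h0, h1⟩ := h.exists_channelSol
  have h2 : φ₀.fn z = 0 := by
    by_cases hy : y ∈ Icc (0 : ℝ) 1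
    · exact h0.fn_eq_zero_of_mem hL hy z
    · exact h0.fn_eq_zero_of_notMem hy z
  rw [h1 z hz] at h2
  exact neg_eq_zero.1 h2

theorem isPrim_fn (h : LimitSol b k ψ C s w φ U) :
    IsPrim φ.fn fun y => -(((deriv ψ y : ℝ) : ℂ) * stream U y + ψ y * streamDer U y) := by
  have h1 := ((isPrim_ofReal h.smooth).mul (isPrim_stream h.one_le U)).const_mul (-1)
  have e : φ.fn = fun y => -1 * (ψ y * stream U y) := funext fun y => by
    rw [h.fn_eq_stream]; ring
  rw [e]
  simpa using h1

/-- The test function should be `V = stream U` itself, but `V` need not vanish at the ends of the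
enlarged interval. A constant added to the derivative on `(p, q]` restores mean zero. When `V = 0`
on `[p, q]`, the correction does not interact with `V`, and in the outer layers the test function
differs from `V` only by a constant. -/
theorem exists_test (h : LimitSol b k ψ C s w φ U) {p q τ : ℝ} (hpq : p < q) (hτ : 0 < τ) :
    ∃ (η : H1 (k : ℝ)) (c : ℂ), (∀ y ∉ Ioo (p - τ) (q + τ), η.fn y = 0) ∧
      (∀ᵐ z, z ∈ Ioc (p - τ) (q + τ) →
        η.der z = streamDer U z + c * indicator (Ioc p q) (fun _ => (1 : ℂ)) z) ∧
      (∀ y ∈ Icc (p - τ) p, η.fn y = stream U y - stream U (p - τ)) ∧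
      (∀ y ∈ Icc q (q + τ), η.fn y = stream U y - stream U (q + τ)) := by
  have hp := isPrim_stream h.one_le U
  have hsub : Ioc p q ⊆ Ioc (p - τ) (q + τ) := Ioc_subset_Ioc (by linarith) (by linarith)
  set c : ℂ := -(stream U (q + τ) - stream U (p - τ)) / ((q - p : ℝ) : ℂ) with hc
  set ζ₁ : ℝ → ℂ := indicator (Ioc (p - τ) (q + τ)) (streamDer U) with hζ₁
  set ζ₂ : ℝ → ℂ := indicator (Ioc p q) (fun _ => (1 : ℂ)) with hζ₂
  have m1 : MemLp ζ₁ 2 volume :=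
    (memLp_indicator_iff_restrict measurableSet_Ioc).2 (memLp_streamDer U _ _)
  have m2 : MemLp ζ₂ 2 volume :=
    (memLp_indicator_iff_restrict measurableSet_Ioc).2 (memLp_const _)
  have hm : MemLp (fun z => ζ₁ z + c * ζ₂ z) 2 volume := m1.add (m2.const_mul c)
  have hsupp : ∀ z ∉ Ioc (p - τ) (q + τ), ζ₁ z + c * ζ₂ z = 0 := fun z hz => by
    rw [hζ₁, hζ₂, indicator_of_notMem hz, indicator_of_notMem fun hc => hz (hsub hc)]
    simp
  have i1 := m1.locallyIntegrable'.intervalIntegrable'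
  have i2 := m2.locallyIntegrable'.intervalIntegrable'
  have I1 : ∀ x y, p - τ ≤ x → x ≤ y → y ≤ q + τ →
      ∫ z in x..y, ζ₁ z = stream U y - stream U x := fun x y hx hxy hy => by
    rw [hp.sub_eq]
    refine intervalIntegral.integral_congr_ae (Filter.Eventually.of_forall fun z hz => ?_)
    rw [uIoc_of_le hxy] at hz
    have hz' : z ∈ Ioc (p - τ) (q + τ) := ⟨by linarith [hz.1], by linarith [hz.2]⟩
    rw [hζ₁, indicator_of_mem hz']
  have I2 : ∀ x y, x ≤ y → (y ≤ p ∨ q ≤ x) → ∫ z in x..y, ζ₂ z = 0 := fun x y hxy hor => by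
    refine intervalIntegral.integral_zero_ae (Filter.Eventually.of_forall fun z hz => ?_)
    rw [uIoc_of_le hxy] at hz
    rw [hζ₂, indicator_of_notMem]
    rintro ⟨h1, h2⟩
    rcases hor with hor | hor <;> linarith [hz.1, hz.2]
  have I3 : ∫ z in p..q, ζ₂ z = ((q - p : ℝ) : ℂ) := by
    have : ∫ z in p..q, ζ₂ z = ∫ z in p..q, (1 : ℂ) := by
      refine intervalIntegral.integral_congr_ae (Filter.Eventually.of_forall fun z hz => ?_)
      rw [uIoc_of_le hpq.le] at hz
      rw [hζ₂, indicator_of_mem hz]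
    rw [this, intervalIntegral.integral_const]; simp
  have I : ∀ x y, ∫ z in x..y, (ζ₁ z + c * ζ₂ z) =
      (∫ z in x..y, ζ₁ z) + c * ∫ z in x..y, ζ₂ z := fun x y => by
    rw [intervalIntegral.integral_add (i1 _ _) ((i2 _ _).const_mul c),
      intervalIntegral.integral_const_mul]
  have hne : ((q - p : ℝ) : ℂ) ≠ 0 := by exact_mod_cast (sub_pos.2 hpq).ne'
  have h0 : ∫ z in (p - τ)..(q + τ), (ζ₁ z + c * ζ₂ z) = 0 := by
    rw [I, I1 _ _ le_rfl (by linarith) le_rfl,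
      ← intervalIntegral.integral_add_adjacent_intervals (i2 (p - τ) p) (i2 p (q + τ)),
      ← intervalIntegral.integral_add_adjacent_intervals (i2 p q) (i2 q (q + τ)),
      I2 _ _ (by linarith) (Or.inl le_rfl), I2 _ _ (by linarith) (Or.inr le_rfl), I3, hc, zero_add,
      add_zero, div_mul_cancel₀ _ hne]
    ring
  obtain ⟨η, h1, h2, h3⟩ := H1.exists_bump h.k_pos hm hsupp h0
  have hl : ∀ y ∈ Icc (p - τ) p, η.fn y = stream U y - stream U (p - τ) := fun y hy => by
    rw [h2, I, I1 _ _ le_rfl hy.1 (by linarith [hy.2]), I2 _ _ hy.1 (Or.inl hy.2), mul_zero,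
      add_zero]
  have hr : ∀ y ∈ Icc q (q + τ), η.fn y = stream U y - stream U (q + τ) := fun y hy => by
    have e := intervalIntegral.integral_add_adjacent_intervals
      ((i1 (p - τ) y).add ((i2 (p - τ) y).const_mul c))
      ((i1 y (q + τ)).add ((i2 y (q + τ)).const_mul c))
    rw [h0, I y, I1 _ _ (by linarith [hy.1]) hy.2 le_rfl, I2 _ _ hy.2 (Or.inr hy.1)] at e
    rw [h2, eq_neg_of_add_eq_zero_left e]
    ring
  refine ⟨η, c, fun y hy => ?_, ?_, hl, hr⟩
  · by_cases hy' : y ∈ Icc (p - τ) (q + τ)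
    · rcases eq_or_lt_of_le hy'.1 with h4 | h4
      · rw [← h4, hl _ ⟨le_rfl, by linarith⟩, sub_self]
      · rcases eq_or_lt_of_le hy'.2 with h5 | h5
        · rw [h5, hr _ ⟨by linarith, le_rfl⟩, sub_self]
        · exact absurd ⟨h4, h5⟩ hy
    · exact h3 y hy'
  · filter_upwards [h1] with z hz hz'
    rw [hz, hζ₁, indicator_of_mem hz']

end LimitSol

namespace LimitSol

variable {b : ℝ → ℝ} {k : ℕ} {ψ : ℝ → ℝ} {C s w : ℝ} {φ U : H1 (k : ℝ)}

/-- The energy of the stream function in `(P, Q]`. -/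
def energy (U : H1 (k : ℝ)) (P Q : ℝ) : ℝ := √(∫ z in Ioc P Q, ‖streamDer U z‖ ^ 2)

theorem energy_nonneg (U : H1 (k : ℝ)) (P Q : ℝ) : 0 ≤ energy U P Q := Real.sqrt_nonneg _

theorem norm_stream_sub_le (h : LimitSol b k ψ C s w φ U) {P Q x y : ℝ} (hx : P ≤ x) (hxy : x ≤ y)
    (hy : y ≤ Q) : ‖stream U y - stream U x‖ ≤ √(y - x) * energy U P Q := by
  refine ((isPrim_stream h.one_le U).norm_sub_le hxy (memLp_streamDer U x y)).trans ?_
  refine mul_le_mul_of_nonneg_left (Real.sqrt_le_sqrt ?_) (Real.sqrt_nonneg _)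
  refine setIntegral_mono_set (memLp_two_norm (memLp_streamDer U P Q))
    (Filter.Eventually.of_forall fun _ => sq_nonneg _) ?_
  exact (Ioc_subset_Ioc hx hy).eventuallyLE

/-- Pointwise bounds for the test function and the solution in the new layers. -/
theorem norm_formDensity_test_le (h : LimitSol b k ψ C s w φ U) (hC : 0 ≤ C) {Cβ : ℝ}
    (hβ : IsCoeff (flowCoeff b) Cβ) {p q τ : ℝ} (hpq : p < q) (hτ : 0 < τ)
    (h0 : ∀ z ∈ Icc p q, stream U z = 0) {η : H1 (k : ℝ)} {c : ℂ}
    (e0 : ∀ y ∉ Ioo (p - τ) (q + τ), η.fn y = 0)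
    (e1 : ∀ᵐ z, z ∈ Ioc (p - τ) (q + τ) →
      η.der z = streamDer U z + c * indicator (Ioc p q) (fun _ => (1 : ℂ)) z)
    (e2 : ∀ y ∈ Icc (p - τ) p, η.fn y = stream U y - stream U (p - τ))
    (e3 : ∀ y ∈ Icc q (q + τ), η.fn y = stream U y - stream U (q + τ)) {N : ℝ}
    (hN : N = energy U (p - τ) (q + τ)) :
    (∀ z, ‖conj (η.fn z) * stream U z‖ ≤ indicator (Ioc (p - τ) p) (fun _ => τ * N ^ 2) z +
      indicator (Ioc q (q + τ)) (fun _ => τ * N ^ 2) z) ∧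
    ∀ᵐ z, z ∈ Ioc (-2 : ℝ) 2 → ‖formDensity (flowCoeff b) φ η z‖ ≤
      Cβ * ((1 + C) * (τ * N ^ 2) + 2 * (√τ * N) *
        ‖indicator (Ioc (p - τ) (q + τ)) (streamDer U) z‖) := by
  have hN0 : 0 ≤ N := hN ▸ energy_nonneg U _ _
  have hB0 : 0 ≤ √τ * N := by positivity
  have hsq : √τ * N * (√τ * N) = τ * N ^ 2 := by
    rw [mul_mul_mul_comm, Real.mul_self_sqrt hτ.le]; ring
  have hCβ := hβ.nonneg
  have bd : ∀ x y, p - τ ≤ x → x ≤ y → y ≤ q + τ → y - x ≤ τ →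
      ‖stream U y - stream U x‖ ≤ √τ * N := fun x y hx hxy hy hd => by
    rw [hN]
    refine (h.norm_stream_sub_le hx hxy hy).trans ?_
    exact mul_le_mul_of_nonneg_right (Real.sqrt_le_sqrt hd) (energy_nonneg U _ _)
  -- In a layer of width `τ`, `V` vanishes at the inner end and the test function at the outer end,
  -- so both are at most `√τ` times the energy.
  have Vl : ∀ z ∈ Icc (p - τ) p, ‖stream U z‖ ≤ √τ * N ∧ ‖η.fn z‖ ≤ √τ * N := fun z hz => by
    have a := bd z p hz.1 hz.2 (by linarith) (by linarith [hz.1])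
    rw [h0 p ⟨le_rfl, hpq.le⟩, zero_sub, norm_neg] at a
    refine ⟨a, ?_⟩
    rw [e2 z hz]
    exact bd _ _ le_rfl hz.1 (by linarith [hz.2]) (by linarith [hz.2])
  have Vr : ∀ z ∈ Icc q (q + τ), ‖stream U z‖ ≤ √τ * N ∧ ‖η.fn z‖ ≤ √τ * N := fun z hz => by
    have a := bd q z (by linarith) hz.1 hz.2 (by linarith [hz.2])
    rw [h0 q ⟨hpq.le, le_rfl⟩, sub_zero] at a
    refine ⟨a, ?_⟩
    rw [e3 z hz, norm_sub_rev]
    exact bd _ _ (by linarith [hz.1]) hz.2 le_rfl (by linarith [hz.1])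
  constructor
  · intro z
    have n1 : 0 ≤ indicator (Ioc (p - τ) p) (fun _ => τ * N ^ 2) z :=
      indicator_nonneg (fun _ _ => by positivity) z
    have n2 : 0 ≤ indicator (Ioc q (q + τ)) (fun _ => τ * N ^ 2) z :=
      indicator_nonneg (fun _ _ => by positivity) z
    rw [norm_mul, RCLike.norm_conj]
    by_cases hz : z ∈ Ioo (p - τ) (q + τ)
    · rcases le_or_gt z p with h1 | h1
      · have hz' : z ∈ Ioc (p - τ) p := ⟨hz.1, h1⟩
        obtain ⟨a1, a2⟩ := Vl z (Ioc_subset_Icc_self hz')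
        rw [indicator_of_mem hz']
        exact (mul_le_mul a2 a1 (norm_nonneg _) hB0).trans (by rw [hsq]; linarith)
      · rcases le_or_gt z q with h2 | h2
        · rw [h0 z ⟨h1.le, h2⟩, norm_zero, mul_zero]; linarith
        · have hz' : z ∈ Ioc q (q + τ) := ⟨h2, hz.2.le⟩
          obtain ⟨a1, a2⟩ := Vr z (Ioc_subset_Icc_self hz')
          rw [indicator_of_mem hz']
          exact (mul_le_mul a2 a1 (norm_nonneg _) hB0).trans (by rw [hsq]; linarith)
    · rw [e0 z hz, norm_zero, zero_mul]; linarith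
  · have hη' : ∀ y ∉ Icc (p - τ) (q + τ), η.fn y = 0 := fun y hy => e0 y fun hc =>
      hy (Ioo_subset_Icc_self hc)
    have hmid : ∀ᵐ z, z ∈ Ioo p q → φ.der z = 0 :=
      (φ.isPrim h.k_pos).ae_eq_zero_of_open isOpen_Ioo fun z hz => by
        rw [h.fn_eq_stream, h0 z (Ioo_subset_Icc_self hz), mul_zero, neg_zero]
    filter_upwards [e1, η.der_ae_zero h.k_pos hη', hmid, (φ.isPrim h.k_pos).ae_eq h.isPrim_fn,
      ae_ne p, ae_ne q, ae_ne (p - τ)] with z d1 d2 d3 d4 ne1 ne2 ne3 hz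
    have hR0 : 0 ≤ Cβ * ((1 + C) * (τ * N ^ 2) + 2 * (√τ * N) *
        ‖indicator (Ioc (p - τ) (q + τ)) (streamDer U) z‖) := by positivity
    by_cases hz1 : z ∈ Icc (p - τ) (q + τ)
    · have hz2 : z ∈ Ioc (p - τ) (q + τ) := ⟨lt_of_le_of_ne hz1.1 ne3.symm, hz1.2⟩
      by_cases hz3 : z ∈ Ioo p q
      · have : formDensity (flowCoeff b) φ η z = 0 := by
          rw [formDensity, d3 hz3, h.fn_eq_stream, h0 z (Ioo_subset_Icc_self hz3)]; simp
        rw [this, norm_zero]; exact hR0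
      · have hz4 : z ∉ Ioc p q := fun hc => hz3 ⟨hc.1, lt_of_le_of_ne hc.2 ne2⟩
        have hVη : ‖stream U z‖ ≤ √τ * N ∧ ‖η.fn z‖ ≤ √τ * N := by
          rcases le_or_gt z p with h1 | h1
          · exact Vl z ⟨hz1.1, h1⟩
          · exact Vr z ⟨not_lt.1 fun hc => hz3 ⟨h1, hc⟩, hz1.2⟩
        obtain ⟨a1, a2⟩ := hVη
        have a3 : ‖φ.fn z‖ ≤ √τ * N := by
          rw [h.fn_eq_stream, norm_neg, norm_mul, Complex.norm_real, Real.norm_eq_abs]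
          exact (mul_le_of_le_one_left (norm_nonneg _) (h.bound z)).trans a1
        have a4 : ‖φ.der z‖ ≤ C * (√τ * N) + ‖streamDer U z‖ := by
          rw [d4, norm_neg]
          refine (norm_add_le _ _).trans ?_
          rw [norm_mul, norm_mul, Complex.norm_real, Complex.norm_real, Real.norm_eq_abs,
            Real.norm_eq_abs]
          exact add_le_add (mul_le_mul (h.bound_deriv z) a1 (norm_nonneg _) hC)
            (mul_le_of_le_one_left (norm_nonneg _) (h.bound z))
        have a5 : ‖η.der z‖ = ‖streamDer U z‖ := by
          rw [d1 hz2, indicator_of_notMem hz4, mul_zero, add_zero]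
        refine (norm_formDensity_le hβ φ η hz).trans ?_
        rw [indicator_of_mem hz2, a5]
        refine mul_le_mul_of_nonneg_left ?_ hCβ
        calc _ ≤ (√τ * N) * (√τ * N) + (√τ * N) * (C * (√τ * N) + ‖streamDer U z‖) +
              (√τ * N) * ‖streamDer U z‖ := by gcongr
          _ = _ := by rw [← hsq]; ring
    · have : formDensity (flowCoeff b) φ η z = 0 := by
        rw [formDensity, d2 hz1, hη' z hz1]; simp
      rw [this, norm_zero]; exact hR0

/-- Unique continuation by a fixed step. -/
theorem exists_step (h : LimitSol b k ψ C s w φ U) :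
    ∃ τ, 0 < τ ∧ ∀ p q, p < q → (∀ z ∈ Icc p q, stream U z = 0) →
      ∀ z ∈ Icc (p - τ) (q + τ), stream U z = 0 := by
  obtain ⟨Cβ, hβ⟩ := h.flow.exists_isCoeff
  have hCβ := hβ.nonneg
  have hC : 0 ≤ C := (abs_nonneg _).trans (h.bound_deriv 0)
  have hl := memLp_logW h.flow w h.sign le_rfl zero_le_one
  set l := logW b s 0 w
  set Λ := √(∫ z in Ioc (-2 : ℝ) 2, ‖l z‖ ^ 2) with hΛd
  have hΛ : 0 ≤ Λ := Real.sqrt_nonneg _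
  have hk := h.k_pos
  -- With `r = √τ ≤ 1`, both `τ` and `τ * τ` are at most `r`, and all error terms together are at
  -- most `r * X * N ^ 2`. The choice of `r` makes `r * X ≤ 1/2`, which forces `N = 0`. None of
  -- these constants depends on `p` or `q`, so the step can be iterated.
  set X : ℝ := 2 * (k : ℝ) ^ 2 + Cβ * Λ * (4 + 2 * C) with hX
  have hX0 : 0 ≤ X := by positivity
  set r : ℝ := 1 / (2 * (X + 1)) with hr
  have hr0 : 0 < r := by positivity
  have hr1 : r ≤ 1 := by rw [hr, div_le_one (by positivity)]; linarith
  have hrX : r * X ≤ 1 / 2 := by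
    rw [hr, div_mul_eq_mul_div, div_le_div_iff₀ (by positivity) (by norm_num)]; linarith
  refine ⟨r ^ 2, by positivity, fun p q hpq h0 z hz => ?_⟩
  set τ := r ^ 2 with hτd
  have hτ : 0 < τ := by positivity
  have hsτ : √τ = r := Real.sqrt_sq hr0.le
  obtain ⟨η, c, e0, e1, e2, e3⟩ := h.exists_test hpq hτ
  set N := energy U (p - τ) (q + τ) with hN
  have hN0 : 0 ≤ N := energy_nonneg U _ _
  obtain ⟨b1, b2⟩ := h.norm_formDensity_test_le hC hβ hpq hτ h0 e0 e1 e2 e3 hN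
  have hle : p - τ ≤ q + τ := by linarith
  have hmD := memLp_streamDer U (p - τ) (q + τ)
  have hN2 : N ^ 2 = ∫ z in Ioc (p - τ) (q + τ), ‖streamDer U z‖ ^ 2 :=
    Real.sq_sqrt (integral_nonneg fun _ => by positivity)
  have hp := isPrim_stream h.one_le U
  have hw := h.weak_eq hle η e0
  have hsub : Ioc p q ⊆ Ioc (p - τ) (q + τ) := Ioc_subset_Ioc (by linarith) (by linarith)
  -- the main term
  have iN : IntegrableOn (fun z => ((‖streamDer U z‖ ^ 2 : ℝ) : ℂ)) (Ioc (p - τ) (q + τ)) :=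
    (memLp_two_norm hmD).ofReal
  have iI : IntegrableOn (fun z => conj c * indicator (Ioc p q) (streamDer U) z)
      (Ioc (p - τ) (q + τ)) :=
    (((hp.intervalIntegrable (p - τ) (q + τ)).1).indicator measurableSet_Ioc).const_mul _
  have iη : IntegrableOn (fun z => (k : ℂ) ^ 2 * (conj (η.fn z) * stream U z))
      (Ioc (p - τ) (q + τ)) :=
    (((Complex.continuous_conj.comp (η.continuous_fn hk)).mul
      hp.continuous).integrableOn_Ioc).const_mul _
  -- The correction in the test function is paired with `∫ V'` over `(p, q]`, that is with `V(q) -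
  -- V(p) = 0`.
  have m2 : ∫ z in Ioc (p - τ) (q + τ), indicator (Ioc p q) (streamDer U) z = 0 := by
    rw [setIntegral_indicator measurableSet_Ioc, inter_eq_right.2 hsub,
      ← intervalIntegral.integral_of_le hpq.le, ← hp.sub_eq, h0 p ⟨le_rfl, hpq.le⟩,
      h0 q ⟨hpq.le, le_rfl⟩, sub_self]
  have m1 : ∫ z in Ioc (p - τ) (q + τ), (conj (η.der z) * streamDer U z +
      k ^ 2 * (conj (η.fn z) * stream U z)) = ((N ^ 2 : ℝ) : ℂ) +
        ∫ z in Ioc (p - τ) (q + τ), (k : ℂ) ^ 2 * (conj (η.fn z) * stream U z) := by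
    have : ∫ z in Ioc (p - τ) (q + τ), (conj (η.der z) * streamDer U z +
        k ^ 2 * (conj (η.fn z) * stream U z)) = ∫ z in Ioc (p - τ) (q + τ),
          (((‖streamDer U z‖ ^ 2 : ℝ) : ℂ) + conj c * indicator (Ioc p q) (streamDer U) z +
            (k : ℂ) ^ 2 * (conj (η.fn z) * stream U z)) := by
      refine integral_congr_ae ?_
      filter_upwards [ae_restrict_mem measurableSet_Ioc, ae_restrict_of_ae e1] with z hz hz1
      rw [hz1 hz, ← Complex.normSq_eq_norm_sq, ← Complex.mul_conj, map_add, map_mul]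
      by_cases hzm : z ∈ Ioc p q
      · rw [indicator_of_mem hzm, indicator_of_mem hzm, map_one]; ring
      · rw [indicator_of_notMem hzm, indicator_of_notMem hzm, map_zero]; ring
    have s1 := integral_add (iN.add iI) iη
    have s2 := integral_add iN iI
    simp only [Pi.add_apply] at s1 s2
    rw [this, s1, s2, integral_const_mul, m2, mul_zero, add_zero, integral_complex_ofReal, hN2]
  -- the lower order term
  have t1 : ‖∫ z in Ioc (p - τ) (q + τ), (k : ℂ) ^ 2 * (conj (η.fn z) * stream U z)‖ ≤
      (k : ℝ) ^ 2 * (2 * τ * (τ * N ^ 2)) := by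
    rw [integral_const_mul, norm_mul, norm_pow, Complex.norm_natCast]
    refine mul_le_mul_of_nonneg_left ?_ (by positivity)
    have j1 : Integrable (indicator (Ioc (p - τ) p) (fun _ : ℝ => τ * N ^ 2)) :=
      (integrable_indicator_iff measurableSet_Ioc).2 (integrableOn_const measure_Ioc_lt_top.ne)
    have j2 : Integrable (indicator (Ioc q (q + τ)) (fun _ : ℝ => τ * N ^ 2)) :=
      (integrable_indicator_iff measurableSet_Ioc).2 (integrableOn_const measure_Ioc_lt_top.ne)
    have s1 : ∫ z, (indicator (Ioc (p - τ) p) (fun _ : ℝ => τ * N ^ 2) z +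
        indicator (Ioc q (q + τ)) (fun _ : ℝ => τ * N ^ 2) z) = 2 * τ * (τ * N ^ 2) := by
      rw [integral_add j1 j2, integral_indicator measurableSet_Ioc,
        integral_indicator measurableSet_Ioc, setIntegral_const, setIntegral_const]
      simp [hτ.le]
      ring
    have s2 : ∫ z in Ioc (p - τ) (q + τ), conj (η.fn z) * stream U z =
        ∫ z, indicator (Ioc (p - τ) (q + τ)) (fun z => conj (η.fn z) * stream U z) z :=
      (integral_indicator measurableSet_Ioc).symm
    rw [s2, ← s1]
    refine norm_integral_le_of_norm_le (j1.add j2) (Filter.Eventually.of_forall fun z => ?_)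
    exact (norm_indicator_le_norm_self _ _).trans (b1 z)
  -- the singular term
  have md : MemLp (indicator (Ioc (p - τ) (q + τ)) (streamDer U)) 2 volume :=
    (memLp_indicator_iff_restrict measurableSet_Ioc).2 hmD
  have d1 : √(∫ z in Ioc (-2 : ℝ) 2, ‖indicator (Ioc (p - τ) (q + τ)) (streamDer U) z‖ ^ 2) ≤ N := by
    refine (integral_Ioc_sq_le md _).trans (Real.sqrt_le_sqrt (le_of_eq ?_))
    rw [← integral_indicator measurableSet_Ioc]
    congr 1; ext z
    by_cases hz : z ∈ Ioc (p - τ) (q + τ)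
    · rw [indicator_of_mem hz, indicator_of_mem hz]
    · rw [indicator_of_notMem hz, indicator_of_notMem hz]; simp
  have t2 : ‖form (flowCoeff b) l φ η‖ ≤ Cβ * ((1 + C) * (τ * N ^ 2) * (2 * Λ) +
      2 * (√τ * N) * (Λ * N)) := by
    have i1 := integrable_norm_mul_norm hl (memLp_const (1 : ℂ))
    have i2 := integrable_norm_mul_norm hl (md.restrict (Ioc (-2 : ℝ) 2))
    have c1 := integral_norm_mul_norm_le hl (memLp_const (1 : ℂ))
    have c2 := integral_norm_mul_norm_le hl (md.restrict (Ioc (-2 : ℝ) 2))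
    have c3 : √(∫ z in Ioc (-2 : ℝ) 2, ‖(1 : ℂ)‖ ^ 2) = 2 := by
      have : ∫ z in Ioc (-2 : ℝ) 2, ‖(1 : ℂ)‖ ^ 2 = 2 ^ 2 := by
        rw [setIntegral_const]; simp; norm_num
      rw [this, Real.sqrt_sq (by norm_num)]
    rw [c3] at c1
    rw [form, norm_neg]
    calc _ ≤ ∫ z in Ioc (-2 : ℝ) 2, Cβ * ((1 + C) * (τ * N ^ 2) * (‖l z‖ * ‖(1 : ℂ)‖) +
          2 * (√τ * N) * (‖l z‖ * ‖indicator (Ioc (p - τ) (q + τ)) (streamDer U) z‖)) := by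
          refine norm_integral_le_of_norm_le (((i1.const_mul _).add (i2.const_mul _)).const_mul _) ?_
          filter_upwards [ae_restrict_mem measurableSet_Ioc, ae_restrict_of_ae b2] with z hz hz2
          rw [norm_mul]
          refine (mul_le_mul_of_nonneg_left (hz2 hz) (norm_nonneg _)).trans (le_of_eq ?_)
          rw [norm_one]; ring
      _ = Cβ * ((1 + C) * (τ * N ^ 2) * (∫ z in Ioc (-2 : ℝ) 2, ‖l z‖ * ‖(1 : ℂ)‖) +
          2 * (√τ * N) * ∫ z in Ioc (-2 : ℝ) 2, ‖l z‖ *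
            ‖indicator (Ioc (p - τ) (q + τ)) (streamDer U) z‖) := by
          rw [integral_const_mul, integral_add (i1.const_mul _) (i2.const_mul _),
            integral_const_mul, integral_const_mul]
      _ ≤ _ := by
          gcongr
          · exact c1.trans (le_of_eq (mul_comm _ _))
          · exact c2.trans (by gcongr)
  -- conclusion
  rw [m1] at hw
  have t3 : N ^ 2 ≤ ‖form (flowCoeff b) l φ η‖ +
      ‖∫ z in Ioc (p - τ) (q + τ), (k : ℂ) ^ 2 * (conj (η.fn z) * stream U z)‖ := by
    have e : ((N ^ 2 : ℝ) : ℂ) = form (flowCoeff b) l φ η -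
        ∫ z in Ioc (p - τ) (q + τ), (k : ℂ) ^ 2 * (conj (η.fn z) * stream U z) := by
      rw [← hw]; ring
    have e' : ‖((N ^ 2 : ℝ) : ℂ)‖ = N ^ 2 := by
      rw [Complex.norm_real, Real.norm_eq_abs, abs_of_nonneg (sq_nonneg N)]
    rw [← e', e]
    exact norm_sub_le _ _
  have hτr : τ ≤ r := by rw [hτd, sq]; exact mul_le_of_le_one_left hr0.le hr1
  have hττ : τ * τ ≤ r := (mul_le_of_le_one_left hτ.le (hτr.trans hr1)).trans hτr
  have t4 : N ^ 2 ≤ r * X * N ^ 2 := by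
    refine t3.trans ((add_le_add t2 t1).trans ?_)
    rw [hsτ]
    calc _ = (Cβ * Λ * ((1 + C) * 2 * τ + 2 * r) + 2 * (k : ℝ) ^ 2 * (τ * τ)) * N ^ 2 := by ring
      _ ≤ (Cβ * Λ * ((1 + C) * 2 * r + 2 * r) + 2 * (k : ℝ) ^ 2 * r) * N ^ 2 := by gcongr
      _ = _ := by rw [hX]; ring
  have hN00 : N = 0 := by
    have : N ^ 2 ≤ 0 := by nlinarith [sq_nonneg N]
    exact pow_eq_zero_iff (by norm_num) |>.1 (le_antisymm this (sq_nonneg N))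
  rcases le_total z p with hzp | hzp
  · have a := h.norm_stream_sub_le hz.1 hzp (by linarith : p ≤ q + τ)
    rw [← hN, hN00, mul_zero, h0 p ⟨le_rfl, hpq.le⟩, zero_sub, norm_neg] at a
    exact norm_le_zero_iff.1 a
  · have a := h.norm_stream_sub_le (by linarith : p - τ ≤ p) hzp hz.2
    rw [← hN, hN00, mul_zero, h0 p ⟨le_rfl, hpq.le⟩, sub_zero] at a
    exact norm_le_zero_iff.1 a

/-- The limiting equation has only the trivial solution. -/
theorem eq_zero (h : LimitSol b k ψ C s w φ U) (hL : NoEmbeddedEigenvalue b k) : φ = 0 := by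
  obtain ⟨τ, hτ, hstep⟩ := h.exists_step
  have hn : ∀ n : ℕ, ∀ z ∈ Icc (-(n * τ)) (1 + n * τ), stream U z = 0 := by
    intro n
    induction n with
    | zero => simpa using h.stream_eq_zero_Icc hL
    | succ n ih =>
      have hpos : 0 ≤ n * τ := by positivity
      have := hstep _ _ (by linarith) ih
      intro z hz
      push_cast at hz
      exact this z ⟨by linarith [hz.1], by linarith [hz.2]⟩
  refine H1.ext_fn h.k_pos (funext fun y => ?_)
  obtain ⟨n, hn'⟩ := exists_nat_ge (|y| / τ)
  rw [div_le_iff₀ hτ] at hn'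
  have hy := abs_le.1 hn'
  rw [h.fn_eq_stream, hn n y ⟨by linarith [hy.1], by linarith [hy.2]⟩, mul_zero, neg_zero,
    H1.fn_zero]

end LimitSol

/-! ### The uniform lower bound -/

/-- `1 + M A` is bounded below by `ρ` for all regularizations of size at most `ρ`. -/
def BoundedBelow (b : ℝ → ℝ) (k : ℕ) (M : H1 (k : ℝ) →L[ℂ] H1 (k : ℝ)) (s W ρ : ℝ) : Prop :=
  ∀ t w : ℝ, 0 < t → t ≤ 1 → t ≤ ρ → |w| ≤ W → ∀ u : H1 (k : ℝ),
    ρ * ‖u‖ ≤ ‖u + M (opA k (flowCoeff b) (logW b s t w) u)‖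

theorem BoundedBelow.mono {b : ℝ → ℝ} {k : ℕ} {M : H1 (k : ℝ) →L[ℂ] H1 (k : ℝ)} {s W ρ ρ' : ℝ}
    (h : BoundedBelow b k M s W ρ) (hρ : ρ' ≤ ρ) : BoundedBelow b k M s W ρ' :=
  fun t w h1 h2 h3 h4 u =>
    (mul_le_mul_of_nonneg_right hρ (norm_nonneg _)).trans (h t w h1 h2 (h3.trans hρ) h4 u)

theorem norm_le_of_norm_comp_le {E : Type*} [NormedAddCommGroup E] [NormedSpace ℂ E]
    {M A : E →L[ℂ] E} {K η : ℝ} (hM : ‖M‖ ≤ K) (hA : ‖A‖ ≤ η) (hKη : K * η ≤ 1 / 2)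
    (u : E) : 1 / 2 * ‖u‖ ≤ ‖u + M (A u)‖ := by
  have h1 : ‖M (A u)‖ ≤ K * (η * ‖u‖) :=
    (M.le_of_opNorm_le hM _).trans (mul_le_mul_of_nonneg_left (A.le_of_opNorm_le hA u)
      ((norm_nonneg _).trans hM))
  have h2 : ‖u‖ ≤ ‖u + M (A u)‖ + ‖M (A u)‖ := by
    simpa using norm_sub_le (u + M (A u)) (M (A u))
  have h3 : K * (η * ‖u‖) ≤ 1 / 2 * ‖u‖ := by
    rw [← mul_assoc]; exact mul_le_mul_of_nonneg_right hKη (norm_nonneg _)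
  linarith

section

variable {b : ℝ → ℝ} {δ₀ : ℝ} {Ψ : ℕ → ℝ → ℝ} {k : ℕ} {M : H1 (k : ℝ) →L[ℂ] H1 (k : ℝ)} {s : ℝ}

/-- The limiting operator is bounded below. -/
theorem exists_limit_lower_bound (hb : IsShearFlow b) (hΨ : IsCutoffFamily δ₀ Ψ) (hk : 1 ≤ k)
    (hL : NoEmbeddedEigenvalue b k)
    (hM : ∀ u y, (M u).fn y = Ψ k y * (u.fn y - sigma₀ k y * u.fn 0 - sigma₁ k y * u.fn 1))
    (hs : s ^ 2 = 1) (w : ℝ) :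
    ∃ K : ℝ, 0 ≤ K ∧ ∀ u, ‖u‖ ≤ K * ‖u + M (opA k (flowCoeff b) (logW b s 0 w) u)‖ := by
  have hk1 : (1 : ℝ) ≤ k := by exact_mod_cast hk
  obtain ⟨Cβ, hβ⟩ := hb.exists_isCoeff
  obtain ⟨C, hC⟩ := hΨ.deriv_bound
  have hl := memLp_logW hb w hs le_rfl zero_le_one
  set A := opA k (flowCoeff b) (logW b s 0 w)
  have hc : IsCompactOperator (M ∘L A) := (isCompactOperator_opA hk1 hβ hl).clm_comp M
  -- Fredholm alternative: for the compact operator `M A` it suffices that `-1` is not an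
  -- eigenvalue, and an eigenvector `v` would solve the limiting equation with `U = A v`.
  obtain ⟨K, hK⟩ := hc.antilipschitz_of_not_hasEigenvalue (μ := (-1 : ℂ)) (by norm_num) (by
    intro hev
    obtain ⟨v, hv⟩ := hev.exists_hasEigenvector
    refine hv.2 ?_
    have hv1 : M (A v) = (-1 : ℂ) • v := hv.apply_eq_smul
    refine LimitSol.eq_zero (b := b) (ψ := Ψ k) (C := C * k) (s := s) (w := w) (U := A v)
      ⟨hb, hk, hs, hΨ.smooth k hk, hΨ.eq_one k hk, fun y => ?_, hC k hk,
        fun η => inner_opA hk1 hβ hl v η, fun y => ?_⟩ hL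
    · have := hΨ.mem_Icc k hk y
      rw [abs_of_nonneg this.1]; exact this.2
    · rw [← hM, hv1]; simp)
  refine ⟨K, K.2, fun u => ?_⟩
  have h := hK.le_mul_norm_sub u 0
  have e : u + M (A u) = -(-u + -M (A u)) := by abel
  rw [e, norm_neg]
  simpa [add_comm] using h

theorem tendsto_opA (hb : IsShearFlow b) (hk : 1 ≤ k) (hs : s ^ 2 = 1) {w : ℝ} {wn tn : ℕ → ℝ}
    (hwn : Filter.Tendsto wn Filter.atTop (nhds w))
    (htn : Filter.Tendsto tn Filter.atTop (nhds 0)) (ht : ∀ n, 0 < tn n) (ht1 : ∀ n, tn n ≤ 1) :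
    Filter.Tendsto (fun n => ‖opA k (flowCoeff b) (logW b s (tn n) (wn n)) -
      opA k (flowCoeff b) (logW b s 0 w)‖) Filter.atTop (nhds 0) := by
  have hk1 : (1 : ℝ) ≤ k := by exact_mod_cast hk
  obtain ⟨C, hβ⟩ := hb.exists_isCoeff
  refine squeeze_zero (fun _ => norm_nonneg _) (fun n => norm_opA_sub_le hk1 hβ
    (memLp_logW hb (wn n) hs (ht n).le (ht1 n)) (memLp_logW hb w hs le_rfl zero_le_one)) ?_
  have h1 := (Real.continuous_sqrt.tendsto 0).comp (tendsto_logW hb hs hwn htn ht)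
  have h2 := (h1.const_mul (3 * C)).div_const (√(k : ℝ))
  simpa [Function.comp_def] using h2

/-- If the bound fails for every `ρ`, there are parameters with `t → 0` and, along a subsequence, `w
→ w₀`. The operators converge in norm to the limiting one at `w₀`, which is bounded below, so no
limit of the functions `u` has to be extracted. -/
theorem exists_boundedBelow (hb : IsShearFlow b) (hΨ : IsCutoffFamily δ₀ Ψ) (hk : 1 ≤ k)
    (hL : NoEmbeddedEigenvalue b k)
    (hM : ∀ u y, (M u).fn y = Ψ k y * (u.fn y - sigma₀ k y * u.fn 0 - sigma₁ k y * u.fn 1))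
    (hs : s ^ 2 = 1) (W : ℝ) : ∃ ρ, 0 < ρ ∧ BoundedBelow b k M s W ρ := by
  by_contra hcon
  push Not at hcon
  have hn : ∀ n : ℕ, ∃ t w : ℝ, ∃ u : H1 (k : ℝ), 0 < t ∧ t ≤ 1 ∧ t ≤ 1 / ((n : ℝ) + 1) ∧ |w| ≤ W ∧
      ‖u + M (opA k (flowCoeff b) (logW b s t w) u)‖ < 1 / ((n : ℝ) + 1) * ‖u‖ := fun n => by
    have := hcon (1 / ((n : ℝ) + 1)) (by positivity)
    unfold BoundedBelow at this
    push Not at this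
    obtain ⟨t, w, h1, h2, h3, h4, u, h5⟩ := this
    exact ⟨t, w, u, h1, h2, h3, h4, h5⟩
  choose t w u h1 h2 h3 h4 h5 using hn
  obtain ⟨w₀, -, g, hg, hgw⟩ := isCompact_Icc.tendsto_subseq (s := Icc (-W) W) (x := w)
    fun n => abs_le.1 (h4 n)
  have t0 := tendsto_one_div_add_atTop_nhds_zero_nat (𝕜 := ℝ)
  have ht0 : Filter.Tendsto t Filter.atTop (nhds 0) :=
    squeeze_zero (fun n => (h1 n).le) h3 t0
  have hA := tendsto_opA (k := k) hb hk hs hgw (ht0.comp hg.tendsto_atTop) (fun n => h1 _)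
    fun n => h2 _
  obtain ⟨K, hK0, hK⟩ := exists_limit_lower_bound hb hΨ hk hL hM hs w₀
  have hlim := (((t0.comp hg.tendsto_atTop).add (hA.const_mul ‖M‖)).const_mul K)
  simp only [mul_zero, add_zero] at hlim
  obtain ⟨n, hn⟩ := (hlim.eventually (gt_mem_nhds zero_lt_one)).exists
  simp only [Function.comp_apply] at hn
  set A := opA k (flowCoeff b) (logW b s (t (g n)) (w (g n)))
  set A₀ := opA k (flowCoeff b) (logW b s 0 w₀)
  set v := u (g n)
  have a1 := hK v
  have a2 : ‖v + M (A₀ v)‖ ≤ ‖v + M (A v)‖ + ‖M‖ * (‖A - A₀‖ * ‖v‖) := by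
    have e : v + M (A₀ v) = (v + M (A v)) - M ((A - A₀) v) := by
      rw [sub_apply, map_sub]; abel
    rw [e]
    refine (norm_sub_le _ _).trans (add_le_add le_rfl ?_)
    exact (M.le_opNorm _).trans (mul_le_mul_of_nonneg_left ((A - A₀).le_opNorm v) (norm_nonneg _))
  have a3 := h5 (g n)
  have hv : 0 < ‖v‖ := by
    by_contra hv0
    have : ‖v‖ = 0 := le_antisymm (not_lt.1 hv0) (norm_nonneg _)
    rw [this, mul_zero] at a3
    exact absurd a3 (not_lt.2 (norm_nonneg _))
  have a4 : ‖v‖ ≤ K * (1 / ((g n : ℝ) + 1) + ‖M‖ * ‖A - A₀‖) * ‖v‖ := by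
    refine a1.trans ((mul_le_mul_of_nonneg_left (a2.trans (add_le_add a3.le le_rfl)) hK0).trans
      (le_of_eq ?_))
    ring
  have a5 : K * (1 / ((g n : ℝ) + 1) + ‖M‖ * ‖A - A₀‖) * ‖v‖ < 1 * ‖v‖ :=
    mul_lt_mul_of_pos_right hn hv
  linarith

end

theorem exists_forall_lt_of_antitone {P : ℕ → ℝ → Prop} (h : ∀ k, ∃ ρ, 0 < ρ ∧ P k ρ)
    (hP : ∀ k ρ ρ', ρ' ≤ ρ → P k ρ → P k ρ') (n : ℕ) : ∃ ρ, 0 < ρ ∧ ∀ k < n, P k ρ := by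
  induction n with
  | zero => exact ⟨1, one_pos, fun k hk => absurd hk (Nat.not_lt_zero k)⟩
  | succ n ih =>
    obtain ⟨ρ, h0, h1⟩ := ih
    obtain ⟨ρ', h0', hPn⟩ := h n
    refine ⟨min ρ ρ', lt_min h0 h0', fun k hk => ?_⟩
    rcases Nat.lt_succ_iff_lt_or_eq.1 hk with hk | rfl
    · exact hP k _ _ (min_le_left _ _) (h1 k hk)
    · exact hP k _ _ (min_le_right _ _) hPn

/-- The lower bound, uniformly in the wave number and the spectral parameter. -/
theorem exists_lower_bound {b : ℝ → ℝ} (hb : IsShearFlow b)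
    (hL : ∀ k : ℕ, 1 ≤ k → NoEmbeddedEigenvalue b k) {δ₀ : ℝ} (hδ₀ : 0 < δ₀) {Ψ : ℕ → ℝ → ℝ}
    (hΨ : IsCutoffFamily δ₀ Ψ) :
    ∃ ρ : ℝ, 0 < ρ ∧ ρ ≤ 1 ∧ ∀ k : ℕ, 1 ≤ k → ∃ M : H1 (k : ℝ) →L[ℂ] H1 (k : ℝ),
      (∀ u y, (M u).fn y = Ψ k y * (u.fn y - sigma₀ k y * u.fn 0 - sigma₁ k y * u.fn 1)) ∧
      ∀ s t w : ℝ, s ^ 2 = 1 → 0 < t → t ≤ ρ → ∀ u : H1 (k : ℝ),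
        ρ * ‖u‖ ≤ ‖u + M (opA k (flowCoeff b) (logW b s t w) u)‖ := by
  obtain ⟨K, hK0, hM⟩ := exists_opM hδ₀ hΨ
  choose M hMK hMf using hM
  obtain ⟨Cβ, hβ⟩ := hb.exists_isCoeff
  have hCβ := hβ.nonneg
  obtain ⟨W, hW0, hW⟩ := exists_norm_opA_le_of_large hb (η := 1 / (2 * K)) (by positivity)
  obtain ⟨D, hD0, hD⟩ := exists_logW_bound hb W
  -- For `k ≥ n` the bounds `‖M‖ ≤ K` and `‖A‖ ≤ 3 * Cβ * √D / √k` have product at most `1/2`.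
  obtain ⟨n, hn⟩ := exists_nat_ge ((2 * K * (3 * Cβ * √D)) ^ 2)
  obtain ⟨ρ, hρ0, hρ⟩ := exists_forall_lt_of_antitone
    (P := fun k ρ => ∀ hk : 1 ≤ k, BoundedBelow b k (M k hk) 1 W ρ ∧
      BoundedBelow b k (M k hk) (-1) W ρ) (fun k => by
      by_cases hk : 1 ≤ k
      · obtain ⟨ρ₁, h1, h2⟩ := exists_boundedBelow hb hΨ hk (hL k hk) (hMf k hk)
          (s := 1) (by norm_num) W
        obtain ⟨ρ₂, h3, h4⟩ := exists_boundedBelow hb hΨ hk (hL k hk) (hMf k hk)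
          (s := -1) (by norm_num) W
        exact ⟨min ρ₁ ρ₂, lt_min h1 h3, fun _ =>
          ⟨h2.mono (min_le_left _ _), h4.mono (min_le_right _ _)⟩⟩
      · exact ⟨1, one_pos, fun hk' => absurd hk' hk⟩)
    (fun k ρ ρ' hle h hk => ⟨(h hk).1.mono hle, (h hk).2.mono hle⟩) (n + 1)
  have hr1 : min ρ (1 / 2) ≤ 1 / 2 := min_le_right _ _
  refine ⟨min ρ (1 / 2), by positivity, by linarith, fun k hk => ⟨M k hk, hMf k hk,
    fun s t w hs ht htρ u => ?_⟩⟩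
  have hk1 : (1 : ℝ) ≤ k := by exact_mod_cast hk
  have ht1 : t ≤ 1 := by linarith
  have half : 1 / 2 * ‖u‖ ≤ ‖u + M k hk (opA k (flowCoeff b) (logW b s t w) u)‖ →
      min ρ (1 / 2) * ‖u‖ ≤ ‖u + M k hk (opA k (flowCoeff b) (logW b s t w) u)‖ :=
    (mul_le_mul_of_nonneg_right hr1 (norm_nonneg _)).trans
  -- Three regimes: large `|w|` and large `k` are perturbative; for `|w| ≤ W` and the finitely many
  -- small `k` the compactness bounds apply, one for each sign `s`.
  rcases le_total W |w| with hw | hw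
  · refine half (norm_le_of_norm_comp_le (hMK k hk) (hW k s t w hk1 hs ht ht1 hw) (le_of_eq ?_) u)
    field_simp
  · rcases lt_or_ge k (n + 1) with hkn | hkn
    · obtain ⟨h1, h2⟩ := hρ k hkn hk
      rcases mul_self_eq_one_iff.1 ((sq s).symm.trans hs) with h | h
      · subst h
        exact (h1.mono (min_le_left ρ (1 / 2))) t w ht ht1 htρ hw u
      · subst h
        exact (h2.mono (min_le_left ρ (1 / 2))) t w ht ht1 htρ hw u
    · obtain ⟨hl, hl2⟩ := hD s t w hs ht.le ht1 hw
      have hA := norm_opA_le hk1 hβ hl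
      have hsk : 0 < √(k : ℝ) := Real.sqrt_pos.2 (by linarith)
      have hA' : ‖opA k (flowCoeff b) (logW b s t w)‖ ≤ 3 * Cβ * √D / √k :=
        hA.trans (by gcongr)
      refine half (norm_le_of_norm_comp_le (hMK k hk) hA' ?_ u)
      have hnk : (2 * K * (3 * Cβ * √D)) ^ 2 ≤ k := by
        refine hn.trans ?_
        exact_mod_cast (Nat.le_of_succ_le hkn)
      have := Real.le_sqrt_of_sq_le hnk
      rw [mul_div_assoc', div_le_div_iff₀ hsk (by norm_num)]
      linarith

/-! ### Change of variables -/

/-- An increasing diffeomorphism `g` of the line with `m ≤ g' ≤ M`. -/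
structure IsDiffeo (g g' : ℝ → ℝ) (m M : ℝ) : Prop where
  hasDerivAt : ∀ x, HasDerivAt g (g' x) x
  continuous' : Continuous g'
  surjective : Function.Surjective g
  pos : 0 < m
  le_deriv : ∀ x, m ≤ g' x
  deriv_le : ∀ x, g' x ≤ M

namespace IsDiffeo

variable {g g' : ℝ → ℝ} {m M : ℝ}

theorem deriv_pos (h : IsDiffeo g g' m M) (x : ℝ) : 0 < g' x := h.pos.trans_le (h.le_deriv x)

theorem strictMono (h : IsDiffeo g g' m M) : StrictMono g :=
  strictMono_of_deriv_pos fun x => by rw [(h.hasDerivAt x).deriv]; exact h.deriv_pos x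

theorem continuous (h : IsDiffeo g g' m M) : Continuous g :=
  continuous_iff_continuousAt.2 fun x => (h.hasDerivAt x).continuousAt

theorem image_univ (h : IsDiffeo g g' m M) : g '' univ = univ := by
  rw [Set.image_univ, h.surjective.range_eq]

theorem integral_eq {E : Type*} [NormedAddCommGroup E] [NormedSpace ℝ E] (h : IsDiffeo g g' m M)
    (f : ℝ → E) : ∫ v, f v = ∫ x, g' x • f (g x) := by
  have h1 := integral_image_eq_integral_abs_deriv_smul MeasurableSet.univ
    (fun x _ => (h.hasDerivAt x).hasDerivWithinAt) h.strictMono.injective.injOn f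
  rw [h.image_univ, setIntegral_univ, setIntegral_univ] at h1
  rw [h1]
  congr 1; ext x
  rw [abs_of_pos (h.deriv_pos x)]

/-- By the area formula the integral of `g'` over the preimage of a null set is zero, and `g'` is
positive. -/
theorem quasiMeasurePreserving (h : IsDiffeo g g' m M) :
    Measure.QuasiMeasurePreserving g volume volume := by
  refine ⟨h.continuous.measurable, Measure.AbsolutelyContinuous.mk fun s hs h0 => ?_⟩
  rw [Measure.map_apply h.continuous.measurable hs]
  have hs' : MeasurableSet (g ⁻¹' s) := h.continuous.measurable hs
  have h1 := lintegral_abs_det_fderiv_eq_addHaar_image volume hs'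
    (fun x _ => ((h.hasDerivAt x).hasFDerivAt).hasFDerivWithinAt) h.strictMono.injective.injOn
  rw [image_preimage_eq s h.surjective, h0, lintegral_eq_zero_iff'] at h1
  · rw [← Measure.restrict_eq_zero, ← ae_eq_bot]
    by_contra hne
    have : (ae (volume.restrict (g ⁻¹' s))).NeBot := ⟨hne⟩
    obtain ⟨x, hx⟩ := h1.exists
    simp [(h.deriv_pos x).ne'] at hx
  · refine Measurable.aemeasurable ?_
    simp only [ContinuousLinearMap.det_toSpanSingleton]
    have := h.continuous'.measurable
    fun_prop

theorem memLp_comp (h : IsDiffeo g g' m M) {f : ℝ → ℂ} (hf : MemLp f 2 volume) :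
    MemLp (fun x => f (g x)) 2 volume ∧ √(∫ x, ‖f (g x)‖ ^ 2) ≤ 1 / √m * √(∫ v, ‖f v‖ ^ 2) := by
  have hm : AEStronglyMeasurable (fun x => f (g x)) volume :=
    hf.1.comp_quasiMeasurePreserving h.quasiMeasurePreserving
  have hi := (memLp_two_norm hf)
  have hi' : Integrable fun x => g' x * ‖f (g x)‖ ^ 2 := by
    have h1 := (integrableOn_image_iff_integrableOn_abs_deriv_smul MeasurableSet.univ
      (fun x _ => (h.hasDerivAt x).hasDerivWithinAt) h.strictMono.injective.injOn
      (fun v => ‖f v‖ ^ 2)).1 (by rw [h.image_univ]; exact hi.integrableOn)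
    rw [integrableOn_univ] at h1
    refine h1.congr (Filter.Eventually.of_forall fun x => ?_)
    simp only [abs_of_pos (h.deriv_pos x), smul_eq_mul]
  have hpt : ∀ x, ‖f (g x)‖ ^ 2 ≤ 1 / m * (g' x * ‖f (g x)‖ ^ 2) := fun x => by
    rw [← mul_assoc]
    refine le_mul_of_one_le_left (by positivity) ?_
    rw [one_div_mul_eq_div, one_le_div h.pos]
    exact h.le_deriv x
  have hI : Integrable fun x => ‖f (g x)‖ ^ 2 :=
    (hi'.const_mul (1 / m)).mono' (hm.norm.pow 2) (Filter.Eventually.of_forall fun x => by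
      rw [Real.norm_eq_abs, abs_of_nonneg (by positivity)]; exact hpt x)
  refine ⟨(memLp_two_iff_integrable_sq_norm hm).2 hI, ?_⟩
  have h2 : ∫ x, ‖f (g x)‖ ^ 2 ≤ 1 / m * ∫ v, ‖f v‖ ^ 2 := by
    rw [h.integral_eq (fun v => ‖f v‖ ^ 2), ← integral_const_mul]
    exact integral_mono hI (hi'.const_mul _) hpt
  refine (Real.sqrt_le_sqrt h2).trans (le_of_eq ?_)
  rw [Real.sqrt_mul (by have := h.pos; positivity), Real.sqrt_div zero_le_one, Real.sqrt_one]

theorem memLp_comp_mul (h : IsDiffeo g g' m M) {f : ℝ → ℂ} (hf : MemLp f 2 volume) :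
    MemLp (fun x => f (g x) * (g' x : ℂ)) 2 volume ∧
      √(∫ x, ‖f (g x) * (g' x : ℂ)‖ ^ 2) ≤ M * (1 / √m * √(∫ v, ‖f v‖ ^ 2)) := by
  obtain ⟨h1, h2⟩ := h.memLp_comp hf
  have hM : 0 ≤ M := ((h.deriv_pos 0).trans_le (h.deriv_le 0)).le
  have hpt : ∀ x, ‖f (g x) * (g' x : ℂ)‖ ≤ M * ‖f (g x)‖ := fun x => by
    rw [norm_mul, Complex.norm_real, Real.norm_eq_abs, abs_of_pos (h.deriv_pos x), mul_comm]
    exact mul_le_mul_of_nonneg_right (h.deriv_le x) (norm_nonneg _)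
  have hmem : MemLp (fun x => f (g x) * (g' x : ℂ)) 2 volume :=
    h1.of_le_mul (h1.1.mul (Complex.continuous_ofReal.comp h.continuous').aestronglyMeasurable)
      (Filter.Eventually.of_forall hpt)
  refine ⟨hmem, ?_⟩
  calc √(∫ x, ‖f (g x) * (g' x : ℂ)‖ ^ 2) ≤ √(∫ x, M ^ 2 * ‖f (g x)‖ ^ 2) := by
        refine Real.sqrt_le_sqrt (integral_mono (memLp_two_norm hmem)
          ((memLp_two_norm h1).const_mul _) fun x => ?_)
        simp only [← mul_pow]
        exact pow_le_pow_left₀ (norm_nonneg _) (hpt x) 2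
    _ = M * √(∫ x, ‖f (g x)‖ ^ 2) := by
        rw [integral_const_mul, Real.sqrt_mul (sq_nonneg M), Real.sqrt_sq hM]
    _ ≤ _ := mul_le_mul_of_nonneg_left h2 hM

theorem image_Ioc (h : IsDiffeo g g' m M) (x y : ℝ) : g '' Ioc x y = Ioc (g x) (g y) := by
  ext v
  constructor
  · rintro ⟨z, hz, rfl⟩
    exact ⟨h.strictMono hz.1, h.strictMono.monotone hz.2⟩
  · intro hv
    obtain ⟨z, rfl⟩ := h.surjective v
    exact ⟨z, ⟨h.strictMono.lt_iff_lt.1 hv.1, h.strictMono.le_iff_le.1 hv.2⟩, rfl⟩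

theorem isPrim_comp (h : IsDiffeo g g' m M) {F G : ℝ → ℂ} (hp : IsPrim F G)
    (hG : MemLp G 2 volume) : IsPrim (fun x => F (g x)) (fun x => G (g x) * (g' x : ℂ)) := by
  have hl := (h.memLp_comp_mul hG).1.locallyIntegrable'
  have key : ∀ x y, x ≤ y → F (g y) - F (g x) = ∫ z in x..y, G (g z) * (g' z : ℂ) :=
    fun x y hxy => by
    rw [hp.sub_eq, intervalIntegral.integral_of_le hxy,
      intervalIntegral.integral_of_le (h.strictMono.monotone hxy), ← h.image_Ioc,
      integral_image_eq_integral_abs_deriv_smul measurableSet_Ioc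
        (fun x _ => (h.hasDerivAt x).hasDerivWithinAt) h.strictMono.injective.injOn]
    congr 1; ext z
    rw [abs_of_pos (h.deriv_pos z), Complex.real_smul, mul_comm]
  refine ⟨hl, fun x y => ?_⟩
  rcases le_total x y with hxy | hxy
  · exact key x y hxy
  · rw [intervalIntegral.integral_symm, ← key y x hxy]; ring

end IsDiffeo

/-- The weighted norm of a function with derivative. -/
def weightedNorm (k : ℝ) (F G : ℝ → ℂ) : ℝ := k * √(∫ x, ‖F x‖ ^ 2) + √(∫ x, ‖G x‖ ^ 2)

theorem IsDiffeo.weightedNorm_comp_le {g g' : ℝ → ℝ} {m M : ℝ} (h : IsDiffeo g g' m M) {k : ℝ}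
    (hk : 0 ≤ k) {F G : ℝ → ℂ} (hF : MemLp F 2 volume) (hG : MemLp G 2 volume) :
    weightedNorm k (fun x => F (g x)) (fun x => G (g x) * (g' x : ℂ)) ≤
      (1 + M) / √m * weightedNorm k F G := by
  have h1 := (h.memLp_comp hF).2
  have h2 := (h.memLp_comp_mul hG).2
  have hM : 0 ≤ M := ((h.deriv_pos 0).trans_le (h.deriv_le 0)).le
  set X := √(∫ x, ‖F x‖ ^ 2) with hX
  set Y := √(∫ x, ‖G x‖ ^ 2) with hY
  have hX0 : 0 ≤ X := Real.sqrt_nonneg _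
  have hY0 : 0 ≤ Y := Real.sqrt_nonneg _
  rw [weightedNorm, weightedNorm, ← hX, ← hY]
  calc _ ≤ k * (1 / √m * X) + M * (1 / √m * Y) := by gcongr
    -- Nonnegative cross terms are added so that the sum factors.
    _ ≤ (k * (1 / √m * X) + M * (1 / √m * Y)) + (M * (1 / √m * (k * X)) + 1 / √m * Y) :=
        le_add_of_nonneg_right (by positivity)
    _ = _ := by ring

theorem weightedNorm_congr {k : ℝ} {F G G' : ℝ → ℂ} (h : G =ᵐ[volume] G') :
    weightedNorm k F G = weightedNorm k F G' := by
  have e : ∫ x, ‖G x‖ ^ 2 = ∫ x, ‖G' x‖ ^ 2 :=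
    integral_congr_ae (h.mono fun x hx => by simp only [hx])
  rw [weightedNorm, weightedNorm, e]

theorem H1.norm_le_weightedNorm {k : ℝ} (hk : 0 < k) (u : H1 k) :
    ‖u‖ ≤ weightedNorm k u.fn u.der := u.norm_le hk

theorem H1.weightedNorm_le {k : ℝ} (hk : 0 < k) (u : H1 k) :
    weightedNorm k u.fn u.der ≤ 2 * ‖u‖ := by
  rw [two_mul]; exact add_le_add (u.sqrt_fn_le hk) (u.sqrt_der_le hk)

theorem HasWeakDeriv.congr_ae {f f' g : ℝ → ℂ} (h : HasWeakDeriv f g) (hf : f =ᵐ[volume] f') :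
    HasWeakDeriv f' g :=
  ⟨h.1.congr hf, h.2.1, fun φ hφ hc => by
    rw [← h.2.2 φ hφ hc]
    exact integral_congr_ae (hf.mono fun x hx => by simp only [hx])⟩

theorem memH1_of_isPrim {f F G : ℝ → ℂ} (h : IsPrim F G) (hF : MemLp F 2 volume)
    (hG : MemLp G 2 volume) (hf : f =ᵐ[volume] F) (k : ℕ) :
    MemH1 f ∧ normH1 k f = weightedNorm k F G := by
  have hw : HasWeakDeriv f G := h.hasWeakDeriv.congr_ae hf.symm
  have hfm : MemLp f 2 volume := (memLp_congr_ae hf).2 hF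
  refine ⟨⟨hfm, G, hw, hG⟩, ?_⟩
  rw [normH1, weightedNorm, eLpNorm_congr_ae hf, eLpNorm_congr_ae hw.weakDeriv_ae_eq,
    eLpNorm_two_toReal hF, eLpNorm_two_toReal hG]

/-! ### The flow as a change of variables -/

namespace IsShearFlow

variable {b : ℝ → ℝ}

theorem invFun_apply (hb : IsShearFlow b) (y : ℝ) : Function.invFun b (b y) = y :=
  Function.leftInverse_invFun hb.strictMono.injective y

theorem apply_invFun (hb : IsShearFlow b) (v : ℝ) : b (Function.invFun b v) = v :=
  Function.rightInverse_invFun hb.surjective v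

theorem continuous_invFun (hb : IsShearFlow b) : Continuous (Function.invFun b) := by
  obtain ⟨c, hc, h⟩ := hb.deriv_gt
  refine (LipschitzWith.of_dist_le_mul (K := Real.toNNReal (1 / c)) fun v v' => ?_).continuous
  have h1 := hb.mul_abs_sub_le h (Function.invFun b v') (Function.invFun b v)
  rw [hb.apply_invFun, hb.apply_invFun] at h1
  rw [Real.dist_eq, Real.dist_eq, Real.coe_toNNReal _ (by positivity), one_div_mul_eq_div,
    le_div_iff₀ hc]
  linarith

theorem hasDerivAt_invFun (hb : IsShearFlow b) (v : ℝ) :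
    HasDerivAt (Function.invFun b) (deriv b (Function.invFun b v))⁻¹ v :=
  HasDerivAt.of_local_left_inverse hb.continuous_invFun.continuousAt
    (hb.differentiable _).hasDerivAt (hb.deriv_pos _).ne'
    (Filter.Eventually.of_forall hb.apply_invFun)

theorem deriv_flowB (hb : IsShearFlow b) (y : ℝ) :
    deriv (flowB b) (b y) = deriv (deriv b) y / deriv b y := by
  have h1 := ((hb.contDiff_deriv.differentiable (by simp)) (Function.invFun b (b y))).hasDerivAt
  have h2 := (h1.comp (b y) (hb.hasDerivAt_invFun (b y))).deriv
  rw [hb.invFun_apply] at h2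
  exact h2

/-- Off `[-2, 2]` the derivative `b'` is constant on each half-line, so a bound on the compact
interval is global. -/
theorem exists_deriv_le (hb : IsShearFlow b) : ∃ M, ∀ y, deriv b y ≤ M := by
  obtain ⟨M, hM0, hM⟩ := exists_bound_Icc hb.contDiff_deriv.continuous (-2) 2
  have hd := hb.contDiff_deriv.differentiable (by simp)
  refine ⟨M, fun y => ?_⟩
  by_cases hy : y ∈ Icc (-2 : ℝ) 2
  · exact (le_abs_self _).trans (hM y hy)
  have key : ∀ (D : Set ℝ), Convex ℝ D → (∀ z ∈ D, deriv (deriv b) z = 0) → ∀ x ∈ D, ∀ z ∈ D,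
      deriv b x = deriv b z := fun D hD h0 x hx z hz => by
    have := hD.norm_image_sub_le_of_norm_deriv_le (f := deriv b) (C := 0) (fun z _ => hd z)
      (fun z hz => by rw [h0 z hz, norm_zero]) hz hx
    rw [zero_mul] at this
    exact sub_eq_zero.1 (norm_le_zero_iff.1 this)
  rcases lt_or_ge y (-2) with h | h
  · rw [key (Iic (-2)) (convex_Iic _) (fun z hz => ?_) y h.le (-2) self_mem_Iic]
    · exact (le_abs_self _).trans (hM (-2) (by norm_num))
    · rcases eq_or_lt_of_le (mem_Iic.1 hz) with h1 | h1
      · rw [h1]; exact hb.deriv2_two.2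
      · exact hb.deriv_deriv_eq_zero z fun hc => by linarith [hc.1]
  · have h' : 2 < y := not_le.1 fun hc => hy ⟨h, hc⟩
    rw [key (Ici 2) (convex_Ici _) (fun z hz => ?_) y h'.le 2 self_mem_Ici]
    · exact (le_abs_self _).trans (hM 2 (by norm_num))
    · rcases eq_or_lt_of_le (mem_Ici.1 hz) with h1 | h1
      · rw [← h1]; exact hb.deriv2_two.1
      · exact hb.deriv_deriv_eq_zero z fun hc => by linarith [hc.2]

theorem isDiffeo (hb : IsShearFlow b) {c M : ℝ} (hc : 0 < c) (h : ∀ y, c < deriv b y)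
    (hM : ∀ y, deriv b y ≤ M) (w : ℝ) : IsDiffeo (fun y => b y - w) (deriv b) c M where
  hasDerivAt y := (hb.differentiable y).hasDerivAt.sub_const w
  continuous' := hb.contDiff_deriv.continuous
  surjective v := by
    obtain ⟨y, hy⟩ := hb.surjective (v + w)
    exact ⟨y, by simp [hy]⟩
  pos := hc
  le_deriv y := (h y).le
  deriv_le := hM

theorem isDiffeo_invFun (hb : IsShearFlow b) {c M : ℝ} (hc : 0 < c) (h : ∀ y, c < deriv b y)
    (hM : ∀ y, deriv b y ≤ M) (w : ℝ) : IsDiffeo (fun v => Function.invFun b (v + w))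
      (fun v => (deriv b (Function.invFun b (v + w)))⁻¹) M⁻¹ c⁻¹ where
  hasDerivAt v := by
    simpa using (hb.hasDerivAt_invFun (v + w)).comp_add_const v w
  continuous' := Continuous.inv₀ (hb.contDiff_deriv.continuous.comp
    (hb.continuous_invFun.comp (continuous_id.add continuous_const))) fun v => (hb.deriv_pos _).ne'
  surjective y := ⟨b y - w, by simp [hb.invFun_apply]⟩
  pos := inv_pos.2 ((hb.deriv_pos 0).trans_le (hM 0))
  le_deriv v := inv_anti₀ (hb.deriv_pos _) (hM _)
  deriv_le v := inv_anti₀ hc (h _).le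

end IsShearFlow

/-- The operator `T` in the original variables. -/
theorem opT_eq {b : ℝ → ℝ} (hb : IsShearFlow b) {k : ℕ} (hk : 1 ≤ k) {ψ : ℝ → ℝ}
    {M : H1 (k : ℝ) →L[ℂ] H1 (k : ℝ)}
    (hM : ∀ u y, (M u).fn y = ψ y * (u.fn y - sigma₀ k y * u.fn 0 - sigma₁ k y * u.fn 1))
    {s t w : ℝ} (hs : s ^ 2 = 1) (ht : 0 < t) (ht1 : t ≤ 1) {f : ℝ → ℂ} {φ : H1 (k : ℝ)}
    (hφ : ∀ᵐ v, f v = φ.fn (Function.invFun b (v + w))) (v : ℝ) :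
    opT b k ψ (s * t) w f v =
      (M (opA k (flowCoeff b) (logW b s t w) φ)).fn (Function.invFun b (v + w)) := by
  obtain ⟨c, hc, hcb⟩ := hb.deriv_gt
  obtain ⟨Mb, hMb⟩ := hb.exists_deriv_le
  obtain ⟨C, hβ⟩ := hb.exists_isCoeff
  have hk1 : (1 : ℝ) ≤ k := by exact_mod_cast hk
  have hk0 : (0 : ℝ) < k := by linarith
  have hl := memLp_logW hb w hs ht.le ht1
  set y := Function.invFun b (v + w) with hy
  set A := opA k (flowCoeff b) (logW b s t w)
  -- Evaluating `M U` at `y` is pairing with the element `ψ(y) greenH1 k y`, whose values are the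
  -- extended Green function; the defining property of `A` then yields the integral.
  have e1 : (M (A φ)).fn y = ⟪(ψ y : ℂ) • greenH1 k y, A φ⟫_ℂ := by
    rw [hM, greenH1, inner_smul_left, inner_sub_left, inner_sub_left, inner_smul_left,
      inner_smul_left, ← H1.fn_eq_inner, ← H1.fn_eq_inner, ← H1.fn_eq_inner]
    simp only [Complex.conj_ofReal]
  have hfn : ∀ z, ((ψ y : ℂ) • greenH1 k y).fn z = (extGreen k ψ y z : ℂ) := fun z => by
    rw [H1.fn_smul, greenH1_fn hk]
    simp only [extGreen]
    push_cast; ring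
  rw [e1, inner_opA hk1 hβ hl, form_logW hk0 hb hs ht, opT]
  have e2 : ∫ v' : ℝ, ((greenV b k ψ (v + w) (v' + w) * deriv (flowB b) (v' + w) : ℝ) : ℂ) *
      (f v' / ((v' : ℂ) + Complex.I * ((s * t : ℝ) : ℂ))) =
      ∫ v' : ℝ, ((greenV b k ψ (v + w) (v' + w) * deriv (flowB b) (v' + w) : ℝ) : ℂ) *
      (φ.fn (Function.invFun b (v' + w)) / ((v' : ℂ) + Complex.I * ((s * t : ℝ) : ℂ))) :=
    integral_congr_ae (hφ.mono fun x hx => by simp only [hx])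
  rw [e2, (hb.isDiffeo hc hcb hMb w).integral_eq]
  -- The Jacobian `b'` cancels the denominator of `∂B = b'' / b'`.
  have e3 : ∀ z, deriv b z • (((greenV b k ψ (v + w) (b z - w + w) *
      deriv (flowB b) (b z - w + w) : ℝ) : ℂ) * (φ.fn (Function.invFun b (b z - w + w)) /
        (((b z - w : ℝ) : ℂ) + Complex.I * ((s * t : ℝ) : ℂ)))) =
      ((deriv (deriv b) z : ℝ) : ℂ) * (φ.fn z * conj (((ψ y : ℂ) • greenH1 k y).fn z)) /
        (((b z - w : ℝ) : ℂ) + Complex.I * ((s * t : ℝ) : ℂ)) := fun z => by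
    have hd : ((deriv b z : ℝ) : ℂ) ≠ 0 := by exact_mod_cast (hb.deriv_pos z).ne'
    rw [sub_add_cancel, hb.deriv_flowB, hb.invFun_apply, greenV, ← hy, hb.invFun_apply, hfn,
      Complex.conj_ofReal, Complex.real_smul]
    push_cast
    field_simp
  simp only [e3]
  refine integral_eq_Ioc_of_zero (Filter.Eventually.of_forall fun z hz => ?_)
  rw [hb.deriv_deriv_eq_zero z hz]
  simp

end InviscidDamping

end


/-! ### The limiting absorption principle in the original variables. -/

theorem mainTheorem4 (b : ℝ → ℝ) (hb : InviscidDamping.IsShearFlow b)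
    (hL : ∀ k : ℕ, 1 ≤ k → InviscidDamping.NoEmbeddedEigenvalue b k)
    (δ₀ : ℝ) (hδ₀ : 0 < δ₀) (Ψ : ℕ → ℝ → ℝ) (hΨ : InviscidDamping.IsCutoffFamily δ₀ Ψ) :
    ∃ σ₀ : ℝ, 0 < σ₀ ∧
      ∀ ε : ℝ, 0 < |ε| → |ε| ≤ σ₀ → ∀ k : ℕ, 1 ≤ k →
        ∀ f : ℝ → ℂ, InviscidDamping.MemH1 f → ∀ w : ℝ,
          InviscidDamping.MemH1 (fun v => f v + InviscidDamping.opT b k (Ψ k) ε w f v) ∧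
          σ₀ * InviscidDamping.normH1 k f ≤
            InviscidDamping.normH1 k
              (fun v => f v + InviscidDamping.opT b k (Ψ k) ε w f v) := by
  open InviscidDamping in
  obtain ⟨ρ, hρ0, hρ1, hρ⟩ := exists_lower_bound hb hL hδ₀ hΨ
  obtain ⟨c, hc, hcb⟩ := hb.deriv_gt
  obtain ⟨Mb, hMb⟩ := hb.exists_deriv_le
  have hMb0 : 0 < Mb := (hb.deriv_pos 0).trans_le (hMb 0)
  set L₁ : ℝ := (1 + Mb) / √c with hL₁
  set L₂ : ℝ := (1 + c⁻¹) / √(Mb⁻¹) with hL₂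
  have hL₁0 : 0 < L₁ := by have := Real.sqrt_pos.2 hc; positivity
  have hL₂0 : 0 < L₂ := by have := Real.sqrt_pos.2 (inv_pos.2 hMb0); positivity
  -- `L₁` and `L₂` bound the distortion of the weighted norm under the two changes of variables, and
  -- `2` compares the sum norm with the Hilbert norm. The minimum with `ρ` ensures that `|ε|` is
  -- admissible in `exists_lower_bound`.
  refine ⟨min ρ (ρ / (2 * L₂ * L₁)), lt_min hρ0 (by positivity), fun ε hε hεσ k hk f hf w => ?_⟩
  have hk0 : (0 : ℝ) < k := by exact_mod_cast hk
  obtain ⟨M, hM, hlow⟩ := hρ k hk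
  -- the sign and the size of the regularization
  have hερ : |ε| ≤ ρ := hεσ.trans (min_le_left _ _)
  obtain ⟨s, hs, hsε⟩ : ∃ s : ℝ, s ^ 2 = 1 ∧ s * |ε| = ε := by
    rcases abs_cases ε with h | h
    · exact ⟨1, by norm_num, by rw [h.1]; ring⟩
    · exact ⟨-1, by norm_num, by rw [h.1]; ring⟩
  -- the data in the original variable
  obtain ⟨hf2, G, hfG, hG⟩ := hf
  obtain ⟨F, hF, hfF⟩ := hfG.exists_isPrim
  have hF2 : MemLp F 2 volume := (memLp_congr_ae hfF).1 hf2
  have hd := hb.isDiffeo hc hcb hMb w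
  have hi := hb.isDiffeo_invFun hc hcb hMb w
  set φ : H1 (k : ℝ) := H1.mk k (hd.memLp_comp hF2).1 (hd.memLp_comp_mul hG).1
    (hd.isPrim_comp hF hG) with hφd
  have hφF : ∀ v, φ.fn (Function.invFun b (v + w)) = F v := fun v => by
    rw [hφd, H1.fn_mk hk0, hb.apply_invFun, add_sub_cancel_right]
  have hφ : ∀ᵐ v, f v = φ.fn (Function.invFun b (v + w)) := hfF.mono fun v hv => by
    rw [hφF, hv]
  set u := φ + M (opA k (flowCoeff b) (logW b s |ε| w) φ) with hu
  have hfu : (fun v => f v + opT b k (Ψ k) ε w f v) =ᵐ[volume]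
      fun v => u.fn (Function.invFun b (v + w)) := by
    filter_upwards [hφ] with v hv
    have h1 := opT_eq hb hk hM hs hε (hερ.trans hρ1) hφ v
    rw [hsε] at h1
    rw [h1, hv, hu, H1.fn_add]
  -- norms
  have hfW := (memH1_of_isPrim hF hF2 hG hfF k).2
  have hup := hi.isPrim_comp (u.isPrim hk0) u.memLp_der
  obtain ⟨huM, huW⟩ := memH1_of_isPrim hup (hi.memLp_comp (u.memLp_fn hk0)).1
    (hi.memLp_comp_mul u.memLp_der).1 hfu k
  refine ⟨huM, ?_⟩
  rw [hfW, huW]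
  set N := weightedNorm k (fun v => u.fn (Function.invFun b (v + w)))
    (fun v => u.der (Function.invFun b (v + w)) *
      (((deriv b (Function.invFun b (v + w)))⁻¹ : ℝ) : ℂ)) with hN
  have a1 : weightedNorm k F G ≤ L₂ * weightedNorm k φ.fn φ.der := by
    have h1 := hi.weightedNorm_comp_le hk0.le (φ.memLp_fn hk0) φ.memLp_der
    have h2 := hi.isPrim_comp (φ.isPrim hk0) φ.memLp_der
    simp only [hφF] at h1 h2
    rwa [weightedNorm_congr (h2.ae_eq hF)] at h1
  have a2 : weightedNorm k u.fn u.der ≤ L₁ * N := by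
    have h1 := hd.weightedNorm_comp_le hk0.le (hi.memLp_comp (u.memLp_fn hk0)).1
      (hi.memLp_comp_mul u.memLp_der).1
    have h2 := hd.isPrim_comp hup (hi.memLp_comp_mul u.memLp_der).1
    simp only [sub_add_cancel, hb.invFun_apply] at h1 h2
    rwa [weightedNorm_congr (h2.ae_eq (u.isPrim hk0))] at h1
  have a3 : ρ * ‖φ‖ ≤ ‖u‖ := hlow s |ε| w hs hε hερ φ
  have hN0 : 0 ≤ weightedNorm k F G := by unfold weightedNorm; positivity
  have a4 : ρ * weightedNorm k F G ≤ 2 * L₂ * L₁ * N := by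
    calc ρ * weightedNorm k F G ≤ ρ * (L₂ * (2 * ‖φ‖)) := by
          gcongr
          exact a1.trans (by gcongr; exact φ.weightedNorm_le hk0)
      _ = 2 * L₂ * (ρ * ‖φ‖) := by ring
      _ ≤ 2 * L₂ * (L₁ * N) :=
          mul_le_mul_of_nonneg_left (a3.trans ((u.norm_le_weightedNorm hk0).trans a2))
            (by positivity)
      _ = _ := by ring
  calc _ ≤ ρ / (2 * L₂ * L₁) * weightedNorm k F G := by
        gcongr; exact min_le_right _ _
    _ = ρ * weightedNorm k F G / (2 * L₂ * L₁) := by ring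
    _ ≤ N := by
        rw [div_le_iff₀ (by positivity)]
        linarith
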